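/- Let $\gamma\in C^3((0,1])$ be real-valued, and let $\psi:[0,1]\to\mathbb{R}$ be continuous on $[0,1]$ and positive and $C^2$ on $(0,1]$. Suppose that for some $t_0,s_0,C>0$ the following hold (each inequality being required wherever its terms are defined, i.e. the arguments of $\gamma$, $\psi$ and their derivatives lie in $(0,1]$, and those of $\gamma'^{-1}$ are at least $\gamma'(1)$). (a.1) $\gamma,\psi,\gamma',\gamma'',\psi'$ are all monotone on $(0,1]$; moreover $\gamma'>0$ and $\gamma'$ is strictly decreasing on $(0,1]$. (a.2) $\left|\dfrac{\psi'(t)}{\psi(t)}\right|\le\dfrac12\left|\dfrac{\gamma'''(t)}{\gamma''(t)}\right|$ for $0<t<t_0$. (a.3) $|\gamma''(\gamma'^{-1}(2s))|\le C\,|\gamma''(\gamma'^{-1}(s))|$ for $s>s_0$. (a.4) There exist $\epsilon>0$ and $A_0>1+\epsilon$ such that $\gamma'(t)\ge A_0\,\gamma'((1+\epsilon)t)$ for $0<t<t_0$. (a.5) There exists $1/2<\lambda<1$ such that $|\gamma''(t)|\le C\,\gamma'(t)^{2\lambda}$ for $0<t<t_0$. For $\varepsilon>0$ put $T^{\varepsilon}f(x)=\int_\varepsilon^1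 e^{i\gamma(t)}f(x-t)\,\frac{dt}{t}$. Then the operator $$T_1f(x)=\lim_{\varepsilon\to0^+}T^{\varepsilon}f(x)$$ is of weak type $(1,1)$. Precisely, there is a constant $A>0$ such that: (i) for every $f\in C_0^\infty(\mathbb{R})$ (complex-valued) the limit $T_1f(x)$ exists for every $x\in\mathbb{R}$, and $|\{x\in\mathbb{R}:|T_1f(x)|>\alpha\}|\le\frac{A}{\alpha}\|f\|_{L^1}$ for all $\alpha>0$; (ii) for every $f\in L^1(\mathbb{R})$ the functions $T^{\varepsilon}f$ converge in measure, as $\varepsilon\to0^+$, to a measurable function $T_1f$, and $|\{x\in\mathbb{R}:|T_1f(x)|>\alpha\}|\le\frac{A}{\alpha}\|f\|_{L^1}$ for all $\alpha>0$. -/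

import Mathlib

open Set Filter Topology MeasureTheory
open scoped ContDiff ENNReal

noncomputable section

/-- The derivative of a function on `(0,1]` (one-sided at the endpoint `1`). -/
def unitDeriv (f : ℝ → ℝ) : ℝ → ℝ := derivWithin f (Ioc 0 1)

/-- `f` is monotone on `(0,1]`, in either direction. -/
def MonotoneOnUnit (f : ℝ → ℝ) : Prop :=
  MonotoneOn f (Ioc 0 1) ∨ AntitoneOn f (Ioc 0 1)

/-- The inverse of `γ' : (0,1] → ℝ`; meaningful at the values `s` that `γ'` takes on `(0,1]`. -/
def phaseDerivInv (γ : ℝ → ℝ) (s : ℝ) : ℝ :=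
  Function.invFunOn (unitDeriv γ) (Ioc 0 1) s

/-- The regularity and growth assumptions on the phase `γ` and the auxiliary function `ψ`.
The inequalities are only required at points where all the terms are defined: arguments of
`γ`, `ψ` and their derivatives in `(0,1]`, arguments of the inverse of `γ'` at least `γ'(1)`. -/
structure PhaseAssumptions (γ ψ : ℝ → ℝ) (t₀ s₀ C : ℝ) : Prop where
  t₀_pos : 0 < t₀
  s₀_pos : 0 < s₀
  C_pos : 0 < C
  contDiffOn_phase : ContDiffOn ℝ 3 γ (Ioc 0 1)
  continuousOn_psi : ContinuousOn ψ (Icc 0 1)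
  contDiffOn_psi : ContDiffOn ℝ 2 ψ (Ioc 0 1)
  psi_pos : ∀ t ∈ Ioc (0 : ℝ) 1, 0 < ψ t
  monotone_phase : MonotoneOnUnit γ
  monotone_psi : MonotoneOnUnit ψ
  monotone_deriv2_phase : MonotoneOnUnit (unitDeriv (unitDeriv γ))
  monotone_deriv_psi : MonotoneOnUnit (unitDeriv ψ)
  deriv_phase_pos : ∀ t ∈ Ioc (0 : ℝ) 1, 0 < unitDeriv γ t
  deriv_phase_decreasing : StrictAntiOn (unitDeriv γ) (Ioc 0 1)
  ratio_bound : ∀ t ∈ Ioc (0 : ℝ) 1, t < t₀ →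
    |unitDeriv ψ t / ψ t| ≤
      1 / 2 * |unitDeriv (unitDeriv (unitDeriv γ)) t / unitDeriv (unitDeriv γ) t|
  doubling : ∀ s : ℝ, s₀ < s → unitDeriv γ 1 ≤ s →
    |unitDeriv (unitDeriv γ) (phaseDerivInv γ (2 * s))| ≤
      C * |unitDeriv (unitDeriv γ) (phaseDerivInv γ s)|
  growth : ∃ ε A : ℝ, 0 < ε ∧ 1 + ε < A ∧
    ∀ t : ℝ, 0 < t → t < t₀ → (1 + ε) * t ≤ 1 →
      A * unitDeriv γ ((1 + ε) * t) ≤ unitDeriv γ t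
  second_deriv_bound : ∃ l : ℝ, 1 / 2 < l ∧ l < 1 ∧
    ∀ t ∈ Ioc (0 : ℝ) 1, t < t₀ →
      |unitDeriv (unitDeriv γ) t| ≤ C * (unitDeriv γ t) ^ (2 * l)

/-- The truncated operator `f ↦ ∫_ε^1 e^{iγ(t)} f(x - t) dt / t`. -/
def truncatedT (γ : ℝ → ℝ) (ε : ℝ) (f : ℝ → ℂ) (x : ℝ) : ℂ :=
  ∫ t in ε..1, Complex.exp (Complex.I * (γ t : ℂ)) * f (x - t) / (t : ℂ)

/-- The operator `T₁ f(x) = lim_{ε → 0⁺} ∫_ε^1 e^{iγ(t)} f(x - t) dt / t`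
(the pointwise limit, where it exists). -/
def T₁ (γ : ℝ → ℝ) (f : ℝ → ℂ) (x : ℝ) : ℂ :=
  limUnder (𝓝[>] (0 : ℝ)) (fun ε => truncatedT γ ε f x)

/-- The weak-type `(1,1)` inequality with constant `A` between an input `f` and an output `g`:
`|{x : |g(x)| > α}| ≤ (A / α) ‖f‖_{L¹}` for all `α > 0`. -/
def WeakTypeOneOneBound (A : ℝ) (f g : ℝ → ℂ) : Prop :=
  ∀ α : ℝ, 0 < α →
    volume {x : ℝ | α < ‖g x‖} ≤ ENNReal.ofReal (A / α) * eLpNorm f 1 volume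

end

/-! Write `G` for the derivative of the phase. The operator is convolution with `e^{iγ(t)} / t`,
whose oscillation is so fast near `0` that the Calderón–Zygmund regularity condition fails there.
The proof is of the kind used for strongly singular integrals: cancellation of the bad functions is
used only where the phase is slow, and an `L²` estimate replaces it where the phase is fast.

Everything needed about the phase is collected in `SingularPhase`. The essential fields are `decay`,
by which `G` grows at least like `s ^ (-(1 + δ))` towards `0`, and `gap`, by which `G s - G (s + x)`
is at least a fixed multiple of `x * G s / (s + x)`. The first comes from iterating the growth
condition, the second from that condition and the convexity of `G`. With them, integration by parts
bounds the correlation at lag `u` of two pieces of the kernel by a multiple of `1 / (u * q * G q)`,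
where `q` is the right end of the common window. The bound does not see the left end, so truncation
is harmless (`norm_integral_oscKernel_pair_le`). In particular the autocorrelation is `O(|u| ^ (δ /
2 - 1))`, hence integrable uniformly in the truncation, and this is the `L²` bound.

For the weak-type estimate (`exists_weakType_kconv`), decompose `f = g + ∑ b_I` at height `α`. The
good part is handled by the `L²` bound. For each interval `I` the kernel is cut at `2|I|` and at the
scale `η` where `G η = 1 / |I|` (or `η = τ` if `G` is larger than that throughout). Up to `2|I|` the
convolution stays in an enlargement of `I`. Beyond both cuts the phase varies by `O(1)` over a
length `|I|`, and the mean zero of `b_I` suffices (`lintegral_oscTrunc_sub_le`). In between, for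
`|I| ≤ |J|`, the correlation of the two pieces is dominated by a Poisson kernel of scale `|J|`
(`norm_corr_le_poisson`). The `b_I` have mass at most `4α|I|` on disjoint intervals no longer than
`|J|`, so their sum against that kernel is `O(α)`. Summing over `J` bounds the squared `L²` norm of
the middle part by a multiple of `α‖f‖₁`, and Chebyshev's inequality concludes.

The constant is independent of `ε`. For smooth `f`, integration by parts gives uniform convergence
as `ε → 0`; for `f` in `L¹`, density together with the uniform weak-type bound gives convergence in
measure. -/

/-! ### Van der Corput's estimate and singular phases -/

/-- A first-order van der Corput estimate: oscillatory integrals are controlled by the size and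
the variation of the amplitude divided by the derivative of the phase. -/
theorem norm_integral_cexp_mul_le {U : Set ℝ} (hU : IsOpen U) {p q : ℝ} (hpq : p ≤ q)
    (hI : Icc p q ⊆ U) {Φ D W W' : ℝ → ℝ} {w w' : ℝ → ℂ}
    (hΦ : ∀ s ∈ U, HasDerivAt Φ (D s) s) (hD : ContinuousOn D U)
    (hw : ∀ s ∈ U, HasDerivAt w (w' s) s) (hW : ∀ s ∈ U, HasDerivAt W (W' s) s)
    (hb : ∀ s ∈ Icc p q, ‖w' s‖ ≤ W' s) :
    ‖∫ s in p..q, Complex.exp (Complex.I * (Φ s : ℂ)) * (D s : ℂ) * w s‖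
      ≤ ‖w q‖ + ‖w p‖ + (W q - W p) := by
  set e : ℝ → ℂ := fun s => Complex.exp (Complex.I * (Φ s : ℂ)) with he
  have hen : ∀ s, ‖e s‖ = 1 := fun s => by
    rw [he]; simp only [mul_comm Complex.I]; exact Complex.norm_exp_ofReal_mul_I _
  have hed : ∀ s ∈ U, HasDerivAt e (e s * (Complex.I * (D s : ℂ))) s := fun s hs =>
    (((hΦ s hs).ofReal_comp).const_mul Complex.I).cexp
  have hcont : ContinuousOn (fun s => e s * (D s : ℂ) * w s) U := by
    have hec : ContinuousOn e U := fun s hs => (hed s hs).continuousAt.continuousWithinAt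
    have hwc : ContinuousOn w U := fun s hs => (hw s hs).continuousAt.continuousWithinAt
    exact (hec.mul (Complex.continuous_ofReal.comp_continuousOn hD)).mul hwc
  -- `F` is the remainder in integration by parts. Its derivative `i e w'` is dominated by `W'`, so
  -- the mean value inequality bounds it by `W q - W p`, without any integrability assumption on
  -- `w'`.
  set F : ℝ → ℂ := fun s => (∫ t in p..s, e t * (D t : ℂ) * w t)
    + Complex.I * (e s * w s) - Complex.I * (e p * w p) with hF
  have hFd : ∀ s ∈ Icc p q, HasDerivAt F (Complex.I * (e s * w' s)) s := by
    intro s hs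
    have h1 : HasDerivAt (fun s => ∫ t in p..s, e t * (D t : ℂ) * w t)
        (e s * (D s : ℂ) * w s) s := by
      refine intervalIntegral.integral_hasDerivAt_right ?_
        (hcont.stronglyMeasurableAtFilter hU s (hI hs)) (hcont.continuousAt (hU.mem_nhds (hI hs)))
      refine ContinuousOn.intervalIntegrable (hcont.mono ?_)
      rw [uIcc_of_le hs.1]
      exact (Icc_subset_Icc_right hs.2).trans hI
    have h2 := (((hed s (hI hs)).mul (hw s (hI hs))).const_mul Complex.I)
    refine ((h1.add h2).sub_const (Complex.I * (e p * w p))).congr_deriv ?_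
    linear_combination (e s * (D s : ℂ) * w s) * Complex.I_mul_I
  have key := image_norm_le_of_norm_deriv_right_le_deriv_boundary' (a := p) (b := q) (f := F)
    (f' := fun s => Complex.I * (e s * w' s)) (B := fun s => W s - W p) (B' := W')
    (fun s hs => (hFd s hs).continuousAt.continuousWithinAt)
    (fun s hs => (hFd s (Ico_subset_Icc_self hs)).hasDerivWithinAt) (by simp [hF])
    (fun s hs => ((hW s (hI hs)).sub_const _).continuousAt.continuousWithinAt)
    (fun s hs => ((hW s (hI (Ico_subset_Icc_self hs))).sub_const _).hasDerivWithinAt)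
    (fun s hs => by
      simpa [hen s] using hb s (Ico_subset_Icc_self hs)) (right_mem_Icc.2 hpq)
  have : (∫ s in p..q, e s * (D s : ℂ) * w s)
      = F q - Complex.I * (e q * w q) + Complex.I * (e p * w p) := by simp only [hF]; ring
  rw [this]
  refine (norm_add_le _ _).trans ?_
  have := norm_sub_le (F q) (Complex.I * (e q * w q))
  simp only [norm_mul, Complex.norm_I, hen, one_mul] at *
  linarith

/-- The properties of a phase `γ` with derivative `G` on `(0, τ]` that drive the estimates:
super-linear growth of `G` towards `0`, and its consequence for the increments of `G`. -/
structure SingularPhase (γ G G₂ : ℝ → ℝ) (τ δ K : ℝ) : Prop where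
  τ_pos : 0 < τ
  τ_lt_one : τ < 1
  δ_pos : 0 < δ
  δ_le_one : δ ≤ 1
  one_le_K : 1 ≤ K
  continuousOn_phase : ContinuousOn γ (Ioc 0 1)
  hasDerivAt_phase : ∀ t ∈ Ioo (0 : ℝ) 1, HasDerivAt γ (G t) t
  hasDerivAt_deriv : ∀ t ∈ Ioo (0 : ℝ) 1, HasDerivAt G (G₂ t) t
  monotoneOn_deriv₂ : MonotoneOn G₂ (Ioo 0 1)
  deriv_pos : ∀ t ∈ Ioo (0 : ℝ) 1, 0 < G t
  strictAntiOn_deriv : StrictAntiOn G (Ioo 0 1)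
  decay : ∀ s b, 0 < s → s ≤ b → b ≤ τ → G b * (b / s) ^ (1 + δ) ≤ K * G s
  gap : ∀ s x, 0 < s → 0 < x → s + x ≤ τ → x * G s ≤ K * ((s + x) * (G s - G (s + x)))

/-- The kernel `e^{iγ(t)} / t`. -/
noncomputable def oscKernel (γ : ℝ → ℝ) (t : ℝ) : ℂ := Complex.exp (Complex.I * (γ t : ℂ)) / (t : ℂ)

namespace SingularPhase

variable {γ G G₂ : ℝ → ℝ} {τ δ K : ℝ}

theorem deriv₂_nonpos (h : SingularPhase γ G G₂ τ δ K) {t : ℝ} (ht : t ∈ Ioo (0 : ℝ) 1) :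
    G₂ t ≤ 0 := by
  by_contra hc
  push Not at hc
  have h1 : ∀ᶠ s in 𝓝[>] t, 0 < slope G t s :=
    (hasDerivAt_iff_tendsto_slope.1 (h.hasDerivAt_deriv t ht)).mono_left
      (nhdsWithin_mono _ (fun s hs => ne_of_gt hs)) |>.eventually_const_lt hc
  have h2 : ∀ᶠ s in 𝓝[>] t, s ∈ Ioo t 1 := Ioo_mem_nhdsGT ht.2
  obtain ⟨s, hs1, hs2⟩ := (h1.and h2).exists
  have h3 := h.strictAntiOn_deriv ht ⟨ht.1.trans hs2.1, hs2.2⟩ hs2.1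
  rw [slope_def_field] at hs1
  have := div_neg_of_neg_of_pos (sub_neg.2 h3) (sub_pos.2 hs2.1)
  linarith

theorem mem_Ioo (h : SingularPhase γ G G₂ τ δ K) {t : ℝ} (h0 : 0 < t) (h1 : t ≤ τ) :
    t ∈ Ioo (0 : ℝ) 1 := ⟨h0, h1.trans_lt h.τ_lt_one⟩

theorem continuousOn_deriv (h : SingularPhase γ G G₂ τ δ K) : ContinuousOn G (Ioo 0 1) :=
  fun t ht => (h.hasDerivAt_deriv t ht).continuousAt.continuousWithinAt

/-- The quantity `1 / (s * G s)` is what one integration by parts against `e^{iγ(s)} ds / s` leaves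
at the endpoint. Read this way, `decay` says that it vanishes like `s ^ δ`, so an integral is
governed by its upper end and errors of the form `(s / b) ^ δ / s` can be integrated down to `0`. -/
theorem inv_mul_deriv_le (h : SingularPhase γ G G₂ τ δ K) {s b : ℝ} (hs : 0 < s) (hsb : s ≤ b)
    (hb : b ≤ τ) : 1 / (s * G s) ≤ K / (b * G b) * (s / b) ^ δ := by
  have hb0 := hs.trans_le hsb
  have hGs := h.deriv_pos s (h.mem_Ioo hs (hsb.trans hb))
  have hGb := h.deriv_pos b (h.mem_Ioo hb0 hb)
  have hd := h.decay s b hs hsb hb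
  have hx : 0 < (b / s) ^ δ := Real.rpow_pos_of_pos (div_pos hb0 hs) _
  rw [Real.rpow_add (div_pos hb0 hs), Real.rpow_one] at hd
  have e1 : (s / b) ^ δ = ((b / s) ^ δ)⁻¹ := by
    rw [← Real.inv_rpow (div_pos hb0 hs).le, inv_div]
  rw [e1, ← div_eq_mul_inv, div_div, div_le_div_iff₀ (by positivity) (by positivity), one_mul]
  have : G b * (b / s * (b / s) ^ δ) * s = b * G b * (b / s) ^ δ := by field_simp
  nlinarith

theorem inv_mul_deriv_le' (h : SingularPhase γ G G₂ τ δ K) {s b : ℝ} (hs : 0 < s) (hsb : s ≤ b)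
    (hb : b ≤ τ) : 1 / (s * G s) ≤ K / (b * G b) := by
  have hb0 := hs.trans_le hsb
  have hGb := h.deriv_pos b (h.mem_Ioo hb0 hb)
  have hK := h.one_le_K
  refine (h.inv_mul_deriv_le hs hsb hb).trans (mul_le_of_le_one_right (by positivity) ?_)
  exact Real.rpow_le_one (by positivity) ((div_le_one hb0).2 hsb) h.δ_pos.le

end SingularPhase

/-! ### From the hypotheses on the phase to a singular phase -/

theorem unitDeriv_eq_deriv {f : ℝ → ℝ} {t : ℝ} (ht : t ∈ Ioo (0 : ℝ) 1) :
    unitDeriv f t = deriv f t :=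
  derivWithin_of_mem_nhds (mem_of_superset (Ioo_mem_nhds ht.1 ht.2) Ioo_subset_Ioc_self)

theorem hasDerivAt_unitDeriv {f : ℝ → ℝ} {n : WithTop ℕ∞} (hf : ContDiffOn ℝ n f (Ioc 0 1))
    (hn : n ≠ 0) {t : ℝ} (ht : t ∈ Ioo (0 : ℝ) 1) : HasDerivAt f (unitDeriv f t) t := by
  rw [unitDeriv_eq_deriv ht]
  exact ((hf.contDiffAt (mem_of_superset (Ioo_mem_nhds ht.1 ht.2)
    Ioo_subset_Ioc_self)).differentiableAt hn).hasDerivAt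

/-- Iterating the growth condition gives power growth towards `0`. -/
theorem growth_iterate {G : ℝ → ℝ} {e A t₀ : ℝ} (he : 0 < e) (hA : 1 + e < A)
    (hG : ∀ t : ℝ, 0 < t → t < t₀ → (1 + e) * t ≤ 1 → A * G ((1 + e) * t) ≤ G t) (n : ℕ) :
    ∀ s, 0 < s → (1 + e) ^ n * s < t₀ → (1 + e) ^ n * s ≤ 1 → A ^ n * G ((1 + e) ^ n * s) ≤ G s := by
  induction n with
  | zero => intro s; simp
  | succ n ih =>
    intro s hs h1 h2
    have hle : s ≤ (1 + e) ^ n * s := le_mul_of_one_le_left hs.le (one_le_pow₀ (by linarith))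
    have hpos : 0 < (1 + e) ^ n * s := by positivity
    have e1 : (1 + e) ^ (n + 1) * s = (1 + e) * ((1 + e) ^ n * s) := by ring
    rw [e1] at h1 h2 ⊢
    have hlt : (1 + e) ^ n * s < (1 + e) * ((1 + e) ^ n * s) := by nlinarith
    have h3 := hG _ hpos (hlt.trans h1) h2
    have h4 := ih s hs (hlt.trans h1) (hlt.le.trans h2)
    calc A ^ (n + 1) * G ((1 + e) * ((1 + e) ^ n * s))
        = A ^ n * (A * G ((1 + e) * ((1 + e) ^ n * s))) := by ring
      _ ≤ A ^ n * G ((1 + e) ^ n * s) := by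
        have : 0 ≤ A ^ n := pow_nonneg (by linarith) _
        gcongr
      _ ≤ _ := h4

/-- Take `n` with `(1 + e) ^ n ≤ b / s < (1 + e) ^ (n + 1)` and iterate the growth condition `n`
times. Each dilation by `1 + e` gains `A`, which is at least `(1 + e) ^ (1 + δ)`; the factor `A` in
the conclusion pays for the incomplete last dilation. -/
theorem growth_rpow {G : ℝ → ℝ} {e A t₀ δ : ℝ} (he : 0 < e) (hA : 1 + e < A)
    (hG : ∀ t : ℝ, 0 < t → t < t₀ → (1 + e) * t ≤ 1 → A * G ((1 + e) * t) ≤ G t)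
    (hpos : ∀ t ∈ Ioo (0 : ℝ) 1, 0 < G t) (hanti : AntitoneOn G (Ioo 0 1))
    (hδA : (1 + e) ^ (1 + δ) ≤ A) (hδ : 0 < δ)
    {s b : ℝ} (hs : 0 < s) (hsb : s ≤ b) (hb : b < t₀) (hb1 : b < 1) :
    G b * (b / s) ^ (1 + δ) ≤ A * G s := by
  have hb0 := hs.trans_le hsb
  have hx : 1 ≤ b / s := (one_le_div hs).2 hsb
  obtain ⟨n, hn1, hn2⟩ := exists_nat_pow_near hx (by linarith : 1 < 1 + e)
  have hns : (1 + e) ^ n * s ≤ b := by rwa [le_div_iff₀ hs] at hn1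
  have h1 := growth_iterate he hA hG n s hs (hns.trans_lt hb) (hns.trans hb1.le)
  have hm : (1 + e) ^ n * s ∈ Ioo (0 : ℝ) 1 := ⟨by positivity, hns.trans_lt hb1⟩
  have h2 : G b ≤ G ((1 + e) ^ n * s) := hanti hm ⟨hb0, hb1⟩ hns
  have h3 : (b / s) ^ (1 + δ) ≤ A ^ (n + 1) := by
    calc (b / s) ^ (1 + δ) ≤ ((1 + e) ^ (n + 1)) ^ (1 + δ) :=
          Real.rpow_le_rpow (by positivity) hn2.le (by linarith)
      _ = ((1 + e) ^ (1 + δ)) ^ (n + 1) := by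
          rw [← Real.rpow_natCast, ← Real.rpow_natCast, ← Real.rpow_mul (by linarith),
            ← Real.rpow_mul (by linarith), mul_comm]
      _ ≤ A ^ (n + 1) := pow_le_pow_left₀ (by positivity) hδA _
  have hGb := hpos b ⟨hb0, hb1⟩
  have hA0 : 0 < A := by linarith
  calc G b * (b / s) ^ (1 + δ) ≤ G ((1 + e) ^ n * s) * A ^ (n + 1) := by
        gcongr
        exact (hpos _ hm).le
    _ = A * (A ^ n * G ((1 + e) ^ n * s)) := by ring
    _ ≤ A * G s := by gcongr

/-- Decides the direction of monotonicity of the second derivative. If it were decreasing, the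
slopes of `G` to the left of `b` would be bounded below by `G₂ b`, so `G` could not blow up at `0`.
-/
theorem deriv₂_monotoneOn_of_growth {G G₂ : ℝ → ℝ} {δ A b : ℝ}
    (hG : ∀ t ∈ Ioo (0 : ℝ) 1, HasDerivAt G (G₂ t) t)
    (hG2 : MonotoneOn G₂ (Ioo 0 1) ∨ AntitoneOn G₂ (Ioo 0 1)) (hb : b ∈ Ioo (0 : ℝ) 1)
    (hpos : ∀ t ∈ Ioo (0 : ℝ) 1, 0 < G t) (hδ : 0 < δ)
    (hgr : ∀ s, 0 < s → s ≤ b → G b * (b / s) ^ (1 + δ) ≤ A * G s) :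
    MonotoneOn G₂ (Ioo 0 1) := by
  refine hG2.resolve_right fun hanti => ?_
  -- `G` would be bounded near `0`
  set M := G b + |G₂ b| with hM
  have hbd : ∀ s, 0 < s → s ≤ b → G s ≤ M := by
    intro s hs hsb
    rcases hsb.eq_or_lt with rfl | hlt
    · have := abs_nonneg (G₂ s); linarith
    obtain ⟨c, hc, hc'⟩ := exists_hasDerivAt_eq_slope G G₂ hlt
      (fun t ht => (hG t ⟨hs.trans_le ht.1, ht.2.trans_lt hb.2⟩).continuousAt.continuousWithinAt)
      (fun t ht => hG t ⟨hs.trans ht.1, ht.2.trans hb.2⟩)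
    have h1 := hanti ⟨hs.trans hc.1, hc.2.trans hb.2⟩ hb hc.2.le
    rw [hc', le_div_iff₀ (sub_pos.2 hlt)] at h1
    have h2 : -|G₂ b| ≤ G₂ b := neg_abs_le _
    have h3 : b - s ≤ 1 := by linarith [hb.2]
    nlinarith [abs_nonneg (G₂ b)]
  have hlim : Tendsto (fun s : ℝ => G b * (b / s) ^ (1 + δ)) (𝓝[>] 0) atTop := by
    refine Tendsto.const_mul_atTop (hpos b hb) ((tendsto_rpow_atTop (by linarith)).comp ?_)
    change Tendsto (fun s : ℝ => b * s⁻¹) _ _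
    exact tendsto_inv_nhdsGT_zero.const_mul_atTop hb.1
  obtain ⟨s, hs1, hs2⟩ := ((hlim.eventually_gt_atTop (|A| * M)).and
    (Ioc_mem_nhdsGT hb.1)).exists
  have h1 := hgr s hs2.1 hs2.2
  have h2 := hbd s hs2.1 hs2.2
  have h3 := hpos s ⟨hs2.1, hs2.2.trans_lt hb.2⟩
  have : A * G s ≤ |A| * M := by
    calc A * G s ≤ |A| * G s := by gcongr; exact le_abs_self A
      _ ≤ _ := by gcongr
  linarith

/-- Between `s` and `(1 + e) * s` the function `G` loses at least the proportion `(A - 1) / A` of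
its value. If `x ≥ e * s`, monotonicity carries that loss over to `s + x`. If `x ≤ e * s`, convexity
makes the average slope on `[s, s + x]` at least as steep as on `[s, (1 + e) * s]`, so the loss is
at least proportional to `x`. -/
theorem gap_of_growth {G G₂ : ℝ → ℝ} {e A τ : ℝ} (he : 0 < e) (hA : 1 + e < A)
    (hτ : (1 + e) * τ < 1) (hG : ∀ t ∈ Ioo (0 : ℝ) 1, HasDerivAt G (G₂ t) t)
    (hG2 : MonotoneOn G₂ (Ioo 0 1)) (hpos : ∀ t ∈ Ioo (0 : ℝ) 1, 0 < G t)
    (hanti : AntitoneOn G (Ioo 0 1))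
    (hgr : ∀ t, 0 < t → t ≤ τ → A * G ((1 + e) * t) ≤ G t) {s x : ℝ} (hs : 0 < s) (hx : 0 < x)
    (hsx : s + x ≤ τ) :
    x * G s ≤ (1 + e) * A / (A - 1) * ((s + x) * (G s - G (s + x))) := by
  have hsτ : s ≤ τ := by linarith
  have hτ0 : 0 < τ := hs.trans_le hsτ
  have hτ1 : τ < 1 := by nlinarith
  have hGs := hpos s ⟨hs, hsτ.trans_lt hτ1⟩
  have hes : (1 + e) * s < 1 := by nlinarith
  have hconv : ConvexOn ℝ (Ioo 0 1) G := by
    refine MonotoneOn.convexOn_of_deriv (convex_Ioo 0 1)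
      (fun t ht => (hG t ht).continuousAt.continuousWithinAt) ?_ ?_
    · rw [interior_Ioo]
      exact fun t ht => (hG t ht).differentiableAt.differentiableWithinAt
    · rw [interior_Ioo]
      exact hG2.congr fun t ht => (hG t ht).deriv.symm
  have hA1 : 0 < A - 1 := by linarith
  have hmain : (A - 1) / A * G s ≤ G s - G ((1 + e) * s) := by
    have h1 := hgr s hs hsτ
    rw [div_mul_eq_mul_div, div_le_iff₀ (by linarith)]
    nlinarith
  have key : x * ((A - 1) / A * G s) ≤ (1 + e) * ((s + x) * (G s - G (s + x))) := by
    rcases le_total (e * s) x with hle | hle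
    · have h1 : G (s + x) ≤ G ((1 + e) * s) :=
        hanti ⟨by positivity, hes⟩ ⟨by linarith, by linarith⟩ (by linarith)
      have h2 : (A - 1) / A * G s ≤ G s - G (s + x) := by linarith
      have h3 : 0 ≤ (A - 1) / A * G s := by have : 0 < A := by linarith
                                            positivity
      calc x * ((A - 1) / A * G s) ≤ ((1 + e) * (s + x)) * (G s - G (s + x)) := by
            apply mul_le_mul _ h2 h3 (by positivity)
            nlinarith
        _ = _ := by ring
    · have h1 : e * s * (G (s + x)) ≤ (e * s - x) * G s + x * G ((1 + e) * s) := by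
        have hes' : 0 < e * s := by positivity
        have := hconv.2 (show s ∈ Ioo (0 : ℝ) 1 from ⟨hs, by linarith⟩)
          (show (1 + e) * s ∈ Ioo (0 : ℝ) 1 from ⟨by positivity, hes⟩)
          (show 0 ≤ (e * s - x) / (e * s) from div_nonneg (by linarith) hes'.le)
          (show 0 ≤ x / (e * s) by positivity) (by field_simp; ring)
        simp only [smul_eq_mul] at this
        have e1 : (e * s - x) / (e * s) * s + x / (e * s) * ((1 + e) * s) = s + x := by
          field_simp; ring
        rw [e1] at this
        calc e * s * G (s + x) ≤ e * s * ((e * s - x) / (e * s) * G s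
              + x / (e * s) * G ((1 + e) * s)) := by gcongr
          _ = _ := by field_simp
      have h2 : x * (G s - G ((1 + e) * s)) ≤ e * s * (G s - G (s + x)) := by linarith
      have h4 : G (s + x) ≤ G s := hanti ⟨hs, by linarith⟩ ⟨by linarith, by linarith⟩ (by linarith)
      calc x * ((A - 1) / A * G s) ≤ x * (G s - G ((1 + e) * s)) := by gcongr
        _ ≤ e * s * (G s - G (s + x)) := h2
        _ ≤ (1 + e) * (s + x) * (G s - G (s + x)) := by
          have : 0 ≤ G s - G (s + x) := by linarith
          gcongr <;> linarith
        _ = _ := by ring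
  calc x * G s = A / (A - 1) * (x * ((A - 1) / A * G s)) := by
        have : A ≠ 0 := by linarith
        field_simp
    _ ≤ A / (A - 1) * ((1 + e) * ((s + x) * (G s - G (s + x)))) := by
        have : 0 ≤ A / (A - 1) := div_nonneg (by linarith) hA1.le
        gcongr
    _ = _ := by ring

theorem PhaseAssumptions.exists_singularPhase {γ ψ : ℝ → ℝ} {t₀ s₀ C : ℝ}
    (h : PhaseAssumptions γ ψ t₀ s₀ C) :
    ∃ τ δ K : ℝ, SingularPhase γ (unitDeriv γ) (unitDeriv (unitDeriv γ)) τ δ K := by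
  obtain ⟨e, A, he, hA, hgr⟩ := h.growth
  have hud : UniqueDiffOn ℝ (Ioc (0 : ℝ) 1) := uniqueDiffOn_Ioc 0 1
  have hG1 : ContDiffOn ℝ 2 (unitDeriv γ) (Ioc 0 1) :=
    h.contDiffOn_phase.derivWithin hud (by norm_num)
  have hd1 : ∀ t ∈ Ioo (0 : ℝ) 1, HasDerivAt γ (unitDeriv γ t) t := fun t ht =>
    hasDerivAt_unitDeriv h.contDiffOn_phase (by norm_num) ht
  have hd2 : ∀ t ∈ Ioo (0 : ℝ) 1, HasDerivAt (unitDeriv γ) (unitDeriv (unitDeriv γ) t) t :=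
    fun t ht => hasDerivAt_unitDeriv hG1 (by norm_num) ht
  have hpos : ∀ t ∈ Ioo (0 : ℝ) 1, 0 < unitDeriv γ t := fun t ht =>
    h.deriv_phase_pos t (Ioo_subset_Ioc_self ht)
  have hanti : StrictAntiOn (unitDeriv γ) (Ioo 0 1) :=
    h.deriv_phase_decreasing.mono Ioo_subset_Ioc_self
  -- The strict inequality `1 + e < A` leaves room, by continuity in the exponent, for a power
  -- strictly above `1`. This `δ` is the source of all convergence below.
  have hδ : ∃ δ : ℝ, 0 < δ ∧ δ ≤ 1 ∧ (1 + e) ^ (1 + δ) ≤ A := by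
    have hc : Tendsto (fun δ : ℝ => (1 + e) ^ (1 + δ)) (𝓝[>] 0) (𝓝 ((1 + e) ^ (1 + (0 : ℝ)))) := by
      refine Tendsto.mono_left (Continuous.tendsto ?_ 0) nhdsWithin_le_nhds
      exact Continuous.rpow continuous_const (by fun_prop) (fun x => Or.inl (by linarith))
    rw [add_zero, Real.rpow_one] at hc
    obtain ⟨δ, h1, h2⟩ := ((hc.eventually_lt_const hA).and
      (Ioc_mem_nhdsGT (zero_lt_one))).exists
    exact ⟨δ, h2.1, h2.2, h1.le⟩
  obtain ⟨δ, hδ0, hδ1, hδA⟩ := hδ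
  -- The second bound keeps `(1 + e) * t` inside `(0, 1)` for all `t ≤ τ`, so that the growth
  -- condition applies there and the derivatives are two-sided.
  set τ : ℝ := min (t₀ / 2) (1 / (2 * (1 + e))) with hτ
  have hτ0 : 0 < τ := lt_min (half_pos h.t₀_pos) (by positivity)
  have hτt : τ < t₀ := (min_le_left _ _).trans_lt (half_lt_self h.t₀_pos)
  have hτe : (1 + e) * τ < 1 := by
    have : τ ≤ 1 / (2 * (1 + e)) := min_le_right _ _
    rw [le_div_iff₀ (by positivity)] at this
    linarith
  have hτ1 : τ < 1 := by nlinarith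
  have hdecay : ∀ s b, 0 < s → s ≤ b → b ≤ τ →
      unitDeriv γ b * (b / s) ^ (1 + δ) ≤ A * unitDeriv γ s := fun s b hs hsb hb =>
    growth_rpow he hA hgr hpos hanti.antitoneOn hδA hδ0 hs hsb (hb.trans_lt hτt) (hb.trans_lt hτ1)
  have hmono : MonotoneOn (unitDeriv (unitDeriv γ)) (Ioo 0 1) :=
    deriv₂_monotoneOn_of_growth hd2 (h.monotone_deriv2_phase.imp
      (fun H => H.mono Ioo_subset_Ioc_self) (fun H => H.mono Ioo_subset_Ioc_self))
      ⟨hτ0, hτ1⟩ hpos hδ0 (fun s hs hsb => hdecay s τ hs hsb le_rfl)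
  have hA1 : 0 < A - 1 := by linarith
  refine ⟨τ, δ, max A ((1 + e) * A / (A - 1)), hτ0, hτ1, hδ0, hδ1, le_max_of_le_left (by linarith),
    h.contDiffOn_phase.continuousOn, hd1, hd2, hmono, hpos, hanti, fun s b hs hsb hb => (hdecay s b hs hsb hb).trans ?_,
    fun s x hs hx hsx => (gap_of_growth he hA hτe hd2 hmono hpos hanti.antitoneOn
      (fun t ht htτ => hgr t ht (htτ.trans_lt hτt) (by nlinarith)) hs hx hsx).trans ?_⟩
  · have := hpos s ⟨hs, hsb.trans_lt (hb.trans_lt hτ1)⟩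
    gcongr
    exact le_max_left _ _
  · have h1 : unitDeriv γ (s + x) ≤ unitDeriv γ s := hanti.antitoneOn
      ⟨hs, by linarith⟩ ⟨by linarith, by linarith⟩ (by linarith)
    have : 0 ≤ unitDeriv γ s - unitDeriv γ (s + x) := by linarith
    gcongr
    exact le_max_right _ _

/-! ### Integration by parts for products of kernels and for tails -/

theorem hasDerivAt_div_rpow {q δ s : ℝ} (hq : 0 < q) (hs : 0 < s) :
    HasDerivAt (fun s : ℝ => (s / q) ^ δ) (δ * ((s / q) ^ δ / s)) s := by
  have h1 : HasDerivAt (fun s : ℝ => s / q) (1 / q) s := (hasDerivAt_id s).div_const q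
  refine (h1.rpow_const (p := δ) (Or.inl (by positivity))).congr_deriv ?_
  rw [Real.rpow_sub_one (by positivity)]
  field_simp

theorem norm_cexp_I_mul_ofReal (x : ℝ) : ‖Complex.exp (Complex.I * (x : ℂ))‖ = 1 := by
  rw [mul_comm]; exact Complex.norm_exp_ofReal_mul_I x

theorem norm_oscKernel (γ : ℝ → ℝ) {t : ℝ} (ht : 0 < t) : ‖oscKernel γ t‖ = 1 / t := by
  rw [oscKernel, norm_div, norm_cexp_I_mul_ofReal, Complex.norm_real, Real.norm_of_nonneg ht.le]

theorem conj_oscKernel (γ : ℝ → ℝ) (t : ℝ) : (starRingEnd ℂ) (oscKernel γ t)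
    = Complex.exp (-(Complex.I * (γ t : ℂ))) / (t : ℂ) := by
  rw [oscKernel, map_div₀, ← Complex.exp_conj]
  simp

/-- If `r > 0` and `r' ≤ m`, the absolute value of `(1/r)'` is `(1/r)'` up to an error. -/
theorem abs_neg_div_sq_le {r r' m : ℝ} (hm : 0 ≤ m) (h : r' ≤ m) :
    |-r' / r ^ 2| ≤ -r' / r ^ 2 + 2 * (m / r ^ 2) := by
  have h2 : 0 ≤ m / r ^ 2 := by positivity
  have h3 : r' / r ^ 2 ≤ m / r ^ 2 := by gcongr
  rw [neg_div, abs_le]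
  constructor <;> linarith

namespace SingularPhase

variable {γ G G₂ : ℝ → ℝ} {τ δ K : ℝ}

/-- The phase `γ s - γ (s + u)` has derivative `D = G s - G (s + u) > 0`, so the amplitude to
control is `1 / r` with `r = s (s + u) D`. By `gap` and `decay`, `1 / r` is at most `κ (s / q) ^ δ`.
As `D` is decreasing, `1 / r` fails to be increasing only through the derivative of `s (s + u)`, an
error of order `1 / (s r)`, which integrates to `O(κ)`. The bound is uniform in the lower end `p`.
-/
theorem norm_integral_oscKernel_pair_le (h : SingularPhase γ G G₂ τ δ K) {p q u : ℝ} (hp : 0 < p)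
    (hpq : p ≤ q) (hu : 0 < u) (hq : q + u ≤ τ) :
    ‖∫ s in p..q, oscKernel γ s * (starRingEnd ℂ) (oscKernel γ (s + u))‖
      ≤ K ^ 2 * (2 + 4 / δ) / (u * (q * G q)) := by
  have hK := h.one_le_K
  have hδ := h.δ_pos
  have hτ1 := h.τ_lt_one
  have hq0 : 0 < q := hp.trans_le hpq
  have hGq := h.deriv_pos q (h.mem_Ioo hq0 (by linarith))
  set U : Set ℝ := Ioo 0 (1 - u) with hU
  have hU1 : ∀ s ∈ U, s ∈ Ioo (0 : ℝ) 1 := fun s hs => ⟨hs.1, by linarith [hs.2]⟩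
  have hU2 : ∀ s ∈ U, s + u ∈ Ioo (0 : ℝ) 1 := fun s hs => ⟨by linarith [hs.1], by linarith [hs.2]⟩
  have hIU : Icc p q ⊆ U := fun s hs => ⟨hp.trans_le hs.1, by linarith [hs.2]⟩
  set D : ℝ → ℝ := fun s => G s - G (s + u) with hD
  have hDpos : ∀ s ∈ U, 0 < D s := fun s hs =>
    sub_pos.2 (h.strictAntiOn_deriv (hU1 s hs) (hU2 s hs) (by linarith))
  have hDd : ∀ s ∈ U, HasDerivAt D (G₂ s - G₂ (s + u)) s := fun s hs =>
    (h.hasDerivAt_deriv s (hU1 s hs)).sub ((h.hasDerivAt_deriv _ (hU2 s hs)).comp_add_const s u)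
  have hDd' : ∀ s ∈ U, G₂ s - G₂ (s + u) ≤ 0 := fun s hs =>
    sub_nonpos.2 (h.monotoneOn_deriv₂ (hU1 s hs) (hU2 s hs) (by linarith))
  set r : ℝ → ℝ := fun s => s * (s + u) * D s with hr
  set r' : ℝ → ℝ := fun s => (2 * s + u) * D s + s * (s + u) * (G₂ s - G₂ (s + u)) with hr'
  have hrpos : ∀ s ∈ U, 0 < r s := fun s hs => by
    have := hDpos s hs; have := hs.1; simp only [hr]; positivity
  have hrd : ∀ s ∈ U, HasDerivAt r (r' s) s := fun s hs => by
    refine (((hasDerivAt_id s).mul ((hasDerivAt_id s).add_const u)).mul (hDd s hs)).congr_deriv ?_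
    simp only [hr', id, one_mul, mul_one, Pi.mul_apply]
    ring
  have hvd : ∀ s ∈ U, HasDerivAt (fun s => (r s)⁻¹) (-r' s / r s ^ 2) s := fun s hs =>
    (hrd s hs).inv (hrpos s hs).ne'
  set κ : ℝ := K ^ 2 / (u * (q * G q)) with hκ
  have hκ0 : 0 ≤ κ := by positivity
  have hrinv : ∀ s ∈ Icc p q, (r s)⁻¹ ≤ κ * (s / q) ^ δ := by
    intro s hs
    have hsU := hIU hs
    have hs0 := hsU.1
    have hGs := h.deriv_pos s (hU1 s hsU)
    have h1 := h.gap s u hs0 hu (by linarith [hs.2])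
    have h2 := h.inv_mul_deriv_le hs0 hs.2 (by linarith)
    have h3 : (r s)⁻¹ ≤ K / u * (1 / (s * G s)) := by
      rw [div_mul_div_comm, mul_one, inv_eq_one_div, div_le_div_iff₀ (hrpos s hsU) (by positivity)]
      simp only [hr, hD]
      nlinarith
    calc (r s)⁻¹ ≤ K / u * (1 / (s * G s)) := h3
      _ ≤ K / u * (K / (q * G q) * (s / q) ^ δ) := by gcongr
      _ = _ := by rw [hκ]; field_simp
  have key := norm_integral_cexp_mul_le (U := U) isOpen_Ioo hpq hIU
    (Φ := fun s => γ s - γ (s + u)) (D := D)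
    (w := fun s => (((r s)⁻¹ : ℝ) : ℂ)) (w' := fun s => ((-r' s / r s ^ 2 : ℝ) : ℂ))
    -- The majorant contains `1 / r` itself, so that the boundary term at `p` cancels in the end.
    -- The power absorbs the error `2 m / r ^ 2 ≤ (4 / s) κ (s / q) ^ δ`.
    (W := fun s => (r s)⁻¹ + 4 * κ / δ * (s / q) ^ δ)
    (W' := fun s => -r' s / r s ^ 2 + 4 * κ / δ * (δ * ((s / q) ^ δ / s)))
    (fun s hs => (h.hasDerivAt_phase s (hU1 s hs)).sub
      ((h.hasDerivAt_phase _ (hU2 s hs)).comp_add_const s u))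
    (fun s hs => (hDd s hs).continuousAt.continuousWithinAt)
    (fun s hs => (hvd s hs).ofReal_comp)
    (fun s hs => (hvd s hs).add ((hasDerivAt_div_rpow hq0 hs.1).const_mul _))
    (fun s hs => by
      have hsU := hIU hs
      have hs0 := hsU.1
      have hDs := hDpos s hsU
      have hrs := hrpos s hsU
      rw [Complex.norm_real, Real.norm_eq_abs]
      refine (abs_neg_div_sq_le (m := (2 * s + u) * D s) (by positivity) ?_).trans ?_
      · simp only [hr']
        have := mul_nonpos_of_nonneg_of_nonpos (a := s * (s + u)) (by positivity) (hDd' s hsU)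
        linarith
      · have h1 : (2 * s + u) * D s / r s ^ 2 ≤ 2 / s * (r s)⁻¹ := by
          rw [div_mul_eq_mul_div, ← div_eq_mul_inv, div_div, div_le_div_iff₀ (by positivity)
            (by positivity)]
          have : (2 * s + u) * D s * s ≤ 2 * r s := by
            simp only [hr]; nlinarith [mul_pos hs0 hDs, mul_pos hu (mul_pos hs0 hDs)]
          nlinarith
        have h2 : 2 / s * (r s)⁻¹ ≤ 2 / s * (κ * (s / q) ^ δ) := by
          have := hrinv s hs
          gcongr
        have h3 : 4 * κ / δ * (δ * ((s / q) ^ δ / s)) = 2 * (2 / s * (κ * (s / q) ^ δ)) := by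
          field_simp; ring
        rw [h3]
        linarith)
  have hcongr : (∫ s in p..q, oscKernel γ s * (starRingEnd ℂ) (oscKernel γ (s + u)))
      = ∫ s in p..q, Complex.exp (Complex.I * ((γ s - γ (s + u) : ℝ) : ℂ)) * (D s : ℂ)
        * (((r s)⁻¹ : ℝ) : ℂ) := by
    refine intervalIntegral.integral_congr fun s hs => ?_
    rw [uIcc_of_le hpq] at hs
    have hsU := hIU hs
    have hDs : (D s : ℂ) ≠ 0 := by exact_mod_cast (hDpos s hsU).ne'
    have hs0 : (s : ℂ) ≠ 0 := by exact_mod_cast hsU.1.ne'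
    have hsu : (s : ℂ) + u ≠ 0 := by exact_mod_cast (hU2 s hsU).1.ne'
    rw [conj_oscKernel]
    simp only [oscKernel, hr]
    push_cast
    rw [mul_sub, sub_eq_add_neg, Complex.exp_add]
    field_simp
  rw [hcongr]
  refine key.trans ?_
  have hpp := hrpos p (hIU (left_mem_Icc.2 hpq))
  have hqq := hrpos q (hIU (right_mem_Icc.2 hpq))
  have h1 := hrinv q (right_mem_Icc.2 hpq)
  rw [div_self hq0.ne', Real.one_rpow, mul_one] at h1
  have h2 : 0 ≤ 4 * κ / δ * (p / q) ^ δ := by positivity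
  simp only [Complex.norm_real, Real.norm_eq_abs, abs_of_pos (inv_pos.2 hpp),
    abs_of_pos (inv_pos.2 hqq), div_self hq0.ne', Real.one_rpow, mul_one]
  have h3 : K ^ 2 * (2 + 4 / δ) / (u * (q * G q)) = 2 * κ + 4 * κ / δ := by
    rw [hκ]; field_simp
  rw [h3]
  linarith

/-- The same integration by parts for a single kernel against a `C¹` function, with amplitude `f (x
- s) / (s * G s)`. The factor `(b / τ) ^ δ` makes the truncations uniformly Cauchy in `x`. -/
theorem norm_integral_tail_le (h : SingularPhase γ G G₂ τ δ K) {f f' : ℝ → ℂ} {M : ℝ}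
    (hf : ∀ x, HasDerivAt f (f' x) x) (hM : ∀ x, ‖f x‖ ≤ M) (hM' : ∀ x, ‖f' x‖ ≤ M) {a b : ℝ}
    (ha : 0 < a) (hab : a ≤ b) (hb : b ≤ τ) (x : ℝ) :
    ‖∫ t in a..b, Complex.exp (Complex.I * (γ t : ℂ)) * f (x - t) / (t : ℂ)‖
      ≤ M * (K / (τ * G τ)) * (2 + 3 / δ) * (b / τ) ^ δ := by
  have hK := h.one_le_K
  have hδ := h.δ_pos
  have hτ0 := h.τ_pos
  have hτ1 := h.τ_lt_one
  have hM0 : 0 ≤ M := (norm_nonneg _).trans (hM 0)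
  have hGτ := h.deriv_pos τ (h.mem_Ioo hτ0 le_rfl)
  set κ : ℝ := K / (τ * G τ) with hκ
  have hκ0 : 0 ≤ κ := by positivity
  have hIU : Icc a b ⊆ Ioo (0 : ℝ) 1 := fun s hs => h.mem_Ioo (ha.trans_le hs.1) (hs.2.trans hb)
  set r : ℝ → ℝ := fun s => s * G s with hr
  have hrpos : ∀ s ∈ Ioo (0 : ℝ) 1, 0 < r s := fun s hs => mul_pos hs.1 (h.deriv_pos s hs)
  set r' : ℝ → ℝ := fun s => G s + s * G₂ s with hr'
  have hrd : ∀ s ∈ Ioo (0 : ℝ) 1, HasDerivAt r (r' s) s := fun s hs => by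
    refine ((hasDerivAt_id s).mul (h.hasDerivAt_deriv s hs)).congr_deriv ?_
    simp only [hr', id, one_mul]
  have hvd : ∀ s ∈ Ioo (0 : ℝ) 1, HasDerivAt (fun s => (r s)⁻¹) (-r' s / r s ^ 2) s :=
    fun s hs => (hrd s hs).inv (hrpos s hs).ne'
  have hrinv : ∀ s ∈ Icc a b, (r s)⁻¹ ≤ κ * (s / τ) ^ δ := fun s hs => by
    simpa [hr] using h.inv_mul_deriv_le (ha.trans_le hs.1) (hs.2.trans hb) le_rfl
  have key := norm_integral_cexp_mul_le (U := Ioo (0 : ℝ) 1) isOpen_Ioo hab hIU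
    (Φ := γ) (D := G)
    (w := fun s => f (x - s) * (((r s)⁻¹ : ℝ) : ℂ))
    (w' := fun s => -f' (x - s) * (((r s)⁻¹ : ℝ) : ℂ) + f (x - s) * ((-r' s / r s ^ 2 : ℝ) : ℂ))
    -- Of the three units in the constant, two come from the derivative of `1 / r` and one from
    -- `f'`, using `1 / r ≤ 1 / (r s)` for `s < 1`.
    (W := fun s => M * ((r s)⁻¹ + 3 * κ / δ * (s / τ) ^ δ))
    (W' := fun s => M * (-r' s / r s ^ 2 + 3 * κ / δ * (δ * ((s / τ) ^ δ / s))))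
    h.hasDerivAt_phase h.continuousOn_deriv
    (fun s hs => ((hf (x - s)).comp_const_sub x s).mul (hvd s hs).ofReal_comp)
    (fun s hs => ((hvd s hs).add ((hasDerivAt_div_rpow hτ0 hs.1).const_mul _)).const_mul M)
    (fun s hs => by
      have hsU := hIU hs
      have hs0 := hsU.1
      have hrs := hrpos s hsU
      have hGs := h.deriv_pos s hsU
      have h1 := abs_neg_div_sq_le (r := r s) (m := G s) hGs.le (show r' s ≤ G s by
        have := mul_nonpos_of_nonneg_of_nonpos hs0.le (h.deriv₂_nonpos hsU)
        simp only [hr']; linarith)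
      have h2 : G s / r s ^ 2 = (r s)⁻¹ / s := by simp only [hr]; field_simp
      have h4 : (r s)⁻¹ / s ≤ κ * (s / τ) ^ δ / s := by have := hrinv s hs; gcongr
      have h5 : (r s)⁻¹ ≤ (r s)⁻¹ / s := by
        rw [le_div_iff₀ hs0]; exact mul_le_of_le_one_right (by positivity) hsU.2.le
      have h6 : 3 * κ / δ * (δ * ((s / τ) ^ δ / s)) = 3 * (κ * (s / τ) ^ δ / s) := by
        field_simp
      refine (norm_add_le _ _).trans ?_
      rw [norm_mul, norm_mul, norm_neg, Complex.norm_real, Complex.norm_real, Real.norm_eq_abs,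
        Real.norm_eq_abs, abs_of_pos (inv_pos.2 hrs)]
      calc ‖f' (x - s)‖ * (r s)⁻¹ + ‖f (x - s)‖ * |-r' s / r s ^ 2|
          ≤ M * (r s)⁻¹ + M * |-r' s / r s ^ 2| := by gcongr; exacts [hM' _, hM _]
        _ = M * ((r s)⁻¹ + |-r' s / r s ^ 2|) := by ring
        _ ≤ _ := by gcongr M * ?_; rw [h6]; linarith)
  have hcongr : (∫ t in a..b, Complex.exp (Complex.I * (γ t : ℂ)) * f (x - t) / (t : ℂ))
      = ∫ s in a..b, Complex.exp (Complex.I * (γ s : ℂ)) * (G s : ℂ)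
        * (f (x - s) * (((r s)⁻¹ : ℝ) : ℂ)) := by
    refine intervalIntegral.integral_congr fun s hs => ?_
    rw [uIcc_of_le hab] at hs
    have hsU := hIU hs
    have hGs : (G s : ℂ) ≠ 0 := by exact_mod_cast (h.deriv_pos s hsU).ne'
    have hs0 : (s : ℂ) ≠ 0 := by exact_mod_cast hsU.1.ne'
    simp only [hr]
    push_cast
    field_simp
  rw [hcongr]
  refine key.trans ?_
  have hpp := hrpos a (hIU (left_mem_Icc.2 hab))
  have hqq := hrpos b (hIU (right_mem_Icc.2 hab))
  have h1 := hrinv b (right_mem_Icc.2 hab)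
  have ha' : 0 ≤ (a / τ) ^ δ := by positivity
  simp only [norm_mul, Complex.norm_real, Real.norm_eq_abs, abs_of_pos (inv_pos.2 hpp),
    abs_of_pos (inv_pos.2 hqq)]
  calc _ ≤ M * (r b)⁻¹ + M * (r a)⁻¹ + (M * ((r b)⁻¹ + 3 * κ / δ * (b / τ) ^ δ)
        - M * ((r a)⁻¹ + 3 * κ / δ * (a / τ) ^ δ)) := by gcongr; exacts [hM _, hM _]
    _ = M * (2 * (r b)⁻¹ + 3 * κ / δ * (b / τ) ^ δ - 3 * κ / δ * (a / τ) ^ δ) := by ring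
    _ ≤ M * (2 * (κ * (b / τ) ^ δ) + 3 * κ / δ * (b / τ) ^ δ) := by
      gcongr M * ?_
      have : 0 ≤ 3 * κ / δ * (a / τ) ^ δ := by positivity
      linarith
    _ = _ := by field_simp

end SingularPhase

/-! ### Convolutions, correlations and Fubini -/

/-- Bounded measurable functions vanishing outside a bounded interval. -/
structure BddSupp (f : ℝ → ℂ) : Prop where
  measurable : Measurable f
  bdd : ∃ M : ℝ, ∀ x, ‖f x‖ ≤ M
  supp : ∃ R : ℝ, ∀ x, R < |x| → f x = 0

/-- The convolution of a kernel with a function. -/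
noncomputable def kconv (κ b : ℝ → ℂ) (x : ℝ) : ℂ := ∫ y, κ (x - y) * b y

/-- The correlation of two kernels. -/
noncomputable def corr (κ₁ κ₂ : ℝ → ℂ) (v : ℝ) : ℂ := ∫ s, κ₁ s * (starRingEnd ℂ) (κ₂ (s + v))

namespace BddSupp

variable {f g κ b : ℝ → ℂ}

theorem integrable (hf : BddSupp f) : Integrable f := by
  obtain ⟨M, hM⟩ := hf.bdd
  obtain ⟨R, hR⟩ := hf.supp
  have h1 : IntegrableOn f (Icc (-R) R) :=
    Measure.integrableOn_of_bounded (M := M) (by simp) hf.measurable.aestronglyMeasurable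
      (Eventually.of_forall hM)
  refine (integrableOn_iff_integrable_of_support_subset fun x hx => ?_).1 h1
  by_contra hc
  rw [mem_Icc, ← abs_le, not_le] at hc
  exact hx (hR x hc)

theorem zero : BddSupp (fun _ => 0) := ⟨measurable_const, ⟨0, by simp⟩, ⟨0, by simp⟩⟩

theorem add (hf : BddSupp f) (hg : BddSupp g) : BddSupp (fun x => f x + g x) := by
  obtain ⟨M, hM⟩ := hf.bdd
  obtain ⟨R, hR⟩ := hf.supp
  obtain ⟨M', hM'⟩ := hg.bdd
  obtain ⟨R', hR'⟩ := hg.supp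
  refine ⟨hf.measurable.add hg.measurable, ⟨M + M', fun x =>
    (norm_add_le _ _).trans (add_le_add (hM x) (hM' x))⟩, ⟨max R R', fun x hx => ?_⟩⟩
  rw [hR x ((le_max_left _ _).trans_lt hx), hR' x ((le_max_right _ _).trans_lt hx), add_zero]

theorem mul_bdd (hf : BddSupp f) (hg : Measurable g) {M : ℝ} (hM : ∀ x, ‖g x‖ ≤ M) :
    BddSupp (fun x => g x * f x) := by
  obtain ⟨M', hM'⟩ := hf.bdd
  obtain ⟨R, hR⟩ := hf.supp
  refine ⟨hg.mul hf.measurable, ⟨M * M', fun x => ?_⟩, ⟨R, fun x hx => by rw [hR x hx, mul_zero]⟩⟩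
  rw [norm_mul]
  exact mul_le_mul (hM x) (hM' x) (norm_nonneg _) ((norm_nonneg _).trans (hM x))

theorem neg (hf : BddSupp f) : BddSupp (fun x => -f x) := by
  simpa using hf.mul_bdd (g := fun _ => -1) measurable_const (M := 1) (by simp)

theorem sub (hf : BddSupp f) (hg : BddSupp g) : BddSupp (fun x => f x - g x) := by
  simpa [sub_eq_add_neg] using hf.add hg.neg

theorem conj (hf : BddSupp f) : BddSupp (fun x => (starRingEnd ℂ) (f x)) := by
  obtain ⟨M, hM⟩ := hf.bdd
  obtain ⟨R, hR⟩ := hf.supp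
  exact ⟨Complex.continuous_conj.measurable.comp hf.measurable, ⟨M, fun x => by simpa using hM x⟩,
    ⟨R, fun x hx => by simp [hR x hx]⟩⟩

theorem sum {ι : Type*} {s : Finset ι} {F : ι → ℝ → ℂ} (hF : ∀ i ∈ s, BddSupp (F i)) :
    BddSupp (fun x => ∑ i ∈ s, F i x) := by
  classical
  induction s using Finset.induction_on with
  | empty => simpa using zero
  | insert i s hi ih =>
    simp only [Finset.sum_insert hi]
    exact (hF i (Finset.mem_insert_self i s)).add
      (ih fun j hj => hF j (Finset.mem_insert_of_mem hj))

theorem indicator (hf : BddSupp f) {s : Set ℝ} (hs : MeasurableSet s) :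
    BddSupp (s.indicator f) := by
  classical
  obtain ⟨M, hM⟩ := hf.bdd
  obtain ⟨R, hR⟩ := hf.supp
  refine ⟨hf.measurable.indicator hs, ⟨M, fun x => (norm_indicator_le_norm_self _ _).trans (hM x)⟩,
    ⟨R, fun x hx => ?_⟩⟩
  rw [indicator_apply, hR x hx, ite_self]

theorem integrable_kconv_aux (hκ : BddSupp κ) (hb : BddSupp b) (x : ℝ) :
    Integrable (fun y => κ (x - y) * b y) := by
  obtain ⟨M, hM⟩ := hκ.bdd
  exact (hb.mul_bdd (hκ.measurable.comp (measurable_const.sub measurable_id))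
    (fun y => hM (x - y))).integrable

theorem kconv (hκ : BddSupp κ) (hb : BddSupp b) : BddSupp (kconv κ b) := by
  obtain ⟨M, hM⟩ := hκ.bdd
  obtain ⟨R, hR⟩ := hκ.supp
  obtain ⟨R', hR'⟩ := hb.supp
  refine ⟨?_, ⟨M * ∫ y, ‖b y‖, fun x => ?_⟩, ⟨R + R', fun x hx => ?_⟩⟩
  · have : Measurable (fun p : ℝ × ℝ => κ (p.1 - p.2) * b p.2) :=
      (hκ.measurable.comp (measurable_fst.sub measurable_snd)).mul (hb.measurable.comp measurable_snd)
    exact (this.stronglyMeasurable.integral_prod_right (ν := volume)).measurable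
  · rw [← integral_const_mul]
    refine norm_integral_le_of_norm_le (hb.integrable.norm.const_mul M)
      (Eventually.of_forall fun y => ?_)
    rw [norm_mul]
    exact mul_le_mul_of_nonneg_right (hM _) (norm_nonneg _)
  · refine integral_eq_zero_of_ae (Eventually.of_forall fun y => ?_)
    change κ (x - y) * b y = 0
    rcases lt_or_ge R' |y| with h | h
    · rw [hR' y h, mul_zero]
    · rw [hR (x - y), zero_mul]
      have := abs_sub_abs_le_abs_sub x y
      linarith

theorem kconv_add (hκ : BddSupp κ) (hf : BddSupp f) (hg : BddSupp g) (x : ℝ) :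
    _root_.kconv κ (fun y => f y + g y) x = _root_.kconv κ f x + _root_.kconv κ g x := by
  simp only [_root_.kconv, mul_add]
  exact integral_add (hκ.integrable_kconv_aux hf x) (hκ.integrable_kconv_aux hg x)

theorem kconv_sum {ι : Type*} {s : Finset ι} {F : ι → ℝ → ℂ} (hκ : BddSupp κ)
    (hF : ∀ i ∈ s, BddSupp (F i)) (x : ℝ) :
    _root_.kconv κ (fun y => ∑ i ∈ s, F i y) x = ∑ i ∈ s, _root_.kconv κ (F i) x := by
  simp only [_root_.kconv, Finset.mul_sum]
  exact integral_finsetSum s fun i hi => hκ.integrable_kconv_aux (hF i hi) x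

theorem add_kconv (hf : BddSupp f) (hg : BddSupp g) (hb : BddSupp b) (x : ℝ) :
    _root_.kconv (fun y => f y + g y) b x = _root_.kconv f b x + _root_.kconv g b x := by
  simp only [_root_.kconv, add_mul]
  exact integral_add (hf.integrable_kconv_aux hb x) (hg.integrable_kconv_aux hb x)

theorem lintegral_enorm_kconv_le (hκ : BddSupp κ) (hb : BddSupp b) :
    ∫⁻ x, ‖_root_.kconv κ b x‖ₑ ≤ (∫⁻ x, ‖κ x‖ₑ) * ∫⁻ y, ‖b y‖ₑ := by
  calc ∫⁻ x, ‖_root_.kconv κ b x‖ₑ ≤ ∫⁻ x, ∫⁻ y, ‖κ (x - y) * b y‖ₑ :=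
        lintegral_mono fun x => enorm_integral_le_lintegral_enorm _
    _ = ∫⁻ y, ∫⁻ x, ‖κ (x - y) * b y‖ₑ := by
        refine lintegral_lintegral_swap (Measurable.aemeasurable ?_)
        exact ((hκ.measurable.comp (measurable_fst.sub measurable_snd)).mul
          (hb.measurable.comp measurable_snd)).enorm
    _ = ∫⁻ y, (∫⁻ x, ‖κ x‖ₑ) * ‖b y‖ₑ := by
        refine lintegral_congr fun y => ?_
        simp only [enorm_mul]
        rw [lintegral_mul_const'' _ (by
          exact (hκ.measurable.comp (measurable_id.sub_const y)).enorm.aemeasurable),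
          lintegral_sub_right_eq_self (fun x => ‖κ x‖ₑ) y]
    _ = _ := lintegral_const_mul _ hb.measurable.enorm

/-- Convolution of a kernel with a function of mean zero. -/
theorem lintegral_enorm_kconv_le_of_integral_eq_zero (hκ : BddSupp κ) (hb : BddSupp b)
    (h0 : ∫ y, b y = 0) {a : ℝ} {B : ℝ≥0∞}
    (hB : ∀ y, b y ≠ 0 → ∫⁻ x, ‖κ (x - (y - a)) - κ x‖ₑ ≤ B) :
    ∫⁻ x, ‖_root_.kconv κ b x‖ₑ ≤ B * ∫⁻ y, ‖b y‖ₑ := by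
  have h1 : ∀ x, _root_.kconv κ b x = ∫ y, (κ (x - y) - κ (x - a)) * b y := by
    intro x
    simp only [_root_.kconv, sub_mul]
    rw [integral_sub (hκ.integrable_kconv_aux hb x) (hb.integrable.const_mul _),
      integral_const_mul, h0, mul_zero, sub_zero]
  calc ∫⁻ x, ‖_root_.kconv κ b x‖ₑ ≤ ∫⁻ x, ∫⁻ y, ‖(κ (x - y) - κ (x - a)) * b y‖ₑ := by
        refine lintegral_mono fun x => ?_
        rw [h1]
        exact enorm_integral_le_lintegral_enorm _
    _ = ∫⁻ y, ∫⁻ x, ‖(κ (x - y) - κ (x - a)) * b y‖ₑ := by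
        refine lintegral_lintegral_swap (Measurable.aemeasurable ?_)
        exact (((hκ.measurable.comp (measurable_fst.sub measurable_snd)).sub
          (hκ.measurable.comp (measurable_fst.sub_const a))).mul
          (hb.measurable.comp measurable_snd)).enorm
    _ ≤ ∫⁻ y, B * ‖b y‖ₑ := by
        refine lintegral_mono fun y => ?_
        simp only [enorm_mul]
        rw [lintegral_mul_const'' _ (by
          exact ((hκ.measurable.comp (measurable_id.sub_const y)).sub
            (hκ.measurable.comp (measurable_id.sub_const a))).enorm.aemeasurable)]
        by_cases hy : b y = 0
        · simp [hy]
        gcongr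
        refine le_trans (le_of_eq ?_) (hB y hy)
        rw [← lintegral_sub_right_eq_self (fun x => ‖κ (x - (y - a)) - κ x‖ₑ) a]
        simp
    _ = _ := lintegral_const_mul _ hb.measurable.enorm

/-- Fubini with the kernel variable innermost. The oscillation is integrated first, inside `corr`,
so absolute values may be taken afterwards without losing it. This takes the place of Plancherel in
all `L²` estimates. -/
theorem integral_kconv_mul_conj {κ₁ κ₂ b₁ b₂ : ℝ → ℂ} (hκ₁ : BddSupp κ₁) (hκ₂ : BddSupp κ₂)
    (hb₁ : BddSupp b₁) (hb₂ : BddSupp b₂) :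
    ∫ x, _root_.kconv κ₁ b₁ x * (starRingEnd ℂ) (_root_.kconv κ₂ b₂ x)
      = ∫ w : ℝ × ℝ, b₁ w.2 * (starRingEnd ℂ) (b₂ w.1) * corr κ₁ κ₂ (w.2 - w.1) := by
  set k : ℝ → ℝ × ℝ → ℂ := fun x w =>
    (κ₁ (x - w.2) * b₁ w.2) * (starRingEnd ℂ) (κ₂ (x - w.1) * b₂ w.1) with hk
  have hmeas : Measurable (Function.uncurry k) := by
    have m1 : Measurable (fun p : ℝ × ℝ × ℝ => κ₁ (p.1 - p.2.2) * b₁ p.2.2) :=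
      (hκ₁.measurable.comp (measurable_fst.sub measurable_snd.snd)).mul
        (hb₁.measurable.comp measurable_snd.snd)
    have m2 : Measurable (fun p : ℝ × ℝ × ℝ => κ₂ (p.1 - p.2.1) * b₂ p.2.1) :=
      (hκ₂.measurable.comp (measurable_fst.sub measurable_snd.fst)).mul
        (hb₂.measurable.comp measurable_snd.fst)
    exact m1.mul (Complex.continuous_conj.measurable.comp m2)
  have hint : Integrable (Function.uncurry k) (volume.prod (volume.prod volume)) := by
    obtain ⟨M₁, hM₁⟩ := hκ₁.bdd
    obtain ⟨R₁, hR₁⟩ := hκ₁.supp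
    obtain ⟨M₂, hM₂⟩ := hκ₂.bdd
    obtain ⟨N₁, hN₁⟩ := hb₁.bdd
    obtain ⟨T₁, hT₁⟩ := hb₁.supp
    obtain ⟨N₂, hN₂⟩ := hb₂.bdd
    obtain ⟨T₂, hT₂⟩ := hb₂.supp
    set S : Set (ℝ × ℝ × ℝ) := Icc (-(R₁ + T₁)) (R₁ + T₁) ×ˢ (Icc (-T₂) T₂ ×ˢ Icc (-T₁) T₁)
    have hS : (volume.prod (volume.prod volume)) S ≠ ⊤ := by
      rw [Measure.prod_prod, Measure.prod_prod]
      exact ENNReal.mul_ne_top (by simp) (ENNReal.mul_ne_top (by simp) (by simp))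
    have h1 : IntegrableOn (Function.uncurry k) S (volume.prod (volume.prod volume)) := by
      refine Measure.integrableOn_of_bounded (M := (M₁ * N₁) * (M₂ * N₂)) hS
        hmeas.aestronglyMeasurable (Eventually.of_forall fun p => ?_)
      simp only [Function.uncurry, hk, norm_mul, RCLike.norm_conj]
      have a1 := norm_nonneg (κ₁ (p.1 - p.2.2))
      have a2 := norm_nonneg (κ₂ (p.1 - p.2.1))
      have a3 := norm_nonneg (b₁ p.2.2)
      have a4 := norm_nonneg (b₂ p.2.1)
      have := a1.trans (hM₁ _)
      have := a2.trans (hM₂ _)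
      have := a3.trans (hN₁ _)
      gcongr <;> first | exact hM₁ _ | exact hM₂ _ | exact hN₁ _ | exact hN₂ _
    refine (integrableOn_iff_integrable_of_support_subset fun p hp => ?_).1 h1
    simp only [Function.mem_support, Function.uncurry, hk, ne_eq, mul_eq_zero, map_mul,
      map_eq_zero, not_or] at hp
    obtain ⟨⟨p1, p2⟩, p3, p4⟩ := hp
    have q1 : |p.1 - p.2.2| ≤ R₁ := not_lt.1 fun hc => p1 (hR₁ _ hc)
    have q2 : |p.2.2| ≤ T₁ := not_lt.1 fun hc => p2 (hT₁ _ hc)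
    have q4 : |p.2.1| ≤ T₂ := not_lt.1 fun hc => p4 (hT₂ _ hc)
    have q5 : |p.1| ≤ R₁ + T₁ := by
      have := abs_sub_abs_le_abs_sub p.1 p.2.2
      linarith
    exact ⟨abs_le.1 q5, abs_le.1 q4, abs_le.1 q2⟩
  calc ∫ x, _root_.kconv κ₁ b₁ x * (starRingEnd ℂ) (_root_.kconv κ₂ b₂ x)
      = ∫ x, ∫ w, k x w ∂(volume.prod volume) := by
        refine integral_congr_ae (Eventually.of_forall fun x => ?_)
        simp only [_root_.kconv, hk]
        rw [← integral_conj, mul_comm, ← integral_prod_mul]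
        exact integral_congr_ae (Eventually.of_forall fun w => mul_comm _ _)
    _ = ∫ w, (∫ x, k x w) ∂(volume.prod volume) := integral_integral_swap hint
    _ = _ := by
        refine integral_congr_ae (Eventually.of_forall fun w => ?_)
        simp only [corr, hk]
        rw [← integral_const_mul, ← integral_sub_right_eq_self (fun s => b₁ w.2 *
          (starRingEnd ℂ) (b₂ w.1) * (κ₁ s * (starRingEnd ℂ) (κ₂ (s + (w.2 - w.1))))) w.2]
        refine integral_congr_ae (Eventually.of_forall fun x => ?_)
        simp only [map_mul, sub_add_sub_cancel]
        ring

theorem enorm_integral_kconv_mul_conj_le {κ₁ κ₂ b₁ b₂ : ℝ → ℂ} (hκ₁ : BddSupp κ₁)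
    (hκ₂ : BddSupp κ₂) (hb₁ : BddSupp b₁) (hb₂ : BddSupp b₂) :
    ‖∫ x, _root_.kconv κ₁ b₁ x * (starRingEnd ℂ) (_root_.kconv κ₂ b₂ x)‖ₑ
      ≤ ∫⁻ z, ‖b₂ z‖ₑ * ∫⁻ y, ‖b₁ y‖ₑ * ‖corr κ₁ κ₂ (y - z)‖ₑ := by
  have hcorr : Measurable (corr κ₁ κ₂) := by
    have : Measurable (fun p : ℝ × ℝ => κ₁ p.2 * (starRingEnd ℂ) (κ₂ (p.2 + p.1))) :=
      (hκ₁.measurable.comp measurable_snd).mul (Complex.continuous_conj.measurable.comp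
        (hκ₂.measurable.comp (measurable_snd.add measurable_fst)))
    exact (this.stronglyMeasurable.integral_prod_right (ν := volume)).measurable
  rw [integral_kconv_mul_conj hκ₁ hκ₂ hb₁ hb₂]
  refine (enorm_integral_le_lintegral_enorm _).trans ?_
  have hm : Measurable (fun w : ℝ × ℝ =>
      b₁ w.2 * (starRingEnd ℂ) (b₂ w.1) * corr κ₁ κ₂ (w.2 - w.1)) :=
    ((hb₁.measurable.comp measurable_snd).mul (Complex.continuous_conj.measurable.comp
      (hb₂.measurable.comp measurable_fst))).mul
      (hcorr.comp (measurable_snd.sub measurable_fst))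
  rw [Measure.volume_eq_prod, lintegral_prod _ hm.enorm.aemeasurable]
  refine le_of_eq (lintegral_congr fun z => ?_)
  rw [← lintegral_const_mul]
  · refine lintegral_congr fun y => ?_
    simp only [enorm_mul]
    have : ‖(starRingEnd ℂ) (b₂ z)‖ₑ = ‖b₂ z‖ₑ := by
      rw [← ofReal_norm, RCLike.norm_conj, ofReal_norm]
    rw [this]
    ring
  · exact hb₁.measurable.enorm.mul (hcorr.comp (measurable_id.sub_const z)).enorm

end BddSupp

/-! ### Correlations of truncated kernels -/

theorem integrableOn_Ioi_inv_sq {c : ℝ} (hc : 0 < c) : IntegrableOn (fun s : ℝ => 1 / s ^ 2) (Ioi c) := by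
  refine (integrableOn_Ioi_rpow_of_lt (by norm_num : (-2 : ℝ) < -1) hc).congr_fun (fun s hs => ?_)
    measurableSet_Ioi
  change s ^ (-2 : ℝ) = 1 / s ^ 2
  rw [Real.rpow_neg (hc.trans hs).le, one_div]
  norm_num

theorem integral_Ioi_inv_sq {c : ℝ} (hc : 0 < c) : ∫ s in Ioi c, 1 / s ^ 2 = 1 / c := by
  have h1 : ∫ s in Ioi c, 1 / s ^ 2 = ∫ s in Ioi c, s ^ (-2 : ℝ) := by
    refine setIntegral_congr_fun measurableSet_Ioi fun s hs => ?_
    rw [Real.rpow_neg (hc.trans hs).le, one_div]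
    norm_num
  rw [h1, integral_Ioi_rpow_of_lt (by norm_num) hc]
  norm_num [Real.rpow_neg_one]

/-- The kernel `e^{iγ(t)} / t` restricted to `p < t ≤ q`. -/
noncomputable def oscTrunc (γ : ℝ → ℝ) (p q : ℝ) : ℝ → ℂ := (Ioc p q).indicator (oscKernel γ)

theorem norm_oscTrunc_le (γ : ℝ → ℝ) {p q : ℝ} (hp : 0 < p) (x : ℝ) :
    ‖oscTrunc γ p q x‖ ≤ 1 / p := by
  by_cases hx : x ∈ Ioc p q
  · rw [oscTrunc, indicator_of_mem hx, norm_oscKernel γ (hp.trans hx.1)]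
    exact one_div_le_one_div_of_le hp hx.1.le
  · rw [oscTrunc, indicator_of_notMem hx, norm_zero]
    positivity

theorem corr_eq_conj (κ₁ κ₂ : ℝ → ℂ) (v : ℝ) : corr κ₁ κ₂ v = (starRingEnd ℂ) (corr κ₂ κ₁ (-v)) := by
  simp only [corr]
  rw [← integral_conj, ← integral_add_right_eq_self _ (-v)]
  refine integral_congr_ae (Eventually.of_forall fun s => ?_)
  simp [mul_comm]

theorem norm_corr_comm (κ₁ κ₂ : ℝ → ℂ) (v : ℝ) : ‖corr κ₁ κ₂ v‖ = ‖corr κ₂ κ₁ (-v)‖ := by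
  rw [corr_eq_conj, RCLike.norm_conj]

theorem corr_oscTrunc (γ : ℝ → ℝ) (p₁ q₁ p₂ q₂ u : ℝ) :
    corr (oscTrunc γ p₁ q₁) (oscTrunc γ p₂ q₂) u = ∫ s in Ioc (max p₁ (p₂ - u)) (min q₁ (q₂ - u)),
      oscKernel γ s * (starRingEnd ℂ) (oscKernel γ (s + u)) := by
  rw [corr, ← integral_indicator measurableSet_Ioc]
  refine integral_congr_ae (Eventually.of_forall fun s => ?_)
  simp only [oscTrunc, indicator_apply, mem_Ioc, max_lt_iff, le_min_iff]
  by_cases h1 : p₁ < s ∧ s ≤ q₁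
  · by_cases h2 : p₂ < s + u ∧ s + u ≤ q₂
    · rw [if_pos h1, if_pos h2, if_pos ⟨⟨h1.1, by linarith⟩, h1.2, by linarith⟩]
    · rw [if_neg h2, if_neg (fun h3 : (p₁ < s ∧ p₂ - u < s) ∧ s ≤ q₁ ∧ s ≤ q₂ - u =>
        h2 ⟨by linarith [h3.1.2], by linarith [h3.2.2]⟩), map_zero, mul_zero]
  · rw [if_neg h1, if_neg (fun h3 : (p₁ < s ∧ p₂ - u < s) ∧ s ≤ q₁ ∧ s ≤ q₂ - u =>
      h1 ⟨h3.1.1, h3.2.1⟩), zero_mul]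

theorem corr_oscTrunc_eq_zero (γ : ℝ → ℝ) {p₁ q₁ p₂ q₂ v : ℝ} (hp₁ : 0 < p₁) (hp₂ : 0 < p₂)
    (h₁ : q₁ ≤ |v|) (h₂ : q₂ ≤ |v|) : corr (oscTrunc γ p₁ q₁) (oscTrunc γ p₂ q₂) v = 0 := by
  rw [corr_oscTrunc, Ioc_eq_empty, setIntegral_empty]
  rw [max_lt_iff, lt_min_iff, lt_min_iff]
  rintro ⟨⟨a1, a2⟩, a3, a4⟩
  rcases abs_cases v with ⟨h, -⟩ | ⟨h, -⟩ <;> rw [h] at h₁ h₂ <;> linarith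

namespace SingularPhase

variable {γ G G₂ : ℝ → ℝ} {τ δ K : ℝ}

theorem continuousOn_oscKernel (h : SingularPhase γ G G₂ τ δ K) :
    ContinuousOn (oscKernel γ) (Ioc 0 1) := by
  refine ContinuousOn.div ?_ Complex.continuous_ofReal.continuousOn
    fun t ht => by exact_mod_cast ht.1.ne'
  exact Complex.continuous_exp.comp_continuousOn
    (continuousOn_const.mul (Complex.continuous_ofReal.comp_continuousOn h.continuousOn_phase))

theorem bddSupp_oscTrunc (h : SingularPhase γ G G₂ τ δ K) {p q : ℝ} (hp : 0 < p) (hq : q ≤ 1) :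
    BddSupp (oscTrunc γ p q) := by
  classical
  refine ⟨?_, ⟨1 / p, norm_oscTrunc_le γ hp⟩, ⟨1, fun x hx => indicator_of_notMem ?_ _⟩⟩
  · rw [oscTrunc, ← piecewise_eq_indicator]
    exact (h.continuousOn_oscKernel.mono fun t ht =>
      ⟨hp.trans ht.1, ht.2.trans hq⟩).measurable_piecewise continuousOn_const
      measurableSet_Ioc
  · intro hx'
    rw [abs_of_pos (hp.trans hx'.1)] at hx
    linarith [hx'.2]

/-- The common window ends at `min q₁ (q₂ - u)`, which lies below `Q` as soon as one of `q₁`, `q₂`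
does. Moving the estimate from that end to `Q` costs the third factor `K`. -/
theorem norm_corr_le_of_pos (h : SingularPhase γ G G₂ τ δ K) {p₁ q₁ p₂ q₂ u Q : ℝ} (hp₁ : 0 < p₁)
    (hq₂ : q₂ ≤ τ) (hu : 0 < u) (hQ : Q ≤ τ) (hQ0 : 0 < Q) (hqQ : q₁ ≤ Q ∨ q₂ ≤ Q) :
    ‖corr (oscTrunc γ p₁ q₁) (oscTrunc γ p₂ q₂) u‖ ≤ K ^ 3 * (2 + 4 / δ) / (u * (Q * G Q)) := by
  have hK := h.one_le_K
  have hδ := h.δ_pos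
  have hGQ := h.deriv_pos Q (h.mem_Ioo hQ0 hQ)
  rw [corr_oscTrunc]
  set p := max p₁ (p₂ - u)
  set q := min q₁ (q₂ - u)
  have hp : 0 < p := hp₁.trans_le (le_max_left _ _)
  rcases le_or_gt p q with hpq | hpq
  · have hq0 := hp.trans_le hpq
    have hq' : q ≤ q₂ - u := min_le_right _ _
    have hqQ' : q ≤ Q := by
      rcases hqQ with hq | hq
      · exact (min_le_left _ _).trans hq
      · linarith
    rw [← intervalIntegral.integral_of_le hpq]
    refine (h.norm_integral_oscKernel_pair_le hp hpq hu (by linarith)).trans ?_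
    have h1 := h.inv_mul_deriv_le' hq0 hqQ' hQ
    have hGq := h.deriv_pos q (h.mem_Ioo hq0 (hqQ'.trans hQ))
    calc K ^ 2 * (2 + 4 / δ) / (u * (q * G q))
        = K ^ 2 * (2 + 4 / δ) / u * (1 / (q * G q)) := by field_simp
      _ ≤ K ^ 2 * (2 + 4 / δ) / u * (K / (Q * G Q)) := by gcongr
      _ = _ := by field_simp
  · rw [Ioc_eq_empty (not_lt.2 hpq.le), setIntegral_empty, norm_zero]
    positivity

theorem norm_corr_le (h : SingularPhase γ G G₂ τ δ K) {p₁ q₁ p₂ q₂ v Q : ℝ} (hp₁ : 0 < p₁)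
    (hp₂ : 0 < p₂) (hq₁ : q₁ ≤ τ) (hq₂ : q₂ ≤ τ) (hv : v ≠ 0) (hQ : Q ≤ τ) (hQ0 : 0 < Q)
    (hqQ : q₁ ≤ Q ∨ q₂ ≤ Q) :
    ‖corr (oscTrunc γ p₁ q₁) (oscTrunc γ p₂ q₂) v‖ ≤ K ^ 3 * (2 + 4 / δ) / (|v| * (Q * G Q)) := by
  rcases lt_or_gt_of_ne hv with hv | hv
  · rw [norm_corr_comm, abs_of_neg hv]
    exact h.norm_corr_le_of_pos hp₂ hq₁ (by linarith) hQ hQ0 hqQ.symm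
  · rw [abs_of_pos hv]
    exact h.norm_corr_le_of_pos hp₁ hq₂ hv hQ hQ0 hqQ

/-- The correlation of two truncated kernels is dominated by a Poisson kernel. -/
theorem norm_corr_le_poisson (h : SingularPhase γ G G₂ τ δ K) {p₁ q₁ p₂ q₂ d η : ℝ} (hd : 0 < d)
    (hp₁ : 2 * d ≤ p₁) (hp₂ : 0 < p₂) (hq₁ : q₁ ≤ η) (hq₂ : q₂ ≤ η) (hη : η ≤ τ) (hη0 : 0 < η)
    (hG : 1 / d ≤ G η) (v : ℝ) :
    ‖corr (oscTrunc γ p₁ q₁) (oscTrunc γ p₂ q₂) v‖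
      ≤ 2 * (K ^ 3 * (2 + 4 / δ)) * (d / (d ^ 2 + v ^ 2)) := by
  have hK := h.one_le_K
  have hδ := h.δ_pos
  have hC : 2 ≤ K ^ 3 * (2 + 4 / δ) := by
    have h1 : 1 ≤ K ^ 3 := one_le_pow₀ hK
    have h2 : 0 ≤ 4 / δ := by positivity
    nlinarith
  set C := K ^ 3 * (2 + 4 / δ) with hCdef
  -- For `|v| ≤ d` no oscillation is needed: since `s > 2 * d`, also `s + v ≥ s / 2`, and the
  -- product of the kernels is at most `2 / s ^ 2`.
  rcases le_or_gt |v| d with hvd | hvd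
  · have h1 : ‖corr (oscTrunc γ p₁ q₁) (oscTrunc γ p₂ q₂) v‖ ≤ 2 / d := by
      rw [corr]
      have e1 : 2 / d = ∫ s, (Ioi d).indicator (fun s => 2 * (1 / s ^ 2)) s := by
        rw [integral_indicator measurableSet_Ioi, integral_const_mul, integral_Ioi_inv_sq hd]
        ring
      rw [e1]
      have hint : IntegrableOn (fun s : ℝ => 2 * (1 / s ^ 2)) (Ioi d) :=
        (integrableOn_Ioi_inv_sq hd).const_mul 2
      refine norm_integral_le_of_norm_le (hint.integrable_indicator measurableSet_Ioi)
        (Eventually.of_forall fun s => ?_)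
      rw [norm_mul, RCLike.norm_conj]
      have hnn : 0 ≤ (Ioi d).indicator (fun s : ℝ => 2 * (1 / s ^ 2)) s :=
        indicator_nonneg (fun s _ => by positivity) s
      by_cases hs : s ∈ Ioc p₁ q₁
      · by_cases hs' : s + v ∈ Ioc p₂ q₂
        · have hds : 2 * d < s := hp₁.trans_lt hs.1
          have hs0 : 0 < s := by linarith
          have hsv : 0 < s + v := hp₂.trans hs'.1
          have h2 : s / 2 ≤ s + v := by linarith [(abs_le.1 hvd).1]
          rw [oscTrunc, oscTrunc, indicator_of_mem hs, indicator_of_mem hs', norm_oscKernel γ hs0,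
            norm_oscKernel γ hsv, indicator_of_mem (show s ∈ Ioi d from by
              rw [mem_Ioi]; linarith), div_mul_div_comm, mul_one, ← mul_div_assoc, mul_one,
            div_le_div_iff₀ (by positivity) (by positivity)]
          nlinarith
        · rw [oscTrunc, oscTrunc, indicator_of_notMem hs', norm_zero, mul_zero]
          exact hnn
      · rw [oscTrunc, oscTrunc, indicator_of_notMem hs, norm_zero, zero_mul]
        exact hnn
    refine h1.trans ?_
    have h2 : v ^ 2 ≤ d ^ 2 := sq_le_sq.2 (by rwa [abs_of_pos hd])
    calc 2 / d = 4 * (d / (d ^ 2 + d ^ 2)) := by field_simp; ring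
      _ ≤ 4 * (d / (d ^ 2 + v ^ 2)) := by gcongr
      _ ≤ 2 * C * (d / (d ^ 2 + v ^ 2)) := by gcongr; linarith
  · have hv0 : 0 < |v| := hd.trans hvd
    have hv : v ≠ 0 := abs_pos.1 hv0
    rcases le_or_gt η |v| with hηv | hηv
    · rw [corr_oscTrunc_eq_zero γ (by linarith) hp₂ (hq₁.trans hηv) (hq₂.trans hηv), norm_zero]
      positivity
    -- For `d < |v| < η` the denominator `|v| * η * G η` is at least `v ^ 2 / d`, because `G η ≥ 1 /
    -- d`; this is the Poisson tail.
    · refine (h.norm_corr_le (by linarith) hp₂ (hq₁.trans hη) (hq₂.trans hη) hv hη hη0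
        (Or.inl hq₁)).trans ?_
      have hGη := h.deriv_pos η (h.mem_Ioo hη0 hη)
      have h3 : v ^ 2 / d ≤ |v| * (η * G η) := by
        rw [← sq_abs, pow_two, mul_div_assoc]
        gcongr
        calc |v| / d = |v| * (1 / d) := by ring
          _ ≤ η * G η := by gcongr
      have h4 : d ^ 2 ≤ v ^ 2 := sq_le_sq.2 (by rw [abs_of_pos hd]; exact hvd.le)
      have hv2 : 0 < v ^ 2 := by positivity
      calc C / (|v| * (η * G η)) ≤ C / (v ^ 2 / d) := by gcongr
        _ = 2 * C * (d / (v ^ 2 + v ^ 2)) := by field_simp; ring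
        _ ≤ 2 * C * (d / (d ^ 2 + v ^ 2)) := by gcongr

/-- Split at `s = √u`. Below, integration by parts gives `u⁻¹ (√u) ^ δ`. Above, absolute values give
`∫ s⁻² = u ^ (-1 / 2)`, no worse than `u ^ (δ / 2 - 1)` because `δ ≤ 1` and `u ≤ 1`. -/
theorem norm_corr_self_le_of_pos (h : SingularPhase γ G G₂ τ δ K) {p u : ℝ} (hp : 0 < p)
    (hu : 0 < u) (hu1 : u ≤ 1) :
    ‖corr (oscTrunc γ p τ) (oscTrunc γ p τ) u‖
      ≤ (K ^ 3 * (2 + 4 / δ) / (τ * G τ) / τ ^ δ + 1) * u ^ (δ / 2 - 1) := by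
  have hK := h.one_le_K
  have hδ := h.δ_pos
  have hτ0 := h.τ_pos
  have hGτ := h.deriv_pos τ (h.mem_Ioo hτ0 le_rfl)
  have e0 : max p (p - u) = p := max_eq_left (by linarith)
  have e1 : min τ (τ - u) = τ - u := min_eq_right (by linarith)
  rw [corr_oscTrunc, e0, e1]
  set k : ℝ → ℂ := fun s => oscKernel γ s * (starRingEnd ℂ) (oscKernel γ (s + u)) with hk
  have hsq : 0 < √u := Real.sqrt_pos.2 hu
  have hkint : IntegrableOn k (Ioc p (τ - u)) := by
    have hc : ContinuousOn k (Icc p (τ - u)) := by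
      refine (h.continuousOn_oscKernel.mono fun s hs =>
        Ioo_subset_Ioc_self (h.mem_Ioo (hp.trans_le hs.1) (by linarith [hs.2]))).mul
        (Complex.continuous_conj.comp_continuousOn (h.continuousOn_oscKernel.comp
          (continuousOn_id.add continuousOn_const) fun s hs => ?_))
      have := hs.1
      exact Ioo_subset_Ioc_self
        (h.mem_Ioo (show 0 < s + u by linarith) (show s + u ≤ τ by linarith [hs.2]))
    exact hc.integrableOn_Icc.mono_set Ioc_subset_Icc_self
  have hsplit := integral_inter_add_sdiff (f := k) (μ := volume) (s := Ioc p (τ - u))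
    (t := Iic √u) measurableSet_Iic hkint
  have hi : Ioc p (τ - u) ∩ Iic √u = Ioc p (min (τ - u) √u) := Ioc_inter_Iic ..
  rw [hi] at hsplit
  rw [← hsplit]
  have hA : ‖∫ s in Ioc p (min (τ - u) √u), k s‖
      ≤ K ^ 3 * (2 + 4 / δ) / (τ * G τ) / τ ^ δ * u ^ (δ / 2 - 1) := by
    set q := min (τ - u) √u
    rcases le_or_gt p q with hpq | hpq
    · have hq0 := hp.trans_le hpq
      have hq' : q ≤ τ - u := min_le_left _ _
      have hqs : q ≤ √u := min_le_right _ _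
      have hGq := h.deriv_pos q (h.mem_Ioo hq0 (by linarith))
      rw [← intervalIntegral.integral_of_le hpq]
      refine (h.norm_integral_oscKernel_pair_le hp hpq hu (by linarith)).trans ?_
      have h1 := h.inv_mul_deriv_le hq0 (by linarith : q ≤ τ) le_rfl
      have h2 : (q / τ) ^ δ ≤ u ^ (δ / 2) / τ ^ δ := by
        rw [Real.div_rpow hq0.le hτ0.le]
        gcongr
        calc q ^ δ ≤ √u ^ δ := Real.rpow_le_rpow hq0.le hqs hδ.le
          _ = u ^ (δ / 2) := by
            rw [Real.sqrt_eq_rpow, ← Real.rpow_mul hu.le]; ring_nf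
      calc K ^ 2 * (2 + 4 / δ) / (u * (q * G q))
          = K ^ 2 * (2 + 4 / δ) / u * (1 / (q * G q)) := by field_simp
        _ ≤ K ^ 2 * (2 + 4 / δ) / u * (K / (τ * G τ) * (u ^ (δ / 2) / τ ^ δ)) := by
          gcongr
          exact h1.trans (by gcongr)
        _ = _ := by rw [Real.rpow_sub_one hu.ne']; field_simp
    · rw [Ioc_eq_empty (not_lt.2 hpq.le), setIntegral_empty, norm_zero]
      positivity
  have hB : ‖∫ s in Ioc p (τ - u) \ Iic √u, k s‖ ≤ u ^ (δ / 2 - 1) := by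
    have hsub : Ioc p (τ - u) \ Iic √u ⊆ Ioi √u := fun s hs => mem_Ioi.2 (not_le.1 hs.2)
    have hm : MeasurableSet (Ioc p (τ - u) \ Iic √u) := measurableSet_Ioc.diff measurableSet_Iic
    have h1 : ‖∫ s in Ioc p (τ - u) \ Iic √u, k s‖ ≤ ∫ s in Ioc p (τ - u) \ Iic √u, 1 / s ^ 2 := by
      refine norm_integral_le_of_norm_le ((integrableOn_Ioi_inv_sq hsq).mono_set hsub)
        ((ae_restrict_iff' hm).2 (Eventually.of_forall fun s hs => ?_))
      have hs0 : 0 < s := hp.trans hs.1.1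
      rw [hk]
      simp only
      rw [norm_mul, RCLike.norm_conj, norm_oscKernel γ hs0, norm_oscKernel γ (by linarith),
        div_mul_div_comm, mul_one]
      exact one_div_le_one_div_of_le (by positivity) (by nlinarith)
    refine h1.trans ((setIntegral_mono_set (integrableOn_Ioi_inv_sq hsq)
      (Eventually.of_forall fun s => by positivity) (Eventually.of_forall hsub)).trans ?_)
    rw [integral_Ioi_inv_sq hsq, Real.sqrt_eq_rpow, one_div, ← Real.rpow_neg hu.le]
    exact Real.rpow_le_rpow_of_exponent_ge hu hu1 (by linarith [h.δ_le_one])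
  refine (norm_add_le _ _).trans ?_
  rw [add_mul, one_mul]
  exact add_le_add hA hB

/-- The `L²` bound in disguise: the square norm of `κ * g` is `g` paired with itself through the
autocorrelation of `κ`, so an `L¹` bound on the latter, uniform in `p`, suffices. -/
theorem exists_lintegral_corr_self_le (h : SingularPhase γ G G₂ τ δ K) :
    ∃ B : ℝ, 0 ≤ B ∧ ∀ p : ℝ, 0 < p →
      ∫⁻ v, ‖corr (oscTrunc γ p τ) (oscTrunc γ p τ) v‖ₑ ≤ ENNReal.ofReal B := by
  set C := K ^ 3 * (2 + 4 / δ) / (τ * G τ) / τ ^ δ + 1 with hC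
  have hC0 : 0 ≤ C := by
    have hK := h.one_le_K
    have hδ := h.δ_pos
    have hτ0 := h.τ_pos
    have hGτ := h.deriv_pos τ (h.mem_Ioo hτ0 le_rfl)
    positivity
  set g : ℝ → ℝ := (Ioc 0 1).indicator (fun u => u ^ (δ / 2 - 1)) with hg
  have hg0 : ∀ v, 0 ≤ g v := indicator_nonneg fun u hu => Real.rpow_nonneg hu.1.le _
  have hgi : Integrable g := by
    have h1 := intervalIntegral.intervalIntegrable_rpow' (a := 0) (b := 1) (r := δ / 2 - 1)
      (by linarith [h.δ_pos])
    rw [intervalIntegrable_iff_integrableOn_Ioc_of_le zero_le_one] at h1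
    exact h1.integrable_indicator measurableSet_Ioc
  have hFi : Integrable (fun v => C * (g v + g (-v))) := (hgi.add hgi.comp_neg).const_mul C
  have hF0 : ∀ v, 0 ≤ C * (g v + g (-v)) := fun v => mul_nonneg hC0 (add_nonneg (hg0 _) (hg0 _))
  refine ⟨∫ v, C * (g v + g (-v)), integral_nonneg hF0, fun p hp => ?_⟩
  rw [ofReal_integral_eq_lintegral_ofReal hFi (Eventually.of_forall hF0)]
  have hne : ∀ᵐ v : ℝ, v ≠ 0 := by simp [ae_iff]
  refine lintegral_mono_ae (hne.mono fun v hv => ?_)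
  rw [← ofReal_norm]
  refine ENNReal.ofReal_le_ofReal ?_
  have hpos : ∀ u, 0 < u → ‖corr (oscTrunc γ p τ) (oscTrunc γ p τ) u‖ ≤ C * g u := by
    intro u hu
    rcases le_or_gt u 1 with hu1 | hu1
    · rw [hg, indicator_of_mem (show u ∈ Ioc (0 : ℝ) 1 from ⟨hu, hu1⟩)]
      exact h.norm_corr_self_le_of_pos hp hu hu1
    · have : τ ≤ |u| := by rw [abs_of_pos hu]; linarith [h.τ_lt_one]
      rw [corr_oscTrunc_eq_zero γ hp hp this this, norm_zero]
      exact mul_nonneg hC0 (hg0 _)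
  rcases lt_or_gt_of_ne hv with hv | hv
  · rw [norm_corr_comm]
    refine (hpos _ (neg_pos.2 hv)).trans ?_
    have := hg0 v
    gcongr
    linarith
  · refine (hpos _ hv).trans ?_
    have := hg0 (-v)
    gcongr
    linarith

/-! ### Regularity of the kernel at slow phase -/

/-- The Hörmander-type condition for the part of the kernel away from the origin. -/
theorem lintegral_oscTrunc_sub_le (h : SingularPhase γ G G₂ τ δ K) {c u : ℝ} (hc : 0 < c)
    (hu : 0 ≤ u) (huc : 2 * u ≤ c) (hG : c < τ → u * G c ≤ 1) :
    ∫⁻ x, ‖oscTrunc γ c τ (x - u) - oscTrunc γ c τ x‖ₑ ≤ ENNReal.ofReal (2 * K + 2) := by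
  have hK := h.one_le_K
  rcases le_or_gt τ c with hτc | hcτ
  · have : oscTrunc γ c τ = fun _ => 0 := by
      funext x; rw [oscTrunc, Ioc_eq_empty (not_lt.2 hτc), indicator_empty]
    simp [this]
  have hGu := hG hcτ
  have hGc := h.deriv_pos c (h.mem_Ioo hc hcτ.le)
  -- The first two terms cover the windows of width `u` next to the cuts, where only one of the two
  -- kernels can be nonzero; each integrates to `u / c ≤ 1 / 2`. The third covers the points where
  -- both are nonzero and integrates to `2 * K + 1`.
  have hpt : ∀ x, ‖oscTrunc γ c τ (x - u) - oscTrunc γ c τ x‖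
      ≤ (Ioc c (c + u)).indicator (fun _ => 1 / c) x + (Ioc τ (τ + u)).indicator (fun _ => 1 / c) x
        + (Ioi c).indicator (fun s => c * (2 * K + 1) * (1 / s ^ 2)) x := by
    intro x
    have n1 : 0 ≤ (Ioc c (c + u)).indicator (fun _ => 1 / c) x :=
      indicator_nonneg (fun _ _ => by positivity) _
    have n2 : 0 ≤ (Ioc τ (τ + u)).indicator (fun _ => 1 / c) x :=
      indicator_nonneg (fun _ _ => by positivity) _
    have n3 : 0 ≤ (Ioi c).indicator (fun s => c * (2 * K + 1) * (1 / s ^ 2)) x :=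
      indicator_nonneg (fun _ _ => by positivity) _
    rcases le_or_gt x c with hxc | hxc
    · have e1 : oscTrunc γ c τ x = 0 := indicator_of_notMem (fun hm => by linarith [hm.1]) _
      have e2 : oscTrunc γ c τ (x - u) = 0 := indicator_of_notMem (fun hm => by linarith [hm.1]) _
      rw [e1, e2, sub_zero, norm_zero]
      linarith
    rcases le_or_gt (x - u) c with hxuc | hxuc
    · have e2 : oscTrunc γ c τ (x - u) = 0 := indicator_of_notMem (fun hm => by linarith [hm.1]) _
      rw [e2, zero_sub, norm_neg, indicator_of_mem (show x ∈ Ioc c (c + u) from ⟨hxc, by linarith⟩)]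
      linarith [norm_oscTrunc_le γ (q := τ) hc x]
    rcases le_or_gt x τ with hxτ | hxτ
    · have hx0 : 0 < x := hc.trans hxc
      have hxu0 : 0 < x - u := hc.trans hxuc
      rw [oscTrunc, indicator_of_mem (show x ∈ Ioc c τ from ⟨hxc, hxτ⟩),
        indicator_of_mem (show x - u ∈ Ioc c τ from ⟨hxuc, by linarith⟩),
        indicator_of_mem (show x ∈ Ioi c from hxc)]
      -- Only the first power of `decay` is used: with `u * G c ≤ 1` it makes the difference of the
      -- exponentials `O(c / x)`, hence that of the kernels `O(c / x ^ 2)`.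
      have hGx : G (x - u) ≤ K * G c * (c / (x - u)) := by
        have h1 := h.decay c (x - u) hc hxuc.le (by linarith)
        have hr : 1 ≤ (x - u) / c := (one_le_div hc).2 hxuc.le
        have h2 : (x - u) / c ≤ ((x - u) / c) ^ (1 + δ) := by
          calc (x - u) / c = ((x - u) / c) ^ (1 : ℝ) := (Real.rpow_one _).symm
            _ ≤ _ := Real.rpow_le_rpow_of_exponent_le hr (by linarith [h.δ_pos])
        have hGp := h.deriv_pos (x - u) (h.mem_Ioo hxu0 (by linarith))
        have h3 : G (x - u) * ((x - u) / c) ≤ K * G c :=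
          (mul_le_mul_of_nonneg_left h2 hGp.le).trans h1
        calc G (x - u) = G (x - u) * ((x - u) / c) * (c / (x - u)) := by field_simp
          _ ≤ _ := by gcongr
      have hosc : ‖Complex.exp (Complex.I * (γ (x - u) : ℂ)) - Complex.exp (Complex.I * (γ x : ℂ))‖
          ≤ u * G (x - u) := by
        have hseg : ∀ t ∈ Icc (x - u) x, t ∈ Ioo (0 : ℝ) 1 := fun t ht =>
          h.mem_Ioo (hxu0.trans_le ht.1) (ht.2.trans hxτ)
        have := norm_image_sub_le_of_norm_deriv_le_segment' (a := x - u) (b := x)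
          (f := fun t => Complex.exp (Complex.I * (γ t : ℂ)))
          (f' := fun t => Complex.exp (Complex.I * (γ t : ℂ)) * (Complex.I * (G t : ℂ)))
          (C := G (x - u))
          (fun t ht => (((h.hasDerivAt_phase t (hseg t ht)).ofReal_comp).const_mul
            Complex.I).cexp.hasDerivWithinAt)
          (fun t ht => by
            have ht' := hseg t (Ico_subset_Icc_self ht)
            rw [norm_mul, norm_cexp_I_mul_ofReal, one_mul, norm_mul, Complex.norm_I, one_mul,
              Complex.norm_real, Real.norm_of_nonneg (h.deriv_pos t ht').le]
            exact h.strictAntiOn_deriv.antitoneOn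
              (hseg _ (left_mem_Icc.2 (by linarith))) ht' ht.1) x (right_mem_Icc.2 (by linarith))
        rw [norm_sub_rev]
        refine this.trans (le_of_eq ?_)
        ring
      have e3 : oscKernel γ (x - u) - oscKernel γ x
          = (Complex.exp (Complex.I * (γ (x - u) : ℂ)) - Complex.exp (Complex.I * (γ x : ℂ)))
            / (x : ℂ) + Complex.exp (Complex.I * (γ (x - u) : ℂ)) * ((u / (x * (x - u)) : ℝ) : ℂ) := by
        have hxc0 : (x : ℂ) ≠ 0 := by exact_mod_cast hx0.ne'
        have hxuc0 : (x : ℂ) - u ≠ 0 := by exact_mod_cast hxu0.ne'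
        simp only [oscKernel]
        push_cast
        field_simp
        ring
      rw [e3]
      refine (norm_add_le _ _).trans ?_
      rw [norm_div, norm_mul, norm_cexp_I_mul_ofReal, one_mul, Complex.norm_real, Complex.norm_real,
        Real.norm_of_nonneg hx0.le, Real.norm_of_nonneg (by positivity)]
      have hx2 : x / 2 ≤ x - u := by linarith
      have hinv : 1 / (x - u) ≤ 2 / x := by
        rw [div_le_div_iff₀ hxu0 hx0]; linarith
      have b1 : ‖Complex.exp (Complex.I * (γ (x - u) : ℂ)) - Complex.exp (Complex.I * (γ x : ℂ))‖ / x
          ≤ 2 * K * c / x ^ 2 := by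
        calc _ ≤ u * (K * G c * (c / (x - u))) / x := by
              gcongr; exact hosc.trans (by gcongr)
          _ = (u * G c) * (K * c) * (1 / (x - u)) / x := by ring
          _ ≤ 1 * (K * c) * (2 / x) / x := by gcongr
          _ = _ := by field_simp
      have b2 : u / (x * (x - u)) ≤ c / x ^ 2 := by
        calc u / (x * (x - u)) = u / x * (1 / (x - u)) := by field_simp
          _ ≤ u / x * (2 / x) := by gcongr
          _ = 2 * u / x ^ 2 := by field_simp
          _ ≤ _ := by gcongr
      have e4 : c * (2 * K + 1) * (1 / x ^ 2) = 2 * K * c / x ^ 2 + c / x ^ 2 := by ring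
      rw [e4]
      linarith
    · have e1 : oscTrunc γ c τ x = 0 := indicator_of_notMem (fun hm => by linarith [hm.2]) _
      rw [e1, sub_zero]
      rcases le_or_gt (x - u) τ with hxuτ | hxuτ
      · rw [indicator_of_mem (show x ∈ Ioc τ (τ + u) from ⟨hxτ, by linarith⟩)]
        linarith [norm_oscTrunc_le γ (q := τ) hc (x - u)]
      · have e2 : oscTrunc γ c τ (x - u) = 0 := indicator_of_notMem (fun hm => by linarith [hm.2]) _
        rw [e2, norm_zero]
        linarith
  have i1 : ∀ r : ℝ, Integrable ((Ioc r (r + u)).indicator (fun _ => 1 / c)) := fun r =>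
    (integrableOn_const (by simp)).integrable_indicator measurableSet_Ioc
  have i3' : IntegrableOn (fun s => c * (2 * K + 1) * (1 / s ^ 2)) (Ioi c) :=
    (integrableOn_Ioi_inv_sq hc).const_mul _
  have i3 := i3'.integrable_indicator measurableSet_Ioi
  have i12 := (i1 c).add (i1 τ)
  have i123 : Integrable (fun x => (Ioc c (c + u)).indicator (fun _ => 1 / c) x
        + (Ioc τ (τ + u)).indicator (fun _ => 1 / c) x
        + (Ioi c).indicator (fun s => c * (2 * K + 1) * (1 / s ^ 2)) x) := i12.add i3
  have v1 : ∀ r : ℝ, ∫ x, (Ioc r (r + u)).indicator (fun _ => 1 / c) x = u / c := fun r => by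
    rw [integral_indicator measurableSet_Ioc, setIntegral_const]
    simp [hu, div_eq_mul_inv]
  have v3 : ∫ x, (Ioi c).indicator (fun s => c * (2 * K + 1) * (1 / s ^ 2)) x = 2 * K + 1 := by
    rw [integral_indicator measurableSet_Ioi, integral_const_mul, integral_Ioi_inv_sq hc]
    field_simp
  calc ∫⁻ x, ‖oscTrunc γ c τ (x - u) - oscTrunc γ c τ x‖ₑ
      ≤ ∫⁻ x, ENNReal.ofReal ((Ioc c (c + u)).indicator (fun _ => 1 / c) x
        + (Ioc τ (τ + u)).indicator (fun _ => 1 / c) x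
        + (Ioi c).indicator (fun s => c * (2 * K + 1) * (1 / s ^ 2)) x) := by
        refine lintegral_mono fun x => ?_
        rw [← ofReal_norm]
        exact ENNReal.ofReal_le_ofReal (hpt x)
    _ = ENNReal.ofReal (u / c + u / c + (2 * K + 1)) := by
        rw [← ofReal_integral_eq_lintegral_ofReal i123
          (Eventually.of_forall fun x => (norm_nonneg _).trans (hpt x))]
        congr 1
        refine (integral_add i12 i3).trans ?_
        rw [v3]
        congr 1
        refine (integral_add (i1 c) (i1 τ)).trans ?_
        rw [v1, v1]
    _ ≤ _ := by
        refine ENNReal.ofReal_le_ofReal ?_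
        have : u / c ≤ 1 / 2 := by rw [div_le_div_iff₀ hc two_pos]; linarith
        linarith

end SingularPhase

/-! ### The Calderón–Zygmund decomposition -/

/-- The half-open interval with left endpoint `I.1` and length `I.2`. -/
def ivl (I : ℝ × ℝ) : Set ℝ := Ico I.1 (I.1 + I.2)

theorem measurableSet_ivl (I : ℝ × ℝ) : MeasurableSet (ivl I) := measurableSet_Ico

theorem volume_ivl (I : ℝ × ℝ) : volume (ivl I) = ENNReal.ofReal I.2 := by
  simp [ivl]

/-- The stopping-time selection of intervals, after `N` bisections. -/
theorem exists_stopping_family {φ : ℝ → ℝ} (hφ : Integrable φ) {α : ℝ} (N : ℕ) :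
    ∀ J : ℝ × ℝ, 0 < J.2 → ∫ x in ivl J, φ x ≤ α * J.2 → (∀ x, 0 ≤ φ x) →
    ∃ S : Finset (ℝ × ℝ), (∀ I ∈ S, 0 < I.2 ∧ ivl I ⊆ ivl J ∧ α * I.2 < ∫ x in ivl I, φ x ∧
        ∫ x in ivl I, φ x ≤ 2 * α * I.2) ∧
      (S : Set (ℝ × ℝ)).PairwiseDisjoint ivl ∧
      ∀ x ∈ ivl J, (∃ I ∈ S, x ∈ ivl I) ∨
        ∃ I : ℝ × ℝ, I.2 = J.2 / 2 ^ N ∧ x ∈ ivl I ∧ ∫ x in ivl I, φ x ≤ α * I.2 := by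
  classical
  induction N with
  | zero =>
    intro J hJ hJφ _
    exact ⟨∅, by simp, by simp, fun x hx => Or.inr ⟨J, by simp, hx, hJφ⟩⟩
  | succ N ih =>
    intro J hJ hJφ h0
    have half : ∀ H : ℝ × ℝ, H.2 = J.2 / 2 → ivl H ⊆ ivl J →
        ∃ S : Finset (ℝ × ℝ), (∀ I ∈ S, 0 < I.2 ∧ ivl I ⊆ ivl H ∧ α * I.2 < ∫ x in ivl I, φ x ∧
          ∫ x in ivl I, φ x ≤ 2 * α * I.2) ∧
        (S : Set (ℝ × ℝ)).PairwiseDisjoint ivl ∧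
        ∀ x ∈ ivl H, (∃ I ∈ S, x ∈ ivl I) ∨
          ∃ I : ℝ × ℝ, I.2 = J.2 / 2 ^ (N + 1) ∧ x ∈ ivl I ∧ ∫ x in ivl I, φ x ≤ α * I.2 := by
      intro H hH hHJ
      have hH0 : 0 < H.2 := by rw [hH]; positivity
      rcases le_or_gt (∫ x in ivl H, φ x) (α * H.2) with hle | hgt
      · obtain ⟨S, h1, h2, h3⟩ := ih H hH0 hle h0
        refine ⟨S, h1, h2, fun x hx => (h3 x hx).imp_right ?_⟩
        rintro ⟨I, hI, hI'⟩
        refine ⟨I, ?_, hI'⟩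
        rw [hI, hH, pow_succ]
        field_simp
      · refine ⟨{H}, ?_, by simp, fun x hx => Or.inl ⟨H, by simp, hx⟩⟩
        simp only [Finset.mem_singleton, forall_eq]
        refine ⟨hH0, subset_rfl, hgt, ?_⟩
        calc ∫ x in ivl H, φ x ≤ ∫ x in ivl J, φ x :=
              setIntegral_mono_set hφ.integrableOn (Eventually.of_forall h0)
                (Eventually.of_forall hHJ)
          _ ≤ α * J.2 := hJφ
          _ = 2 * α * H.2 := by rw [hH]; ring
    have hl : ivl (J.1, J.2 / 2) ⊆ ivl J := Ico_subset_Ico le_rfl (by simp only; linarith)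
    have hr : ivl (J.1 + J.2 / 2, J.2 / 2) ⊆ ivl J :=
      Ico_subset_Ico (by simp only; linarith) (by simp only; linarith)
    have hdis : Disjoint (ivl (J.1, J.2 / 2)) (ivl (J.1 + J.2 / 2, J.2 / 2)) := by
      rw [Set.disjoint_left]
      intro x hx hx'
      exact absurd hx.2 (not_lt.2 hx'.1)
    obtain ⟨S, a1, a2, a3⟩ := half (J.1, J.2 / 2) rfl hl
    obtain ⟨S', b1, b2, b3⟩ := half (J.1 + J.2 / 2, J.2 / 2) rfl hr
    refine ⟨S ∪ S', ?_, ?_, ?_⟩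
    · intro I hI
      rcases Finset.mem_union.1 hI with hI | hI
      · exact ⟨(a1 I hI).1, (a1 I hI).2.1.trans hl, (a1 I hI).2.2⟩
      · exact ⟨(b1 I hI).1, (b1 I hI).2.1.trans hr, (b1 I hI).2.2⟩
    · rw [Finset.coe_union]
      exact (pairwiseDisjoint_union).2 ⟨a2, b2, fun I hI I' hI' _ =>
        hdis.mono (a1 I hI).2.1 (b1 I' hI').2.1⟩
    · intro x hx
      rcases lt_or_ge x (J.1 + J.2 / 2) with hlt | hge
      · refine (a3 x ⟨hx.1, hlt⟩).imp_left ?_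
        rintro ⟨I, hI, hxI⟩
        exact ⟨I, Finset.mem_union_left _ hI, hxI⟩
      · refine (b3 x ⟨hge, by simp only; linarith [hx.2]⟩).imp_left ?_
        rintro ⟨I, hI, hxI⟩
        exact ⟨I, Finset.mem_union_right _ hI, hxI⟩

/-- For continuous `f` of compact support finitely many bisections suffice, and uniform continuity
replaces Lebesgue differentiation. On an unselected interval of the last generation `‖f‖` oscillates
by less than `α / 2`, so a value above `2 * α` would force an average of at least `3 / 2 * α`,
contradicting the average at most `α`. -/
theorem exists_selected_intervals {f : ℝ → ℂ} (hf : Continuous f) (hc : HasCompactSupport f) {α : ℝ}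
    (hα : 0 < α) :
    ∃ S : Finset (ℝ × ℝ), (∀ I ∈ S, 0 < I.2 ∧ ∫ x in ivl I, ‖f x‖ ≤ 2 * α * I.2) ∧
      (S : Set (ℝ × ℝ)).PairwiseDisjoint ivl ∧ (∑ I ∈ S, I.2) ≤ (∫ x, ‖f x‖) / α ∧
      ∀ x, (∀ I ∈ S, x ∉ ivl I) → ‖f x‖ ≤ 2 * α := by
  have hfi : Integrable f := hf.integrable_of_hasCompactSupport hc
  obtain ⟨ρ, hρ, hρf⟩ := Metric.uniformContinuous_iff.1 (hc.uniformContinuous_of_continuous hf)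
    (α / 2) (half_pos hα)
  obtain ⟨R₀, hR₀⟩ := hc.isCompact.isBounded.subset_closedBall 0
  -- The starting interval `[-R, R)` must contain the support (the `+ 1` allows for the open right
  -- end) and be long enough for the average of `‖f‖` over it to be at most `α`.
  set R : ℝ := max (R₀ + 1) (max 1 ((∫ x, ‖f x‖) / (2 * α))) with hR
  have hR1 : R₀ + 1 ≤ R := le_max_left _ _
  have hR2 : 1 ≤ R := (le_max_left _ _).trans (le_max_right _ _)
  have hR3 : (∫ x, ‖f x‖) / (2 * α) ≤ R := (le_max_right _ _).trans (le_max_right _ _)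
  obtain ⟨N, hN⟩ := pow_unbounded_of_one_lt (2 * R / ρ) (one_lt_two : (1 : ℝ) < 2)
  have hlen : 2 * R / 2 ^ N < ρ := by
    rw [div_lt_iff₀ (by positivity)]
    rw [div_lt_iff₀ hρ] at hN
    linarith
  obtain ⟨S, h1, h2, h3⟩ := exists_stopping_family hfi.norm (α := α) N (-R, 2 * R)
    (by simp only; linarith) (by
      refine (setIntegral_le_integral hfi.norm (Eventually.of_forall fun x => norm_nonneg _)).trans ?_
      rw [div_le_iff₀ (by positivity)] at hR3
      simp only
      linarith) (fun x => norm_nonneg _)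
  refine ⟨S, fun I hI => ⟨(h1 I hI).1, (h1 I hI).2.2.2⟩, h2, ?_, ?_⟩
  · rw [le_div_iff₀ hα, Finset.sum_mul]
    calc ∑ I ∈ S, I.2 * α ≤ ∑ I ∈ S, ∫ x in ivl I, ‖f x‖ :=
          Finset.sum_le_sum fun I hI => by linarith [(h1 I hI).2.2.1]
      _ = ∫ x in ⋃ I ∈ S, ivl I, ‖f x‖ :=
          (integral_biUnion_finset S (fun I _ => measurableSet_ivl I) h2
            fun I _ => hfi.norm.integrableOn).symm
      _ ≤ _ := setIntegral_le_integral hfi.norm (Eventually.of_forall fun x => norm_nonneg _)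
  · intro x hx
    by_cases hxJ : x ∈ ivl (-R, 2 * R)
    · rcases h3 x hxJ with ⟨I, hI, hxI⟩ | ⟨I, hI, hxI, hIφ⟩
      · exact absurd hxI (hx I hI)
      · by_contra hcon
        push Not at hcon
        have hI0 : 0 < I.2 := by rw [hI]; positivity
        have hlow : ∀ y ∈ ivl I, 3 / 2 * α ≤ ‖f y‖ := by
          intro y hy
          have hd : dist x y < ρ := by
            rw [Real.dist_eq, abs_lt]
            have e : I.2 < ρ := by rw [hI]; exact hlen
            constructor <;> linarith [hxI.1, hxI.2, hy.1, hy.2]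
          have h4 := hρf hd
          rw [dist_eq_norm] at h4
          have := norm_sub_norm_le (f x) (f y)
          linarith
        have h5 : 3 / 2 * α * I.2 ≤ ∫ x in ivl I, ‖f x‖ := by
          have hv : volume.real (ivl I) = I.2 := by
            rw [Measure.real, volume_ivl, ENNReal.toReal_ofReal hI0.le]
          calc 3 / 2 * α * I.2 = ∫ x in ivl I, 3 / 2 * α := by
                rw [setIntegral_const, hv, smul_eq_mul, mul_comm]
            _ ≤ _ := setIntegral_mono_on (integrableOn_const (by rw [volume_ivl]; simp))
                hfi.norm.integrableOn (measurableSet_ivl I) hlow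
        nlinarith
    · have : f x = 0 := by
        by_contra hne
        have hx' := hR₀ (subset_tsupport f hne)
        rw [Metric.mem_closedBall, dist_zero_right, Real.norm_eq_abs, abs_le] at hx'
        exact hxJ ⟨by simp only; linarith, by simp only; linarith⟩
      rw [this, norm_zero]
      positivity

theorem HasCompactSupport.bddSupp {f : ℝ → ℂ} (hc : HasCompactSupport f) (hf : Continuous f) :
    BddSupp f := by
  refine ⟨hf.measurable, hf.bounded_above_of_compact_support hc, ?_⟩
  obtain ⟨R, hR⟩ := hc.isCompact.isBounded.subset_closedBall 0
  refine ⟨R, fun x hx => ?_⟩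
  by_contra hne
  have := hR (subset_tsupport f hne)
  rw [Metric.mem_closedBall, dist_zero_right, Real.norm_eq_abs] at this
  linarith

/-- The Calderón–Zygmund decomposition. -/
theorem exists_calderonZygmund {f : ℝ → ℂ} (hf : Continuous f) (hc : HasCompactSupport f) {α : ℝ}
    (hα : 0 < α) :
    ∃ (S : Finset (ℝ × ℝ)) (g : ℝ → ℂ) (b : ℝ × ℝ → ℝ → ℂ),
      BddSupp g ∧ (∀ I ∈ S, BddSupp (b I)) ∧ (f = fun x => g x + ∑ I ∈ S, b I x) ∧
      (∀ x, ‖g x‖ ≤ 2 * α) ∧ ∫ x, ‖g x‖ ≤ 3 * ∫ x, ‖f x‖ ∧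
      (∀ I ∈ S, 0 < I.2) ∧ (∀ I ∈ S, ∀ x, x ∉ ivl I → b I x = 0) ∧ (∀ I ∈ S, ∫ x, b I x = 0) ∧
      (∀ I ∈ S, ∫ x, ‖b I x‖ ≤ 4 * α * I.2) ∧ ∑ I ∈ S, ∫ x, ‖b I x‖ ≤ 2 * ∫ x, ‖f x‖ ∧
      ∑ I ∈ S, I.2 ≤ (∫ x, ‖f x‖) / α ∧ (S : Set (ℝ × ℝ)).PairwiseDisjoint ivl := by
  obtain ⟨S, h1, h2, h3, h4⟩ := exists_selected_intervals hf hc hα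
  have hfi : Integrable f := hf.integrable_of_hasCompactSupport hc
  have hfb := hc.bddSupp hf
  set m : ℝ × ℝ → ℂ := fun I => (∫ x in ivl I, f x) / (I.2 : ℂ) with hm
  set b : ℝ × ℝ → ℝ → ℂ := fun I => (ivl I).indicator (fun x => f x - m I) with hb
  have hone : ∀ I : ℝ × ℝ, BddSupp ((ivl I).indicator (fun _ => m I)) := fun I => by
    refine ⟨measurable_const.indicator (measurableSet_ivl I), ⟨‖m I‖, fun x =>
      norm_indicator_le_norm_self (fun _ => m I) x⟩, ⟨|I.1| + |I.2|, fun x hx =>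
        indicator_of_notMem (fun hxI => ?_) _⟩⟩
    have a1 := hxI.1
    have a2 := hxI.2
    have : |x| ≤ |I.1| + |I.2| := by
      rw [abs_le]
      constructor <;> linarith [neg_abs_le I.1, le_abs_self I.1, le_abs_self I.2, abs_nonneg I.2]
    linarith
  have hbS : ∀ I, BddSupp (b I) := fun I => by
    have : b I = fun x => (ivl I).indicator f x - (ivl I).indicator (fun _ => m I) x := by
      funext x
      by_cases hx : x ∈ ivl I <;> simp [hb, hx]
    rw [this]
    exact (hfb.indicator (measurableSet_ivl I)).sub (hone I)
  have hvol : ∀ I ∈ S, volume.real (ivl I) = I.2 := fun I hI => by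
    rw [Measure.real, volume_ivl, ENNReal.toReal_ofReal (h1 I hI).1.le]
  have hmnorm : ∀ I ∈ S, ‖m I‖ * I.2 ≤ ∫ x in ivl I, ‖f x‖ := fun I hI => by
    have hI := (h1 I hI).1
    simp only [hm]
    rw [norm_div, Complex.norm_real, Real.norm_of_nonneg hI.le, div_mul_cancel₀ _ hI.ne']
    exact norm_integral_le_integral_norm _
  have hbnorm : ∀ I ∈ S, ∫ x, ‖b I x‖ ≤ 2 * ∫ x in ivl I, ‖f x‖ := fun I hI => by
    have e1 : ∀ x, ‖b I x‖ = (ivl I).indicator (fun x => ‖f x - m I‖) x := fun x => by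
      simp only [hb]; rw [norm_indicator_eq_indicator_norm]
    simp only [e1]
    rw [integral_indicator (measurableSet_ivl I)]
    have hci : IntegrableOn (fun _ : ℝ => ‖m I‖) (ivl I) :=
      integrableOn_const (by rw [volume_ivl]; simp)
    have hcc : IntegrableOn (fun _ : ℝ => m I) (ivl I) :=
      integrableOn_const (by rw [volume_ivl]; simp)
    calc ∫ x in ivl I, ‖f x - m I‖ ≤ ∫ x in ivl I, (‖f x‖ + ‖m I‖) :=
          setIntegral_mono_on (hfi.integrableOn.sub hcc).norm (hfi.norm.integrableOn.add hci)
            (measurableSet_ivl I) fun x _ => norm_sub_le _ _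
      _ = (∫ x in ivl I, ‖f x‖) + ‖m I‖ * I.2 := by
          rw [integral_add hfi.norm.integrableOn hci, setIntegral_const, hvol I hI, smul_eq_mul,
            mul_comm]
      _ ≤ _ := by linarith [hmnorm I hI]
  have hsum : ∑ I ∈ S, ∫ x, ‖b I x‖ ≤ 2 * ∫ x, ‖f x‖ := by
    calc ∑ I ∈ S, ∫ x, ‖b I x‖ ≤ ∑ I ∈ S, 2 * ∫ x in ivl I, ‖f x‖ := Finset.sum_le_sum hbnorm
      _ = 2 * ∫ x in ⋃ I ∈ S, ivl I, ‖f x‖ := by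
          rw [← Finset.mul_sum, integral_biUnion_finset S (fun I _ => measurableSet_ivl I) h2
            fun I _ => hfi.norm.integrableOn]
      _ ≤ _ := by
          gcongr 2 * ?_
          exact setIntegral_le_integral hfi.norm (Eventually.of_forall fun x => norm_nonneg _)
  have hbsum : BddSupp (fun x => ∑ I ∈ S, b I x) := BddSupp.sum fun I _ => hbS I
  refine ⟨S, fun x => f x - ∑ I ∈ S, b I x, b, hfb.sub hbsum, fun I _ => hbS I, by simp, ?_, ?_,
    fun I hI => (h1 I hI).1, fun I _ x hx => indicator_of_notMem hx _, ?_, ?_, hsum, h3, h2⟩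
  · intro x
    beta_reduce
    by_cases hx : ∃ I ∈ S, x ∈ ivl I
    · obtain ⟨I, hI, hxI⟩ := hx
      have e1 : ∑ I' ∈ S, b I' x = f x - m I := by
        rw [Finset.sum_eq_single_of_mem I hI]
        · exact indicator_of_mem hxI _
        · intro I' hI' hne
          exact indicator_of_notMem (fun hxI' =>
            (Set.disjoint_left.1 (h2 hI' hI hne)) hxI' hxI) _
      rw [e1, sub_sub_cancel]
      have := hmnorm I hI
      have h5 := (h1 I hI).2
      exact le_of_mul_le_mul_right (this.trans h5) (h1 I hI).1
    · push Not at hx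
      have e1 : ∑ I ∈ S, b I x = 0 := Finset.sum_eq_zero fun I hI => indicator_of_notMem (hx I hI) _
      rw [e1, sub_zero]
      exact h4 x hx
  · calc ∫ x, ‖f x - ∑ I ∈ S, b I x‖ ≤ ∫ x, (‖f x‖ + ∑ I ∈ S, ‖b I x‖) :=
          integral_mono (hfb.sub hbsum).integrable.norm
            (hfi.norm.add (integrable_finsetSum _ fun I _ => (hbS I).integrable.norm))
            fun x => (norm_sub_le _ _).trans (add_le_add le_rfl (norm_sum_le _ _))
      _ = (∫ x, ‖f x‖) + ∑ I ∈ S, ∫ x, ‖b I x‖ := by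
          rw [integral_add hfi.norm (integrable_finsetSum _ fun I _ => (hbS I).integrable.norm),
            integral_finsetSum _ fun I _ => (hbS I).integrable.norm]
      _ ≤ _ := by linarith
  · intro I hI
    have hI0 : (I.2 : ℂ) ≠ 0 := by exact_mod_cast (h1 I hI).1.ne'
    have hcc : IntegrableOn (fun _ : ℝ => m I) (ivl I) :=
      integrableOn_const (by rw [volume_ivl]; simp)
    simp only [hb]
    rw [integral_indicator (measurableSet_ivl I), integral_sub hfi.integrableOn hcc,
      setIntegral_const, hvol I hI]
    simp only [hm, Complex.real_smul]
    rw [mul_div_cancel₀ _ hI0, sub_self]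
  · intro I hI
    linarith [hbnorm I hI, (h1 I hI).2]

/-! ### Poisson summation and the `L²` estimate for the oscillatory part -/

theorem lintegral_poisson_le {d : ℝ} (hd : 0 < d) (z : ℝ) :
    ∫⁻ y, ENNReal.ofReal (d / (d ^ 2 + (y - z) ^ 2)) ≤ ENNReal.ofReal Real.pi := by
  have e : ∀ y : ℝ, d / (d ^ 2 + y ^ 2) = d⁻¹ * (1 + (y / d) ^ 2)⁻¹ := fun y => by field_simp
  rw [lintegral_sub_right_eq_self (fun y => ENNReal.ofReal (d / (d ^ 2 + y ^ 2))) z]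
  have hi : Integrable (fun y : ℝ => d / (d ^ 2 + y ^ 2)) := by
    simp only [e]
    exact (integrable_inv_one_add_sq.comp_div hd.ne').const_mul _
  rw [← ofReal_integral_eq_lintegral_ofReal hi (Eventually.of_forall fun y => by positivity)]
  refine ENNReal.ofReal_le_ofReal (le_of_eq ?_)
  simp only [e]
  rw [integral_const_mul, Measure.integral_comp_div (fun y : ℝ => (1 + y ^ 2)⁻¹) d,
    integral_univ_inv_one_add_sq, abs_of_pos hd, smul_eq_mul]
  field_simp

theorem BddSupp.lintegral_enorm {f : ℝ → ℂ} (hf : BddSupp f) :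
    ∫⁻ x, ‖f x‖ₑ = ENNReal.ofReal (∫ x, ‖f x‖) :=
  (ofReal_integral_norm_eq_lintegral_enorm hf.integrable).symm

theorem BddSupp.measure_lt_norm_le {F : ℝ → ℂ} (hF : BddSupp F) {β : ℝ} (hβ : 0 < β) :
    volume {x | β < ‖F x‖}
      ≤ ‖∫ x, F x * (starRingEnd ℂ) (F x)‖ₑ / ENNReal.ofReal (β ^ 2) := by
  have e1 : ∫ x, F x * (starRingEnd ℂ) (F x) = ((∫ x, ‖F x‖ ^ 2 : ℝ) : ℂ) := by
    rw [← integral_complex_ofReal]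
    refine integral_congr_ae (Eventually.of_forall fun x => ?_)
    simp only [Complex.mul_conj, Complex.normSq_eq_norm_sq]
  have hi : Integrable (fun x => ‖F x‖ ^ 2) := by
    obtain ⟨M, hM⟩ := hF.bdd
    have := (hF.mul_bdd hF.measurable hM).integrable.norm
    simpa only [norm_mul, pow_two] using this
  have h0 : 0 ≤ ∫ x, ‖F x‖ ^ 2 := integral_nonneg fun x => by positivity
  rw [e1, ← ofReal_norm, Complex.norm_real, Real.norm_of_nonneg h0,
    ofReal_integral_eq_lintegral_ofReal hi (Eventually.of_forall fun x => by positivity)]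
  refine le_trans (measure_mono fun x hx => ?_) (meas_ge_le_lintegral_div
    (f := fun x => ENNReal.ofReal (‖F x‖ ^ 2)) (hF.measurable.norm.pow_const 2).ennreal_ofReal.aemeasurable
    (by simpa using by positivity) (by simp))
  exact ENNReal.ofReal_le_ofReal (pow_le_pow_left₀ hβ.le (le_of_lt hx) 2)

theorem measure_lt_norm_le_lintegral {F : ℝ → ℂ} (hF : Measurable F) {β : ℝ} (hβ : 0 < β) :
    volume {x | β < ‖F x‖} ≤ (∫⁻ x, ‖F x‖ₑ) / ENNReal.ofReal β := by
  refine le_trans (measure_mono fun x hx => ?_) (meas_ge_le_lintegral_div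
    (f := fun x => ‖F x‖ₑ) hF.enorm.aemeasurable (by simpa using hβ) (by simp))
  change ENNReal.ofReal β ≤ ‖F x‖ₑ
  rw [← ofReal_norm]
  exact ENNReal.ofReal_le_ofReal (le_of_lt hx)

/-- Summation of a Poisson kernel against functions carried by disjoint intervals whose lengths do
not exceed the scale of the kernel. -/
theorem sum_lintegral_poisson_le {S : Finset (ℝ × ℝ)} {b : ℝ × ℝ → ℝ → ℂ} {α d : ℝ} (hα : 0 < α)
    (hd : 0 < d) (hb : ∀ I ∈ S, BddSupp (b I)) (hS : ∀ I ∈ S, 0 < I.2 ∧ I.2 ≤ d)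
    (hsupp : ∀ I ∈ S, ∀ x, x ∉ ivl I → b I x = 0)
    (hbnd : ∀ I ∈ S, ∫ x, ‖b I x‖ ≤ 4 * α * I.2)
    (hdis : (S : Set (ℝ × ℝ)).PairwiseDisjoint ivl) (z : ℝ) :
    ∑ I ∈ S, ∫⁻ y, ‖b I y‖ₑ * ENNReal.ofReal (d / (d ^ 2 + (y - z) ^ 2))
      ≤ ENNReal.ofReal (12 * α * Real.pi) := by
  set P : ℝ → ℝ≥0∞ := fun y => ENNReal.ofReal (d / (d ^ 2 + (y - z) ^ 2)) with hP
  have hPm : Measurable P := by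
    refine Measurable.ennreal_ofReal ?_
    exact measurable_const.div (measurable_const.add ((measurable_id.sub_const z).pow_const 2))
  have h1 : ∀ I ∈ S, ∫⁻ y, ‖b I y‖ₑ * P y ≤ ENNReal.ofReal (12 * α) * ∫⁻ y in ivl I, P y := by
    intro I hI
    obtain ⟨hI0, hId⟩ := hS I hI
    have hI0' : ENNReal.ofReal I.2 ≠ 0 := by simpa using hI0
    -- Harnack's inequality: at scale `d` the kernel varies by a factor at most `3` over an interval
    -- no longer than `d`. The mass `4 * α * I.2` of `b I` can therefore be spread evenly over `I`,
    -- whence `12 * α`. Both sides carry the length `I.2` to avoid dividing by it.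
    have hcomp : ∀ y ∈ ivl I, P y * ENNReal.ofReal I.2 ≤ ENNReal.ofReal 3 * ∫⁻ y in ivl I, P y := by
      intro y hy
      rw [← volume_ivl I, ← setLIntegral_const, ← lintegral_const_mul _ hPm]
      refine setLIntegral_mono (hPm.const_mul _) fun y' hy' => ?_
      simp only [hP]
      rw [← ENNReal.ofReal_mul (by norm_num)]
      refine ENNReal.ofReal_le_ofReal ?_
      rw [← mul_div_assoc, div_le_div_iff₀ (by positivity) (by positivity)]
      have h2 : (y' - y) ^ 2 ≤ d ^ 2 := by
        refine sq_le_sq.2 ?_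
        rw [abs_of_pos hd, abs_le]
        constructor <;> linarith [hy.1, hy.2, hy'.1, hy'.2]
      have h3 : d ^ 2 + (y' - z) ^ 2 ≤ 3 * (d ^ 2 + (y - z) ^ 2) := by
        nlinarith [sq_nonneg (y' - y - (y - z))]
      nlinarith
    have h2 : (∫⁻ y, ‖b I y‖ₑ * P y) * ENNReal.ofReal I.2
        ≤ (ENNReal.ofReal (12 * α) * ∫⁻ y in ivl I, P y) * ENNReal.ofReal I.2 := by
      calc (∫⁻ y, ‖b I y‖ₑ * P y) * ENNReal.ofReal I.2
          = ∫⁻ y, ‖b I y‖ₑ * (P y * ENNReal.ofReal I.2) := by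
            rw [← lintegral_mul_const' _ _ ENNReal.ofReal_ne_top]
            simp only [mul_assoc]
        _ ≤ ∫⁻ y, ‖b I y‖ₑ * (ENNReal.ofReal 3 * ∫⁻ y in ivl I, P y) := by
            refine lintegral_mono fun y => ?_
            by_cases hy : y ∈ ivl I
            · exact mul_le_mul_right (hcomp y hy) _
            · simp [hsupp I hI y hy]
        _ = ENNReal.ofReal (∫ y, ‖b I y‖) * (ENNReal.ofReal 3 * ∫⁻ y in ivl I, P y) := by
            rw [lintegral_mul_const _ (hb I hI).measurable.enorm, (hb I hI).lintegral_enorm]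
        _ ≤ ENNReal.ofReal (4 * α * I.2) * (ENNReal.ofReal 3 * ∫⁻ y in ivl I, P y) := by
            gcongr
            exact hbnd I hI
        _ = _ := by
            rw [show 12 * α = 4 * α * 3 by ring, ENNReal.ofReal_mul (by positivity),
              ENNReal.ofReal_mul (by positivity : 0 ≤ 4 * α)]
            ring
    exact (ENNReal.mul_le_mul_iff_left hI0' ENNReal.ofReal_ne_top).1 h2
  calc ∑ I ∈ S, ∫⁻ y, ‖b I y‖ₑ * P y
      ≤ ∑ I ∈ S, ENNReal.ofReal (12 * α) * ∫⁻ y in ivl I, P y := Finset.sum_le_sum h1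
    _ = ENNReal.ofReal (12 * α) * ∫⁻ y in ⋃ I ∈ S, ivl I, P y := by
        rw [← Finset.mul_sum, lintegral_biUnion_finset hdis fun I _ => measurableSet_ivl I]
    _ ≤ ENNReal.ofReal (12 * α) * ENNReal.ofReal Real.pi := by
        gcongr
        exact (setLIntegral_le_lintegral _ _).trans (lintegral_poisson_le hd z)
    _ = _ := by rw [← ENNReal.ofReal_mul (by positivity)]

namespace SingularPhase

variable {γ G G₂ : ℝ → ℝ} {τ δ K : ℝ}

/-- The scale up to which the oscillation of the kernel dominates at resolution `d`. -/
theorem exists_scale (h : SingularPhase γ G G₂ τ δ K) (d : ℝ) :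
    ∃ η, 0 < η ∧ η ≤ τ ∧ 1 / d ≤ G η ∧ (η < τ → G η ≤ 1 / d) := by
  have hτ0 := h.τ_pos
  have hGτ := h.deriv_pos τ (h.mem_Ioo hτ0 le_rfl)
  rcases le_or_gt (1 / d) (G τ) with hle | hgt
  · exact ⟨τ, hτ0, le_rfl, hle, fun hlt => absurd hlt (lt_irrefl _)⟩
  -- `G` is unbounded at `0`, so the level `1 / d`, lying above `G τ`, is attained by the
  -- intermediate value theorem.
  · have hlim : Tendsto (fun s : ℝ => G τ * (τ / s) ^ (1 + δ)) (𝓝[>] 0) atTop := by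
      refine Tendsto.const_mul_atTop hGτ ((tendsto_rpow_atTop (by linarith [h.δ_pos])).comp ?_)
      change Tendsto (fun s : ℝ => τ * s⁻¹) _ _
      exact tendsto_inv_nhdsGT_zero.const_mul_atTop hτ0
    obtain ⟨s, hs1, hs2⟩ := ((hlim.eventually_gt_atTop (K * (1 / d))).and
      (Ioc_mem_nhdsGT hτ0)).exists
    have hK := h.one_le_K
    have h1 : 1 / d ≤ G s := by
      have := hs1.trans_le (h.decay s τ hs2.1 hs2.2 le_rfl)
      exact (lt_of_mul_lt_mul_left this (by linarith)).le
    obtain ⟨η, hη, hηd⟩ := intermediate_value_Icc' hs2.2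
      (h.continuousOn_deriv.mono fun t ht => h.mem_Ioo (hs2.1.trans_le ht.1) ht.2) ⟨hgt.le, h1⟩
    exact ⟨η, hs2.1.trans_le hη.1, hη.2, hηd.ge, fun _ => hηd.le⟩

/-- The oscillatory part: an `L²` estimate by summing correlations. -/
theorem enorm_integral_sum_le (h : SingularPhase γ G G₂ τ δ K) {S : Finset (ℝ × ℝ)}
    {b : ℝ × ℝ → ℝ → ℂ} {α : ℝ} (hα : 0 < α) (hb : ∀ I ∈ S, BddSupp (b I))
    (hS : ∀ I ∈ S, 0 < I.2) (hsupp : ∀ I ∈ S, ∀ x, x ∉ ivl I → b I x = 0)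
    (hbnd : ∀ I ∈ S, ∫ x, ‖b I x‖ ≤ 4 * α * I.2)
    (hdis : (S : Set (ℝ × ℝ)).PairwiseDisjoint ivl) {p η : ℝ × ℝ → ℝ}
    (hp : ∀ I ∈ S, 2 * I.2 ≤ p I)
    (hη : ∀ I ∈ S, 0 < η I ∧ η I ≤ τ ∧ 1 / I.2 ≤ G (η I) ∧ (η I < τ → G (η I) ≤ 1 / I.2)) :
    ‖∫ x, (∑ I ∈ S, kconv (oscTrunc γ (p I) (η I)) (b I) x)
        * (starRingEnd ℂ) (∑ I ∈ S, kconv (oscTrunc γ (p I) (η I)) (b I) x)‖ₑ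
      ≤ ENNReal.ofReal (48 * Real.pi * (K ^ 3 * (2 + 4 / δ)) * α * ∑ I ∈ S, ∫ x, ‖b I x‖) := by
  classical
  have hK := h.one_le_K
  have hδ := h.δ_pos
  set C := K ^ 3 * (2 + 4 / δ) with hC
  have hC0 : 0 ≤ C := by positivity
  set κ : ℝ × ℝ → ℝ → ℂ := fun I => oscTrunc γ (p I) (η I) with hκdef
  have hp0 : ∀ I ∈ S, 0 < p I := fun I hI => by linarith [hS I hI, hp I hI]
  have hκ : ∀ I ∈ S, BddSupp (κ I) := fun I hI => h.bddSupp_oscTrunc (hp0 I hI)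
    ((hη I hI).2.1.trans h.τ_lt_one.le)
  have hF : ∀ I ∈ S, BddSupp (kconv (κ I) (b I)) := fun I hI => (hκ I hI).kconv (hb I hI)
  set a : ℝ × ℝ → ℝ × ℝ → ℝ≥0∞ := fun I J =>
    ‖∫ x, kconv (κ I) (b I) x * (starRingEnd ℂ) (kconv (κ J) (b J) x)‖ₑ with ha
  have hsymm : ∀ I J, a I J = a J I := fun I J => by
    simp only [ha]
    rw [← ofReal_norm, ← RCLike.norm_conj, ← integral_conj, ofReal_norm]
    simp only [map_mul, Complex.conj_conj, mul_comm]
  have hηmono : ∀ I ∈ S, ∀ J ∈ S, I.2 ≤ J.2 → η I ≤ η J := by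
    intro I hI J hJ hIJ
    obtain ⟨i1, i2, i3, i4⟩ := hη I hI
    obtain ⟨j1, j2, j3, j4⟩ := hη J hJ
    rcases j2.eq_or_lt with he | hlt
    · rwa [he]
    · have h1 : G (η J) ≤ G (η I) :=
        (j4 hlt).trans ((one_div_le_one_div_of_le (hS I hI) hIJ).trans i3)
      exact (h.strictAntiOn_deriv.le_iff_ge (h.mem_Ioo j1 j2) (h.mem_Ioo i1 i2)).1 h1
  -- Fix the longer interval `J`. All shorter `I` interact with it through the same Poisson kernel
  -- of scale `J.2`, so they can be summed at once before integrating against `b J`.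
  have hpair : ∀ J ∈ S, ∑ I ∈ S with I.2 ≤ J.2, a I J
      ≤ ENNReal.ofReal (24 * Real.pi * C * α * ∫ x, ‖b J x‖) := by
    intro J hJ
    have hcorr : ∀ I ∈ S, I.2 ≤ J.2 → ∀ v,
        ‖corr (κ I) (κ J) v‖ₑ ≤ ENNReal.ofReal (2 * C) * ENNReal.ofReal (J.2 / (J.2 ^ 2 + v ^ 2)) := by
      intro I hI hIJ v
      -- The Poisson bound requires the lower cut of the first kernel to be at least twice the
      -- scale; only the kernel of the longer interval is known to satisfy this, so it is moved to
      -- the front.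
      rw [← ofReal_norm, ← ENNReal.ofReal_mul (by positivity), norm_corr_comm]
      refine ENNReal.ofReal_le_ofReal ?_
      have := h.norm_corr_le_poisson (hS J hJ) (hp J hJ) (hp0 I hI) le_rfl (hηmono I hI J hJ hIJ)
        (hη J hJ).2.1 (hη J hJ).1 (hη J hJ).2.2.1 (-v)
      rwa [neg_sq] at this
    have hPm2 : ∀ I ∈ S, Measurable fun z : ℝ =>
        ∫⁻ y, ‖b I y‖ₑ * ENNReal.ofReal (J.2 / (J.2 ^ 2 + (y - z) ^ 2)) := fun I hI => by
      refine Measurable.lintegral_prod_right' (f := fun q : ℝ × ℝ =>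
        ‖b I q.2‖ₑ * ENNReal.ofReal (J.2 / (J.2 ^ 2 + (q.2 - q.1) ^ 2))) ?_
      exact ((hb I hI).measurable.comp measurable_snd).enorm.mul (measurable_const.div
        (measurable_const.add ((measurable_snd.sub measurable_fst).pow_const 2))).ennreal_ofReal
    calc ∑ I ∈ S with I.2 ≤ J.2, a I J
        ≤ ∑ I ∈ S with I.2 ≤ J.2, ∫⁻ z, ‖b J z‖ₑ * (ENNReal.ofReal (2 * C) *
          ∫⁻ y, ‖b I y‖ₑ * ENNReal.ofReal (J.2 / (J.2 ^ 2 + (y - z) ^ 2))) := by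
          refine Finset.sum_le_sum fun I hI => ?_
          obtain ⟨hI, hIJ⟩ := Finset.mem_filter.1 hI
          refine (BddSupp.enorm_integral_kconv_mul_conj_le (hκ I hI) (hκ J hJ) (hb I hI)
            (hb J hJ)).trans (lintegral_mono fun z => mul_le_mul_right ?_ _)
          rw [← lintegral_const_mul' _ _ ENNReal.ofReal_ne_top]
          refine lintegral_mono fun y => ?_
          calc ‖b I y‖ₑ * ‖corr (κ I) (κ J) (y - z)‖ₑ ≤ ‖b I y‖ₑ * (ENNReal.ofReal (2 * C) *
                ENNReal.ofReal (J.2 / (J.2 ^ 2 + (y - z) ^ 2))) :=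
                mul_le_mul_right (hcorr I hI hIJ _) _
            _ = _ := by ring
      _ = ∫⁻ z, ‖b J z‖ₑ * (ENNReal.ofReal (2 * C) * ∑ I ∈ S with I.2 ≤ J.2,
          ∫⁻ y, ‖b I y‖ₑ * ENNReal.ofReal (J.2 / (J.2 ^ 2 + (y - z) ^ 2))) := by
          rw [← lintegral_finsetSum]
          · simp only [Finset.mul_sum]
          · intro I hI
            exact (hb J hJ).measurable.enorm.mul
              ((hPm2 I (Finset.mem_filter.1 hI).1).const_mul _)
      _ ≤ ∫⁻ z, ‖b J z‖ₑ * (ENNReal.ofReal (2 * C) * ENNReal.ofReal (12 * α * Real.pi)) := by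
          refine lintegral_mono fun z => mul_le_mul_right (mul_le_mul_right ?_ _) _
          exact sum_lintegral_poisson_le hα (hS J hJ)
            (fun I hI => hb I (Finset.mem_filter.1 hI).1)
            (fun I hI => ⟨hS I (Finset.mem_filter.1 hI).1, (Finset.mem_filter.1 hI).2⟩)
            (fun I hI => hsupp I (Finset.mem_filter.1 hI).1)
            (fun I hI => hbnd I (Finset.mem_filter.1 hI).1)
            (hdis.subset (Finset.coe_subset.2 (Finset.filter_subset _ _))) z
      _ = _ := by
          rw [lintegral_mul_const _ (hb J hJ).measurable.enorm, (hb J hJ).lintegral_enorm,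
            ← ENNReal.ofReal_mul (by positivity),
            ← ENNReal.ofReal_mul (integral_nonneg fun x => norm_nonneg _)]
          congr 1
          ring
  have hexp : ∫ x, (∑ I ∈ S, kconv (κ I) (b I) x) * (starRingEnd ℂ) (∑ I ∈ S, kconv (κ I) (b I) x)
      = ∑ I ∈ S, ∑ J ∈ S, ∫ x, kconv (κ I) (b I) x * (starRingEnd ℂ) (kconv (κ J) (b J) x) := by
    have hint : ∀ I ∈ S, ∀ J ∈ S, Integrable fun x =>
        kconv (κ I) (b I) x * (starRingEnd ℂ) (kconv (κ J) (b J) x) := fun I hI J hJ => by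
      obtain ⟨M, hM⟩ := (hF I hI).bdd
      exact ((hF J hJ).conj.mul_bdd (hF I hI).measurable hM).integrable
    simp only [map_sum, Finset.sum_mul_sum]
    rw [integral_finsetSum _ fun I hI => integrable_finsetSum _ fun J hJ => hint I hI J hJ]
    exact Finset.sum_congr rfl fun I hI => integral_finsetSum _ fun J hJ => hint I hI J hJ
  rw [hexp]
  calc ‖∑ I ∈ S, ∑ J ∈ S, ∫ x, kconv (κ I) (b I) x * (starRingEnd ℂ) (kconv (κ J) (b J) x)‖ₑ
      ≤ ∑ I ∈ S, ∑ J ∈ S, a I J :=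
        (enorm_sum_le _ _).trans (Finset.sum_le_sum fun I _ => enorm_sum_le _ _)
    -- By symmetry each pair may be charged to its longer interval; pairs of equal length are
    -- counted twice, which is harmless for an upper bound.
    _ ≤ ∑ I ∈ S, ∑ J ∈ S, ((if I.2 ≤ J.2 then a I J else 0) + if J.2 ≤ I.2 then a J I else 0) := by
        refine Finset.sum_le_sum fun I _ => Finset.sum_le_sum fun J _ => ?_
        rcases le_total I.2 J.2 with hle | hle
        · rw [if_pos hle]; exact le_self_add
        · rw [if_pos hle, hsymm J I]; exact le_add_self
    _ = 2 * ∑ J ∈ S, ∑ I ∈ S with I.2 ≤ J.2, a I J := by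
        simp only [Finset.sum_add_distrib]
        rw [Finset.sum_comm, two_mul]
        simp only [Finset.sum_filter]
    _ ≤ 2 * ∑ J ∈ S, ENNReal.ofReal (24 * Real.pi * C * α * ∫ x, ‖b J x‖) := by
        gcongr with J hJ
        exact hpair J hJ
    _ = _ := by
        have hnn : ∀ J ∈ S, 0 ≤ 24 * Real.pi * C * α * ∫ x, ‖b J x‖ := fun J _ =>
          mul_nonneg (by have := Real.pi_pos; positivity) (integral_nonneg fun x => norm_nonneg _)
        rw [← ENNReal.ofReal_sum_of_nonneg hnn, ← Finset.mul_sum,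
          show (2 : ℝ≥0∞) = ENNReal.ofReal 2 by simp, ← ENNReal.ofReal_mul (by norm_num)]
        congr 1
        ring

end SingularPhase

/-! ### The weak-type estimate for the truncated kernel -/

theorem oscTrunc_add (γ : ℝ → ℝ) {p q r : ℝ} (hpq : p ≤ q) (hqr : q ≤ r) (x : ℝ) :
    oscTrunc γ p r x = oscTrunc γ p q x + oscTrunc γ q r x := by
  simp only [oscTrunc]
  rw [← Ioc_union_Ioc_eq_Ioc hpq hqr, indicator_union_of_disjoint]
  rw [Set.disjoint_left]
  exact fun y hy hy' => absurd hy.2 (not_le.2 hy'.1)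

/-- Local, oscillatory and regular pieces of the kernel. The maxima and minima make the identity
valid for every order of `p`, `d` and `η`, with some of the pieces empty. -/
theorem oscTrunc_split (γ : ℝ → ℝ) {p τ d η : ℝ} (hη : η ≤ τ) (x : ℝ) :
    oscTrunc γ p τ x = oscTrunc γ p (min d τ) x + (oscTrunc γ (max p d) η x
      + oscTrunc γ (max p (max d η)) τ x) := by
  simp only [oscTrunc, indicator_apply, mem_Ioc, max_lt_iff, le_min_iff]
  rcases le_or_gt x d with h1 | h1
  · simp [h1, not_lt.2 h1]
  · rcases le_or_gt x η with h2 | h2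
    · simp [h1, not_le.2 h1, h2, not_lt.2 h2, h2.trans hη]
    · simp [h1, not_le.2 h1, h2, not_le.2 h2]

namespace SingularPhase

variable {γ G G₂ : ℝ → ℝ} {τ δ K : ℝ}

/-- The `L²` estimate for bounded functions. -/
theorem enorm_integral_kconv_le {κ g : ℝ → ℂ} {α B : ℝ} (hκ : BddSupp κ) (hg : BddSupp g)
    (hα : 0 < α) (hgα : ∀ x, ‖g x‖ ≤ α)
    (hB : ∫⁻ v, ‖corr κ κ v‖ₑ ≤ ENNReal.ofReal B) :
    ‖∫ x, kconv κ g x * (starRingEnd ℂ) (kconv κ g x)‖ₑ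
      ≤ ENNReal.ofReal (α * B * ∫ x, ‖g x‖) := by
  refine (BddSupp.enorm_integral_kconv_mul_conj_le hκ hκ hg hg).trans ?_
  calc ∫⁻ z, ‖g z‖ₑ * ∫⁻ y, ‖g y‖ₑ * ‖corr κ κ (y - z)‖ₑ
      ≤ ∫⁻ z, ‖g z‖ₑ * (ENNReal.ofReal α * ENNReal.ofReal B) := by
        refine lintegral_mono fun z => mul_le_mul_right ?_ _
        calc ∫⁻ y, ‖g y‖ₑ * ‖corr κ κ (y - z)‖ₑ
            ≤ ∫⁻ y, ENNReal.ofReal α * ‖corr κ κ (y - z)‖ₑ := by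
              refine lintegral_mono fun y => mul_le_mul_left ?_ _
              rw [← ofReal_norm]
              exact ENNReal.ofReal_le_ofReal (hgα y)
          _ = ENNReal.ofReal α * ∫⁻ v, ‖corr κ κ v‖ₑ := by
              rw [lintegral_const_mul' _ _ ENNReal.ofReal_ne_top,
                lintegral_sub_right_eq_self (fun v => ‖corr κ κ v‖ₑ) z]
          _ ≤ _ := by gcongr
    _ = _ := by
        rw [lintegral_mul_const _ hg.measurable.enorm, hg.lintegral_enorm,
          ← ENNReal.ofReal_mul hα.le, ← ENNReal.ofReal_mul (integral_nonneg fun x => norm_nonneg _)]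
        congr 1
        ring

/-- Each bad function gets its own splitting of the kernel, at `2 * I.2` and at the scale `η I.2`.
Outside the exceptional set `E` three terms remain, each tested at height `α / 3`: the good part and
the oscillatory part in `L²`, the regular part in `L¹`. -/
theorem exists_weakType_kconv (h : SingularPhase γ G G₂ τ δ K) :
    ∃ A : ℝ, 0 ≤ A ∧ ∀ p : ℝ, 0 < p → ∀ f : ℝ → ℂ, Continuous f → HasCompactSupport f →
      ∀ α : ℝ, 0 < α → volume {x | α < ‖kconv (oscTrunc γ p τ) f x‖}
        ≤ ENNReal.ofReal (A / α * ∫ x, ‖f x‖) := by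
  classical
  obtain ⟨B, hB0, hB⟩ := h.exists_lintegral_corr_self_le
  have hK := h.one_le_K
  have hδ := h.δ_pos
  have hτ1 := h.τ_lt_one.le
  set C := K ^ 3 * (2 + 4 / δ) with hC
  have hC0 : 0 ≤ C := by positivity
  have hπ := Real.pi_pos
  -- The good part gives `54 = 2 * 3 * 9`, the exceptional set `3`, the oscillatory part `864 = 48 *
  -- 2 * 9` and the regular part `6 = 3 * 2`; the factors `9` and `3` come from the height `α / 3`.
  refine ⟨54 * B + 3 + 864 * Real.pi * C + 6 * (2 * K + 2), by positivity,
    fun p hp f hf hc α hα => ?_⟩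
  obtain ⟨S, g, b, hg, hb, hfgb, hgα, hgF, hS, hsupp, hb0, hbnd, hbF, hSF, hdis⟩ :=
    exists_calderonZygmund hf hc hα
  choose η hη using h.exists_scale
  set F := ∫ x, ‖f x‖ with hF
  have hF0 : 0 ≤ F := integral_nonneg fun x => norm_nonneg _
  set κ := oscTrunc γ p τ with hκdef
  have hκ : BddSupp κ := h.bddSupp_oscTrunc hp hτ1
  set κ₁ : ℝ × ℝ → ℝ → ℂ := fun I => oscTrunc γ p (min (2 * I.2) τ) with hκ₁
  set κ₂ : ℝ × ℝ → ℝ → ℂ := fun I => oscTrunc γ (max p (2 * I.2)) (η I.2) with hκ₂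
  set κ₃ : ℝ × ℝ → ℝ → ℂ := fun I => oscTrunc γ (max p (max (2 * I.2) (η I.2))) τ with hκ₃
  have hη' : ∀ I ∈ S, 0 < η I.2 ∧ η I.2 ≤ τ ∧ 1 / I.2 ≤ G (η I.2) ∧
      (η I.2 < τ → G (η I.2) ≤ 1 / I.2) := fun I _ => hη I.2
  have b1 : ∀ I ∈ S, BddSupp (κ₁ I) := fun I _ =>
    h.bddSupp_oscTrunc hp ((min_le_right _ _).trans hτ1)
  have b2 : ∀ I ∈ S, BddSupp (κ₂ I) := fun I hI =>
    h.bddSupp_oscTrunc (hp.trans_le (le_max_left _ _)) ((hη' I hI).2.1.trans hτ1)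
  have b3 : ∀ I ∈ S, BddSupp (κ₃ I) := fun I _ =>
    h.bddSupp_oscTrunc (hp.trans_le (le_max_left _ _)) hτ1
  have hsplit : ∀ I ∈ S, ∀ x, kconv κ (b I) x
      = kconv (κ₁ I) (b I) x + (kconv (κ₂ I) (b I) x + kconv (κ₃ I) (b I) x) := by
    intro I hI x
    have e : κ = fun y => κ₁ I y + (κ₂ I y + κ₃ I y) :=
      funext fun y => oscTrunc_split γ (hη' I hI).2.1 y
    rw [e, (b1 I hI).add_kconv ((b2 I hI).add (b3 I hI)) (hb I hI),
      (b2 I hI).add_kconv (b3 I hI) (hb I hI)]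
  set P : ℝ → ℂ := fun x => ∑ I ∈ S, kconv (κ₂ I) (b I) x with hP
  set R : ℝ → ℂ := fun x => ∑ I ∈ S, kconv (κ₃ I) (b I) x with hR
  have hPb : BddSupp P := BddSupp.sum fun I hI => (b2 I hI).kconv (hb I hI)
  have hRb : BddSupp R := BddSupp.sum fun I hI => (b3 I hI).kconv (hb I hI)
  have hTf : ∀ x, kconv κ f x
      = kconv κ g x + (∑ I ∈ S, kconv (κ₁ I) (b I) x) + P x + R x := by
    intro x
    have e : kconv κ f x = kconv κ (fun y => g y + ∑ I ∈ S, b I y) x := by rw [← hfgb]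
    rw [e, hκ.kconv_add hg (BddSupp.sum hb), hκ.kconv_sum hb, Finset.sum_congr rfl fun I hI =>
      hsplit I hI x, Finset.sum_add_distrib, Finset.sum_add_distrib]
    simp only [hP, hR]
    ring
  -- The kernel lives on positive `t`, so enlarging each interval to the right only is enough:
  -- translates by at most `2 * I.2` stay in `[I.1, I.1 + 3 * I.2)`.
  set E : Set ℝ := ⋃ I ∈ S, ivl (I.1, 3 * I.2) with hE
  have hloc : ∀ x, x ∉ E → ∑ I ∈ S, kconv (κ₁ I) (b I) x = 0 := by
    intro x hx
    refine Finset.sum_eq_zero fun I hI => integral_eq_zero_of_ae (Eventually.of_forall fun y => ?_)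
    change κ₁ I (x - y) * b I y = 0
    by_cases hy : y ∈ ivl I
    · have : x - y ∉ Ioc p (min (2 * I.2) τ) := by
        intro hm
        refine hx (mem_iUnion₂.2 ⟨I, hI, ?_, ?_⟩)
        · linarith [hy.1, hm.1]
        · have := hm.2.trans (min_le_left _ _)
          simp only
          linarith [hy.2]
      simp only [hκ₁, oscTrunc]
      rw [indicator_of_notMem this, zero_mul]
    · rw [hsupp I hI y hy, mul_zero]
  have hsub : {x | α < ‖kconv κ f x‖} ⊆ E ∪ ({x | α / 3 < ‖kconv κ g x‖} ∪
      ({x | α / 3 < ‖P x‖} ∪ {x | α / 3 < ‖R x‖})) := by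
    intro x hx
    by_contra hcon
    simp only [mem_union, mem_ofPred_eq, not_or, not_lt] at hcon
    obtain ⟨h1, h2, h3, h4⟩ := hcon
    rw [mem_ofPred_eq, hTf, hloc x h1, add_zero] at hx
    have := norm_add₃_le (a := kconv κ g x) (b := P x) (c := R x)
    linarith
  have vE : volume E ≤ ENNReal.ofReal (3 / α * F) := by
    calc volume E ≤ ∑ I ∈ S, volume (ivl (I.1, 3 * I.2)) := measure_biUnion_finset_le _ _
      _ = ENNReal.ofReal (∑ I ∈ S, 3 * I.2) := by
          rw [ENNReal.ofReal_sum_of_nonneg fun I hI => by linarith [hS I hI]]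
          simp only [volume_ivl]
      _ ≤ _ := by
          refine ENNReal.ofReal_le_ofReal ?_
          rw [← Finset.mul_sum]
          calc 3 * ∑ I ∈ S, I.2 ≤ 3 * (F / α) := by gcongr
            _ = _ := by ring
  have vG : volume {x | α / 3 < ‖kconv κ g x‖} ≤ ENNReal.ofReal (54 * B / α * F) := by
    refine ((hκ.kconv hg).measure_lt_norm_le (by positivity)).trans ?_
    refine (ENNReal.div_le_div_right (enorm_integral_kconv_le hκ hg (by positivity) hgα
      (hB p hp)) _).trans ?_
    rw [← ENNReal.ofReal_div_of_pos (by positivity)]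
    refine ENNReal.ofReal_le_ofReal ?_
    calc 2 * α * B * (∫ x, ‖g x‖) / (α / 3) ^ 2 ≤ 2 * α * B * (3 * F) / (α / 3) ^ 2 := by gcongr
      _ = _ := by field_simp; ring
  have vP : volume {x | α / 3 < ‖P x‖} ≤ ENNReal.ofReal (864 * Real.pi * C / α * F) := by
    refine (hPb.measure_lt_norm_le (by positivity)).trans ?_
    refine (ENNReal.div_le_div_right (h.enorm_integral_sum_le hα hb hS hsupp hbnd hdis
      (fun I _ => le_max_right _ _) hη') _).trans ?_
    rw [← ENNReal.ofReal_div_of_pos (by positivity)]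
    refine ENNReal.ofReal_le_ofReal ?_
    calc _ ≤ 48 * Real.pi * C * α * (2 * F) / (α / 3) ^ 2 := by gcongr
      _ = _ := by field_simp; ring
  have vR : volume {x | α / 3 < ‖R x‖} ≤ ENNReal.ofReal (6 * (2 * K + 2) / α * F) := by
    refine (measure_lt_norm_le_lintegral hRb.measurable (by positivity)).trans ?_
    have hI : ∀ I ∈ S, ∫⁻ x, ‖kconv (κ₃ I) (b I) x‖ₑ
        ≤ ENNReal.ofReal (2 * K + 2) * ENNReal.ofReal (∫ x, ‖b I x‖) := by
      intro I hI
      rw [← (hb I hI).lintegral_enorm]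
      obtain ⟨e1, e2, e3, e4⟩ := hη' I hI
      have hI0 := hS I hI
      refine BddSupp.lintegral_enorm_kconv_le_of_integral_eq_zero (b3 I hI) (hb I hI) (hb0 I hI)
        (a := I.1) fun y hy => ?_
      have hyI : y ∈ ivl I := by
        by_contra hcon
        exact hy (hsupp I hI y hcon)
      have hc1 : 2 * I.2 ≤ max p (max (2 * I.2) (η I.2)) :=
        (le_max_left _ _).trans (le_max_right _ _)
      have hc2 : η I.2 ≤ max p (max (2 * I.2) (η I.2)) :=
        (le_max_right _ _).trans (le_max_right _ _)
      -- The displacement is `y - I.1 < I.2`. If the lower cut is below `τ`, then so is `η I.2`,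
      -- hence `G ≤ 1 / I.2` at the cut: the phase moves by at most `O(1)`.
      refine h.lintegral_oscTrunc_sub_le (hp.trans_le (le_max_left _ _)) (by linarith [hyI.1])
        (by linarith [hyI.2]) fun hlt => ?_
      have hηlt := hc2.trans_lt hlt
      have hm := h.mem_Ioo (hp.trans_le (le_max_left _ (max (2 * I.2) (η I.2)))) hlt.le
      have h1 : G (max p (max (2 * I.2) (η I.2))) ≤ 1 / I.2 :=
        (h.strictAntiOn_deriv.antitoneOn (h.mem_Ioo e1 e2) hm hc2).trans (e4 hηlt)
      have h2 := h.deriv_pos _ hm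
      calc (y - I.1) * G (max p (max (2 * I.2) (η I.2))) ≤ I.2 * (1 / I.2) := by
            gcongr
            linarith [hyI.2]
        _ = 1 := by field_simp
    have hsum : ∫⁻ x, ‖R x‖ₑ ≤ ENNReal.ofReal ((2 * K + 2) * (2 * F)) := by
      calc ∫⁻ x, ‖R x‖ₑ ≤ ∫⁻ x, ∑ I ∈ S, ‖kconv (κ₃ I) (b I) x‖ₑ :=
            lintegral_mono fun x => enorm_sum_le _ _
        _ = ∑ I ∈ S, ∫⁻ x, ‖kconv (κ₃ I) (b I) x‖ₑ :=
            lintegral_finsetSum _ fun I hI => ((b3 I hI).kconv (hb I hI)).measurable.enorm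
        _ ≤ ∑ I ∈ S, ENNReal.ofReal (2 * K + 2) * ENNReal.ofReal (∫ x, ‖b I x‖) :=
            Finset.sum_le_sum hI
        _ = ENNReal.ofReal ((2 * K + 2) * ∑ I ∈ S, ∫ x, ‖b I x‖) := by
            rw [← Finset.mul_sum, ← ENNReal.ofReal_sum_of_nonneg fun I _ =>
              integral_nonneg fun x => norm_nonneg _, ← ENNReal.ofReal_mul (by positivity)]
        _ ≤ _ := by gcongr
    refine (ENNReal.div_le_div_right hsum _).trans ?_
    rw [← ENNReal.ofReal_div_of_pos (by positivity)]
    refine ENNReal.ofReal_le_ofReal (le_of_eq ?_)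
    field_simp
    ring
  calc volume {x | α < ‖kconv κ f x‖}
      ≤ volume E + (volume {x | α / 3 < ‖kconv κ g x‖} +
        (volume {x | α / 3 < ‖P x‖} + volume {x | α / 3 < ‖R x‖})) :=
        (measure_mono hsub).trans ((measure_union_le _ _).trans (add_le_add le_rfl
          ((measure_union_le _ _).trans (add_le_add le_rfl (measure_union_le _ _)))))
    _ ≤ ENNReal.ofReal (3 / α * F) + (ENNReal.ofReal (54 * B / α * F) +
        (ENNReal.ofReal (864 * Real.pi * C / α * F) +
          ENNReal.ofReal (6 * (2 * K + 2) / α * F))) := by gcongr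
    _ = _ := by
        rw [← ENNReal.ofReal_add (by positivity) (by positivity),
          ← ENNReal.ofReal_add (by positivity) (by positivity),
          ← ENNReal.ofReal_add (by positivity) (by positivity)]
        congr 1
        ring

end SingularPhase

/-! ### From the truncated operators to the limit on test functions -/

theorem truncatedT_eq_kconv (γ : ℝ → ℝ) {ε : ℝ} (hε1 : ε ≤ 1) (f : ℝ → ℂ) :
    truncatedT γ ε f = kconv (oscTrunc γ ε 1) f := by
  funext x
  rw [truncatedT, intervalIntegral.integral_of_le hε1, ← integral_indicator measurableSet_Ioc,
    kconv, ← integral_sub_left_eq_self _ volume x]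
  refine integral_congr_ae (Eventually.of_forall fun t => ?_)
  simp only [oscTrunc]
  by_cases ht : x - t ∈ Ioc ε 1
  · rw [indicator_of_mem ht, indicator_of_mem ht, oscKernel, sub_sub_cancel]
    ring
  · rw [indicator_of_notMem ht, indicator_of_notMem ht, zero_mul]

theorem BddSupp.integrable_mul_of_integrable {κ f : ℝ → ℂ} (hκ : BddSupp κ) (hf : Integrable f)
    (x : ℝ) : Integrable (fun y => κ (x - y) * f y) := by
  obtain ⟨M, hM⟩ := hκ.bdd
  exact hf.bdd_mul (c := M)
    (hκ.measurable.comp (measurable_const.sub measurable_id)).aestronglyMeasurable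
    (Eventually.of_forall fun y => hM _)

theorem BddSupp.kconv_sub_of_integrable {κ f g : ℝ → ℂ} (hκ : BddSupp κ) (hf : Integrable f)
    (hg : Integrable g) (x : ℝ) : _root_.kconv κ (f - g) x = _root_.kconv κ f x - _root_.kconv κ g x := by
  simp only [_root_.kconv, Pi.sub_apply, mul_sub]
  exact integral_sub (hκ.integrable_mul_of_integrable hf x) (hκ.integrable_mul_of_integrable hg x)

theorem norm_kconv_le {κ f : ℝ → ℂ} {M : ℝ} (hM : ∀ x, ‖κ x‖ ≤ M) (hf : Integrable f) (x : ℝ) :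
    ‖kconv κ f x‖ ≤ M * ∫ y, ‖f y‖ := by
  rw [← integral_const_mul]
  refine norm_integral_le_of_norm_le (hf.norm.const_mul M) (Eventually.of_forall fun y => ?_)
  rw [norm_mul]
  exact mul_le_mul_of_nonneg_right (hM _) (norm_nonneg _)

theorem eLpNorm_one_eq_ofReal {f : ℝ → ℂ} (hf : Integrable f) :
    eLpNorm f 1 volume = ENNReal.ofReal (∫ x, ‖f x‖) := by
  rw [eLpNorm_one_eq_lintegral_enorm, ofReal_integral_norm_eq_lintegral_enorm hf]

/-- A weak-type bound passes to limits. -/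
theorem WeakTypeOneOneBound.of_approx {A : ℝ} {f g : ℝ → ℂ} (hf : Integrable f)
    (happ : ∀ η : ℝ, 0 < η → ∃ f' g' : ℝ → ℂ, WeakTypeOneOneBound A f' g' ∧
      eLpNorm f' 1 volume ≤ eLpNorm f 1 volume + ENNReal.ofReal η ∧
      volume {x | η ≤ ‖g x - g' x‖} ≤ ENNReal.ofReal η) :
    WeakTypeOneOneBound A f g := by
  intro α hα
  have hN : eLpNorm f 1 volume ≠ ⊤ := by
    rw [eLpNorm_one_eq_ofReal hf]; exact ENNReal.ofReal_ne_top
  have hη : Tendsto (fun η : ℝ => ENNReal.ofReal η) (𝓝[>] 0) (𝓝 0) := by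
    have := (ENNReal.continuous_ofReal.tendsto 0).mono_left (nhdsWithin_le_nhds (s := Ioi 0))
    simpa using this
  have h1 : Tendsto (fun η : ℝ => ENNReal.ofReal (A / (α - η))) (𝓝[>] 0)
      (𝓝 (ENNReal.ofReal (A / α))) := by
    refine (ENNReal.continuous_ofReal.tendsto _).comp (Tendsto.mono_left ?_ nhdsWithin_le_nhds)
    have : ContinuousAt (fun η : ℝ => A / (α - η)) 0 :=
      continuousAt_const.div (continuousAt_const.sub continuousAt_id) (by simpa using hα.ne')
    simpa [ContinuousAt] using this
  have h2 : Tendsto (fun η : ℝ => ENNReal.ofReal (A / (α - η)) *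
      (eLpNorm f 1 volume + ENNReal.ofReal η) + ENNReal.ofReal η) (𝓝[>] 0)
      (𝓝 (ENNReal.ofReal (A / α) * (eLpNorm f 1 volume + 0) + 0)) := by
    refine Tendsto.add (ENNReal.Tendsto.mul h1 (Or.inr ?_) (tendsto_const_nhds.add hη)
      (Or.inr ENNReal.ofReal_ne_top)) hη
    simpa using hN
  rw [add_zero, add_zero] at h2
  refine ge_of_tendsto h2 ?_
  filter_upwards [Ioo_mem_nhdsGT hα] with η hη
  obtain ⟨f', g', hw, hf', hg'⟩ := happ η hη.1
  have hsub : {x | α < ‖g x‖} ⊆ {x | α - η < ‖g' x‖} ∪ {x | η ≤ ‖g x - g' x‖} := by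
    intro x hx
    by_contra hcon
    simp only [mem_union, mem_ofPred_eq, not_or, not_lt, not_le] at hcon hx
    have := norm_sub_norm_le (g x) (g' x)
    linarith
  calc volume {x | α < ‖g x‖} ≤ volume {x | α - η < ‖g' x‖} + volume {x | η ≤ ‖g x - g' x‖} :=
        (measure_mono hsub).trans (measure_union_le _ _)
    _ ≤ ENNReal.ofReal (A / (α - η)) * eLpNorm f' 1 volume + ENNReal.ofReal η :=
        add_le_add (hw _ (by linarith [hη.2])) hg'
    _ ≤ _ := by gcongr

theorem exists_testFunction_approx {f : ℝ → ℂ} (hf : Integrable f) {η : ℝ} (hη : 0 < η) :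
    ∃ g : ℝ → ℂ, ContDiff ℝ ∞ g ∧ HasCompactSupport g ∧ ∫ x, ‖(f - g) x‖ ≤ η := by
  obtain ⟨g, h1, h2, h3⟩ := MemLp.exist_eLpNorm_sub_le ENNReal.one_ne_top le_rfl
    (memLp_one_iff_integrable.2 hf) hη
  refine ⟨g, h2, h1, ?_⟩
  rw [eLpNorm_one_eq_ofReal (hf.sub (h2.continuous.integrable_of_hasCompactSupport h1))] at h3
  exact (ENNReal.ofReal_le_ofReal_iff hη.le).1 h3

theorem eLpNorm_le_add_of_integral_sub_le {f g : ℝ → ℂ} (hf : Integrable f) (hg : Integrable g)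
    {η : ℝ} (h : ∫ x, ‖(f - g) x‖ ≤ η) :
    eLpNorm g 1 volume ≤ eLpNorm f 1 volume + ENNReal.ofReal η := by
  have e : g = f - (f - g) := by simp
  calc eLpNorm g 1 volume = eLpNorm (f - (f - g)) 1 volume := by rw [← e]
    _ ≤ eLpNorm f 1 volume + eLpNorm (f - g) 1 volume :=
        eLpNorm_sub_le hf.aestronglyMeasurable (hf.sub hg).aestronglyMeasurable le_rfl
    _ ≤ _ := by
        rw [eLpNorm_one_eq_ofReal (hf.sub hg)]
        gcongr

namespace SingularPhase

variable {γ G G₂ : ℝ → ℝ} {τ δ K : ℝ}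

theorem truncatedT_sub (h : SingularPhase γ G G₂ τ δ K) {f g : ℝ → ℂ} (hf : Integrable f)
    (hg : Integrable g) {ε : ℝ} (hε : 0 < ε) (hε1 : ε ≤ 1) (x : ℝ) :
    truncatedT γ ε (f - g) x = truncatedT γ ε f x - truncatedT γ ε g x := by
  simp only [truncatedT_eq_kconv γ hε1]
  exact (h.bddSupp_oscTrunc hε le_rfl).kconv_sub_of_integrable hf hg x

/-- The piece of the kernel on `(τ, 1]` has `L¹` norm at most `1 / τ`, so it is bounded on `L¹` and
needs no oscillation. For fixed `ε` the kernel is bounded, so `L¹` approximation of `f` gives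
uniform approximation of the output, and the bound extends from test functions with a constant free
of `ε`. -/
theorem exists_weakType_truncatedT (h : SingularPhase γ G G₂ τ δ K) :
    ∃ A : ℝ, 0 < A ∧ ∀ ε : ℝ, 0 < ε → ε ≤ τ → ∀ f : ℝ → ℂ, Integrable f →
      WeakTypeOneOneBound A f (truncatedT γ ε f) := by
  obtain ⟨A, hA0, hA⟩ := h.exists_weakType_kconv
  have hτ0 := h.τ_pos
  have hτ1 := h.τ_lt_one
  have htest : ∀ ε : ℝ, 0 < ε → ε ≤ τ → ∀ f : ℝ → ℂ, Continuous f → HasCompactSupport f →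
      WeakTypeOneOneBound (2 * A + 2 / τ) f (truncatedT γ ε f) := by
    intro ε hε hετ f hf hc α hα
    have hfi : Integrable f := hf.integrable_of_hasCompactSupport hc
    have hfb := hc.bddSupp hf
    have hF0 : 0 ≤ ∫ x, ‖f x‖ := integral_nonneg fun x => norm_nonneg _
    have k1 : BddSupp (oscTrunc γ ε τ) := h.bddSupp_oscTrunc hε hτ1.le
    have k2 : BddSupp (oscTrunc γ τ 1) := h.bddSupp_oscTrunc hτ0 le_rfl
    have hT : ∀ x, truncatedT γ ε f x
        = kconv (oscTrunc γ ε τ) f x + kconv (oscTrunc γ τ 1) f x := fun x => by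
      rw [truncatedT_eq_kconv γ (hετ.trans hτ1.le), ← k1.add_kconv k2 hfb]
      congr 1
      exact funext fun y => oscTrunc_add γ hετ hτ1.le y
    have v2 : volume {x | α / 2 < ‖kconv (oscTrunc γ τ 1) f x‖}
        ≤ ENNReal.ofReal (2 / τ / α * ∫ x, ‖f x‖) := by
      refine (measure_lt_norm_le_lintegral (k2.kconv hfb).measurable (by positivity)).trans ?_
      have hk : ∫⁻ x, ‖oscTrunc γ τ 1 x‖ₑ ≤ ENNReal.ofReal (1 / τ) := by
        calc ∫⁻ x, ‖oscTrunc γ τ 1 x‖ₑ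
            ≤ ∫⁻ x, (Ioc τ 1).indicator (fun _ => ENNReal.ofReal (1 / τ)) x := by
              refine lintegral_mono fun x => ?_
              by_cases hx : x ∈ Ioc τ 1
              · rw [indicator_of_mem hx, ← ofReal_norm]
                exact ENNReal.ofReal_le_ofReal (norm_oscTrunc_le γ hτ0 x)
              · rw [oscTrunc, indicator_of_notMem hx, indicator_of_notMem hx, enorm_zero]
          _ = ENNReal.ofReal (1 / τ) * ENNReal.ofReal (1 - τ) := by
              rw [lintegral_indicator_const measurableSet_Ioc, Real.volume_Ioc]
          _ ≤ _ := by
              rw [← ENNReal.ofReal_mul (by positivity)]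
              exact ENNReal.ofReal_le_ofReal (mul_le_of_le_one_right (by positivity) (by linarith))
      calc (∫⁻ x, ‖kconv (oscTrunc γ τ 1) f x‖ₑ) / ENNReal.ofReal (α / 2)
          ≤ (ENNReal.ofReal (1 / τ) * ENNReal.ofReal (∫ x, ‖f x‖)) / ENNReal.ofReal (α / 2) := by
            refine ENNReal.div_le_div_right ((k2.lintegral_enorm_kconv_le hfb).trans ?_) _
            rw [hfb.lintegral_enorm]
            gcongr
        _ = _ := by
            rw [← ENNReal.ofReal_mul (by positivity), ← ENNReal.ofReal_div_of_pos (by positivity)]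
            congr 1
            field_simp
    have hsub : {x | α < ‖truncatedT γ ε f x‖} ⊆ {x | α / 2 < ‖kconv (oscTrunc γ ε τ) f x‖} ∪
        {x | α / 2 < ‖kconv (oscTrunc γ τ 1) f x‖} := by
      intro x hx
      by_contra hcon
      simp only [mem_union, mem_ofPred_eq, not_or, not_lt] at hcon
      rw [mem_ofPred_eq, hT] at hx
      have := norm_add_le (kconv (oscTrunc γ ε τ) f x) (kconv (oscTrunc γ τ 1) f x)
      linarith
    calc volume {x | α < ‖truncatedT γ ε f x‖}
        ≤ ENNReal.ofReal (A / (α / 2) * ∫ x, ‖f x‖) + ENNReal.ofReal (2 / τ / α * ∫ x, ‖f x‖) :=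
          (measure_mono hsub).trans ((measure_union_le _ _).trans
            (add_le_add (hA ε hε f hf hc _ (by positivity)) v2))
      _ = _ := by
          rw [eLpNorm_one_eq_ofReal hfi, ← ENNReal.ofReal_mul (by positivity),
            ← ENNReal.ofReal_add (by positivity) (by positivity)]
          congr 1
          field_simp
  refine ⟨2 * A + 2 / τ, by positivity, fun ε hε hετ f hf => ?_⟩
  refine WeakTypeOneOneBound.of_approx hf fun η hη => ?_
  -- Since the kernel is at most `1 / ε`, the tolerance `ε * η / 2` keeps the outputs within `η / 2`
  -- at every point, and the exceptional set is empty.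
  obtain ⟨g, hg, hgc, hfg⟩ := exists_testFunction_approx hf
    (show 0 < min η (ε * η / 2) from lt_min hη (by positivity))
  have hgi : Integrable g := hg.continuous.integrable_of_hasCompactSupport hgc
  refine ⟨g, truncatedT γ ε g, htest ε hε hετ g hg.continuous hgc,
    eLpNorm_le_add_of_integral_sub_le hf hgi (hfg.trans (min_le_left _ _)), ?_⟩
  have he : {x | η ≤ ‖truncatedT γ ε f x - truncatedT γ ε g x‖} = ∅ := by
    refine eq_empty_of_forall_notMem fun x hx => ?_
    have hε1 := hετ.trans hτ1.le
    rw [mem_ofPred_eq, ← h.truncatedT_sub hf hgi hε hε1, truncatedT_eq_kconv γ hε1] at hx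
    have h1 := norm_kconv_le (norm_oscTrunc_le γ (q := 1) hε) (hf.sub hgi) x
    have h2 : 1 / ε * ∫ y, ‖(f - g) y‖ ≤ 1 / ε * (ε * η / 2) := by
      gcongr
      exact hfg.trans (min_le_right _ _)
    have h3 : 1 / ε * (ε * η / 2) = η / 2 := by field_simp
    linarith
  rw [he, measure_empty]
  exact zero_le

theorem exists_norm_truncatedT_sub_le (h : SingularPhase γ G G₂ τ δ K) {f : ℝ → ℂ}
    (hf : ContDiff ℝ ∞ f) (hc : HasCompactSupport f) :
    ∃ D : ℝ, ∀ a b : ℝ, 0 < a → a ≤ b → b ≤ τ → ∀ x,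
      ‖truncatedT γ a f x - truncatedT γ b f x‖ ≤ D * (b / τ) ^ δ := by
  have hτ1 := h.τ_lt_one
  have hd : Differentiable ℝ f := hf.differentiable (by simp)
  have hdc : Continuous (deriv f) := hf.continuous_deriv (by exact_mod_cast le_top)
  obtain ⟨M, hM⟩ := hf.continuous.bounded_above_of_compact_support hc
  obtain ⟨M', hM'⟩ := hdc.bounded_above_of_compact_support hc.deriv
  refine ⟨max M M' * (K / (τ * G τ)) * (2 + 3 / δ), fun a b ha hab hb x => ?_⟩
  have hcont : ContinuousOn
      (fun t : ℝ => Complex.exp (Complex.I * (γ t : ℂ)) * f (x - t) / (t : ℂ)) (Ioc 0 1) := by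
    have e : (fun t : ℝ => Complex.exp (Complex.I * (γ t : ℂ)) * f (x - t) / (t : ℂ))
        = fun t => oscKernel γ t * f (x - t) := by
      funext t; rw [oscKernel]; ring
    rw [e]
    exact h.continuousOn_oscKernel.mul
      (hf.continuous.comp (continuous_const.sub continuous_id)).continuousOn
  have hii : ∀ p q : ℝ, 0 < p → p ≤ q → q ≤ 1 → IntervalIntegrable
      (fun t : ℝ => Complex.exp (Complex.I * (γ t : ℂ)) * f (x - t) / (t : ℂ)) volume p q := by
    intro p q hp hpq hq
    refine ContinuousOn.intervalIntegrable (hcont.mono ?_)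
    rw [uIcc_of_le hpq]
    exact fun t ht => ⟨hp.trans_le ht.1, ht.2.trans hq⟩
  have hb0 := ha.trans_le hab
  have hb1 : b ≤ 1 := hb.trans hτ1.le
  have e : truncatedT γ a f x - truncatedT γ b f x
      = ∫ t in a..b, Complex.exp (Complex.I * (γ t : ℂ)) * f (x - t) / (t : ℂ) := by
    simp only [truncatedT]
    rw [sub_eq_iff_eq_add, intervalIntegral.integral_add_adjacent_intervals
      (hii a b ha hab hb1) (hii b 1 hb0 hb1 le_rfl)]
  rw [e]
  exact h.norm_integral_tail_le (fun y => (hd y).hasDerivAt)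
    (fun y => (hM y).trans (le_max_left _ _)) (fun y => (hM' y).trans (le_max_right _ _)) ha hab hb x

theorem tendsto_mul_div_rpow (h : SingularPhase γ G G₂ τ δ K) (D : ℝ) :
    Tendsto (fun b : ℝ => D * (b / τ) ^ δ) (𝓝[>] 0) (𝓝 0) := by
  have hc : Continuous fun b : ℝ => D * (b / τ) ^ δ :=
    continuous_const.mul ((continuous_id.div_const τ).rpow_const fun _ => Or.inr h.δ_pos.le)
  have := (hc.tendsto 0).mono_left (nhdsWithin_le_nhds (s := Ioi 0))
  simpa [Real.zero_rpow h.δ_pos.ne'] using this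

theorem tendsto_truncatedT (h : SingularPhase γ G G₂ τ δ K) {f : ℝ → ℂ}
    (hf : ContDiff ℝ ∞ f) (hc : HasCompactSupport f) (x : ℝ) :
    Tendsto (fun ε => truncatedT γ ε f x) (𝓝[>] (0 : ℝ)) (𝓝 (T₁ γ f x)) := by
  obtain ⟨D, hD⟩ := h.exists_norm_truncatedT_sub_le hf hc
  refine tendsto_nhds_limUnder (cauchy_map_iff_exists_tendsto.1 (Metric.cauchy_iff.2
    ⟨inferInstance, fun η hη => ?_⟩))
  obtain ⟨b, hb1, hb2⟩ := (((h.tendsto_mul_div_rpow D).eventually_lt_const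
    (half_pos hη)).and (Ioc_mem_nhdsGT h.τ_pos)).exists
  refine ⟨_, image_mem_map (Ioc_mem_nhdsGT hb2.1), ?_⟩
  rintro _ ⟨s, hs, rfl⟩ _ ⟨t, ht, rfl⟩
  have h1 := hD s b hs.1 hs.2 hb2.2 x
  have h2 := hD t b ht.1 ht.2 hb2.2 x
  have h3 := dist_triangle_right (truncatedT γ s f x) (truncatedT γ t f x) (truncatedT γ b f x)
  rw [dist_eq_norm _ (truncatedT γ b f x), dist_eq_norm _ (truncatedT γ b f x)] at h3
  linarith

theorem exists_norm_truncatedT_sub_T₁_lt (h : SingularPhase γ G G₂ τ δ K) {f : ℝ → ℂ}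
    (hf : ContDiff ℝ ∞ f) (hc : HasCompactSupport f) {η : ℝ} (hη : 0 < η) :
    ∀ᶠ b in 𝓝[>] (0 : ℝ), ∀ x, ‖truncatedT γ b f x - T₁ γ f x‖ < η := by
  obtain ⟨D, hD⟩ := h.exists_norm_truncatedT_sub_le hf hc
  filter_upwards [(h.tendsto_mul_div_rpow D).eventually_lt_const hη, Ioc_mem_nhdsGT h.τ_pos]
    with b hb1 hb2 x
  refine lt_of_le_of_lt ?_ hb1
  refine le_of_tendsto ((tendsto_const_nhds.sub (h.tendsto_truncatedT hf hc x)).norm) ?_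
  filter_upwards [Ioc_mem_nhdsGT hb2.1] with a ha
  rw [norm_sub_rev]
  exact hD a b ha.1 ha.2 hb2.2 x

/-- `T₁` is a `limUnder`, so linearity holds only because all the limits involved exist. -/
theorem T₁_sub (h : SingularPhase γ G G₂ τ δ K) {f g : ℝ → ℂ}
    (hf : ContDiff ℝ ∞ f) (hfc : HasCompactSupport f) (hg : ContDiff ℝ ∞ g)
    (hgc : HasCompactSupport g) (x : ℝ) : T₁ γ (f - g) x = T₁ γ f x - T₁ γ g x := by
  refine tendsto_nhds_unique (h.tendsto_truncatedT (hf.sub hg) (hfc.sub hgc) x) ?_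
  refine ((h.tendsto_truncatedT hf hfc x).sub (h.tendsto_truncatedT hg hgc x)).congr' ?_
  filter_upwards [Ioc_mem_nhdsGT h.τ_pos] with ε hε
  exact (h.truncatedT_sub (hf.continuous.integrable_of_hasCompactSupport hfc)
    (hg.continuous.integrable_of_hasCompactSupport hgc) hε.1 (hε.2.trans h.τ_lt_one.le) x).symm

theorem measurable_T₁ (h : SingularPhase γ G G₂ τ δ K) {f : ℝ → ℂ}
    (hf : ContDiff ℝ ∞ f) (hc : HasCompactSupport f) : AEStronglyMeasurable (T₁ γ f) volume := by
  have hu : Tendsto (fun n : ℕ => (1 / ((n : ℝ) + 1))) atTop (𝓝[>] 0) :=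
    tendsto_nhdsWithin_iff.2 ⟨tendsto_one_div_add_atTop_nhds_zero_nat,
      Eventually.of_forall fun n => mem_Ioi.2 (by positivity)⟩
  refine aestronglyMeasurable_of_tendsto_ae atTop
    (f := fun (n : ℕ) x => truncatedT γ (1 / ((n : ℝ) + 1)) f x) (fun n => ?_)
    (Eventually.of_forall fun x => (h.tendsto_truncatedT hf hc x).comp hu)
  have h1 : 1 / ((n : ℝ) + 1) ≤ 1 := by
    rw [div_le_one (by positivity)]; linarith [Nat.cast_nonneg (α := ℝ) n]
  have := truncatedT_eq_kconv γ h1 f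
  change AEStronglyMeasurable (truncatedT γ (1 / ((n : ℝ) + 1)) f) volume
  rw [this]
  exact ((h.bddSupp_oscTrunc (by positivity) le_rfl).kconv
    (hc.bddSupp hf.continuous)).measurable.aestronglyMeasurable

theorem weakType_T₁ (h : SingularPhase γ G G₂ τ δ K) {A : ℝ}
    (hA : ∀ ε : ℝ, 0 < ε → ε ≤ τ → ∀ f : ℝ → ℂ, Integrable f →
      WeakTypeOneOneBound A f (truncatedT γ ε f)) {f : ℝ → ℂ}
    (hf : ContDiff ℝ ∞ f) (hc : HasCompactSupport f) : WeakTypeOneOneBound A f (T₁ γ f) := by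
  have hfi : Integrable f := hf.continuous.integrable_of_hasCompactSupport hc
  refine WeakTypeOneOneBound.of_approx hfi fun η hη => ?_
  obtain ⟨b, hb1, hb2⟩ := ((h.exists_norm_truncatedT_sub_T₁_lt hf hc hη).and
    (Ioc_mem_nhdsGT h.τ_pos)).exists
  refine ⟨f, truncatedT γ b f, hA b hb2.1 hb2.2 f hfi, le_self_add, ?_⟩
  have he : {x | η ≤ ‖T₁ γ f x - truncatedT γ b f x‖} = ∅ := by
    refine eq_empty_of_forall_notMem fun x hx => ?_
    rw [mem_ofPred_eq, norm_sub_rev] at hx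
    exact absurd (hb1 x) (not_lt.2 hx)
  rw [he, measure_empty]
  exact zero_le

end SingularPhase

/-! ### Convergence in measure on `L¹` -/

/-- A sequence whose increments are small off sets of summable measure converges in a uniform way
off small sets. -/
theorem exists_limit_of_measure_dist_le {u : ℕ → ℝ → ℂ} {c : ℝ≥0∞} (hc : c ≠ ⊤)
    (hu : ∀ n, AEStronglyMeasurable (u n) volume)
    (h : ∀ n, volume {x | (1 / 2 : ℝ) ^ n < ‖u n x - u (n + 1) x‖} ≤ c * 2⁻¹ ^ n) :
    ∃ (g : ℝ → ℂ) (U : ℕ → Set ℝ), AEStronglyMeasurable g volume ∧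
      Tendsto (fun n => volume (U n)) atTop (𝓝 0) ∧
      ∀ n x, x ∉ U n → ‖u n x - g x‖ ≤ 2 * (1 / 2) ^ n := by
  set D : ℕ → Set ℝ := fun n => {x | (1 / 2 : ℝ) ^ n < ‖u n x - u (n + 1) x‖} with hD
  -- Off the tail union `U n` every later increment is controlled, so the sequence is geometrically
  -- Cauchy there; by Borel–Cantelli the points lying in all `U n` form a null set.
  set U : ℕ → Set ℝ := fun n => ⋃ k, D (n + k) with hU
  have hUv : ∀ n, volume (U n) ≤ c * 2⁻¹ ^ n * 2 := fun n => by
    calc volume (U n) ≤ ∑' k, volume (D (n + k)) := measure_iUnion_le _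
      _ ≤ ∑' k, c * 2⁻¹ ^ n * 2⁻¹ ^ k := ENNReal.tsum_le_tsum fun k => by
          rw [mul_assoc, ← pow_add]; exact h _
      _ = _ := by
          rw [ENNReal.tsum_mul_left, ENNReal.tsum_geometric, ENNReal.one_sub_inv_two, inv_inv]
  have hUlim : Tendsto (fun n => volume (U n)) atTop (𝓝 0) := by
    have h1 : Tendsto (fun n : ℕ => c * 2⁻¹ ^ n * 2) atTop (𝓝 (c * 0 * 2)) :=
      ENNReal.Tendsto.mul_const (ENNReal.Tendsto.const_mul
        (ENNReal.tendsto_pow_atTop_nhds_zero_of_lt_one (by simp)) (Or.inr hc)) (Or.inr (by simp))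
    rw [mul_zero, zero_mul] at h1
    exact tendsto_of_tendsto_of_tendsto_of_le_of_le tendsto_const_nhds h1 (fun _ => zero_le) hUv
  have hinc : ∀ n x, x ∉ U n → ∀ k, dist (u (n + k) x) (u (n + (k + 1)) x)
      ≤ (1 / 2) ^ n * (1 / 2) ^ k := by
    intro n x hx k
    rw [← pow_add, dist_eq_norm]
    exact not_lt.1 fun hlt => hx (mem_iUnion.2 ⟨k, hlt⟩)
  have hconv : ∀ n x, x ∉ U n → Tendsto (fun k => u k x) atTop
      (𝓝 (limUnder atTop fun k => u k x)) := by
    intro n x hx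
    have hcs := cauchySeq_of_le_geometric (1 / 2) ((1 / 2) ^ n) (by norm_num) (hinc n x hx)
    obtain ⟨a, ha⟩ := cauchySeq_tendsto_of_complete hcs
    refine tendsto_nhds_limUnder ⟨a, ?_⟩
    simp only [add_comm n] at ha
    exact (tendsto_add_atTop_iff_nat n).1 ha
  refine ⟨fun x => limUnder atTop fun k => u k x, U, ?_, hUlim, fun n x hx => ?_⟩
  · refine aestronglyMeasurable_of_tendsto_ae atTop hu ?_
    have hz : volume (⋂ n, U n) = 0 := le_antisymm
      (ge_of_tendsto' hUlim fun n => measure_mono (iInter_subset _ n)) zero_le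
    refine measure_mono_null (fun x hx => ?_) hz
    by_contra hcon
    rw [mem_iInter, not_forall] at hcon
    obtain ⟨n, hn⟩ := hcon
    exact hx (hconv n x hn)
  · have ha : Tendsto (fun k => u (n + k) x) atTop (𝓝 (limUnder atTop fun k => u k x)) := by
      simp only [add_comm n]
      exact (tendsto_add_atTop_iff_nat n).2 (hconv n x hx)
    have := dist_le_of_le_geometric_of_tendsto₀ (1 / 2) ((1 / 2) ^ n) (by norm_num) (hinc n x hx) ha
    rw [dist_eq_norm, add_zero] at this
    refine this.trans (le_of_eq ?_)
    ring

namespace SingularPhase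

variable {γ G G₂ : ℝ → ℝ} {τ δ K : ℝ}

theorem exists_tendstoInMeasure (h : SingularPhase γ G G₂ τ δ K) {A : ℝ} (hA0 : 0 < A)
    (hA : ∀ ε : ℝ, 0 < ε → ε ≤ τ → ∀ f : ℝ → ℂ, Integrable f →
      WeakTypeOneOneBound A f (truncatedT γ ε f)) {f : ℝ → ℂ} (hf : Integrable f) :
    ∃ g : ℝ → ℂ, AEStronglyMeasurable g volume ∧
      TendstoInMeasure volume (fun ε => truncatedT γ ε f) (𝓝[>] (0 : ℝ)) g ∧
      WeakTypeOneOneBound A f g := by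
  -- The rate `4⁻ⁿ` tested at height `2⁻ⁿ` in the weak-type inequality leaves exceptional sets of
  -- measure `O(2⁻ⁿ)`, which are summable.
  have happ := fun n : ℕ => exists_testFunction_approx hf (show 0 < (1 / 4 : ℝ) ^ n by positivity)
  choose F hFs hFc hFf using happ
  have hFi : ∀ n, Integrable (F n) := fun n =>
    (hFs n).continuous.integrable_of_hasCompactSupport (hFc n)
  have hinc : ∀ n, volume {x | (1 / 2 : ℝ) ^ n < ‖T₁ γ (F n) x - T₁ γ (F (n + 1)) x‖}
      ≤ ENNReal.ofReal (2 * A) * 2⁻¹ ^ n := by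
    intro n
    have h1 := h.weakType_T₁ hA (f := F n - F (n + 1)) ((hFs n).sub (hFs (n + 1))) ((hFc n).sub (hFc (n + 1)))
      ((1 / 2) ^ n) (by positivity)
    simp only [h.T₁_sub (hFs n) (hFc n) (hFs (n + 1)) (hFc (n + 1))] at h1
    refine h1.trans ?_
    rw [eLpNorm_one_eq_ofReal ((hFi n).sub (hFi (n + 1))), ← ENNReal.ofReal_mul (by positivity),
      show (2⁻¹ : ℝ≥0∞) = ENNReal.ofReal (1 / 2) by
        rw [one_div, ENNReal.ofReal_inv_of_pos two_pos]; simp,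
      ← ENNReal.ofReal_pow (by norm_num), ← ENNReal.ofReal_mul (by positivity)]
    refine ENNReal.ofReal_le_ofReal ?_
    have h2 : ∫ x, ‖(F n - F (n + 1)) x‖ ≤ 2 * (1 / 4) ^ n := by
      calc ∫ x, ‖(F n - F (n + 1)) x‖ ≤ ∫ x, (‖(f - F n) x‖ + ‖(f - F (n + 1)) x‖) := by
            refine integral_mono ((hFi n).sub (hFi (n + 1))).norm
              ((hf.sub (hFi n)).norm.add (hf.sub (hFi (n + 1))).norm) fun x => ?_
            simp only [Pi.sub_apply]
            calc ‖F n x - F (n + 1) x‖ = ‖(f x - F (n + 1) x) - (f x - F n x)‖ := by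
                  rw [sub_sub_sub_cancel_left]
              _ ≤ ‖f x - F (n + 1) x‖ + ‖f x - F n x‖ := norm_sub_le _ _
              _ = _ := add_comm _ _
        _ = (∫ x, ‖(f - F n) x‖) + ∫ x, ‖(f - F (n + 1)) x‖ :=
            integral_add (hf.sub (hFi n)).norm (hf.sub (hFi (n + 1))).norm
        _ ≤ (1 / 4) ^ n + (1 / 4) ^ n := by
            refine add_le_add (hFf n) ((hFf (n + 1)).trans ?_)
            exact pow_le_pow_of_le_one (by norm_num) (by norm_num) (Nat.le_succ n)
        _ = _ := by ring
    calc A / (1 / 2) ^ n * ∫ x, ‖(F n - F (n + 1)) x‖ ≤ A / (1 / 2) ^ n * (2 * (1 / 4) ^ n) := by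
          gcongr
      _ = 2 * A * (1 / 2) ^ n := by
          rw [show (1 / 4 : ℝ) = 1 / 2 * (1 / 2) by norm_num, mul_pow]
          field_simp
  obtain ⟨g, U, hgm, hU, hg⟩ := exists_limit_of_measure_dist_le ENNReal.ofReal_ne_top
    (fun n => h.measurable_T₁ (hFs n) (hFc n)) hinc
  have hp4 : Tendsto (fun n : ℕ => (1 / 4 : ℝ) ^ n) atTop (𝓝 0) :=
    tendsto_pow_atTop_nhds_zero_of_lt_one (by norm_num) (by norm_num)
  have hp2 : Tendsto (fun n : ℕ => 2 * (1 / 2 : ℝ) ^ n) atTop (𝓝 0) := by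
    simpa using (tendsto_pow_atTop_nhds_zero_of_lt_one (r := (1 / 2 : ℝ)) (by norm_num)
      (by norm_num)).const_mul 2
  refine ⟨g, hgm, ?_, ?_⟩
  · rw [tendstoInMeasure_iff_norm]
    intro η hη
    refine ENNReal.tendsto_nhds_zero.2 fun θ hθ => ?_
    have hlim : Tendsto (fun n => ENNReal.ofReal (A / (η / 4)) * ENNReal.ofReal ((1 / 4) ^ n)
        + volume (U n)) atTop (𝓝 0) := by
      have h1 : Tendsto (fun n : ℕ => ENNReal.ofReal ((1 / 4) ^ n)) atTop (𝓝 0) := by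
        rw [← ENNReal.ofReal_zero]
        exact (ENNReal.continuous_ofReal.tendsto 0).comp hp4
      simpa using (ENNReal.Tendsto.const_mul (a := ENNReal.ofReal (A / (η / 4))) h1 (Or.inr ENNReal.ofReal_ne_top)).add hU
    obtain ⟨n, hn1, hn2⟩ := ((hlim.eventually_lt_const hθ).and
      (hp2.eventually_lt_const (show 0 < η / 4 by positivity))).exists
    filter_upwards [h.exists_norm_truncatedT_sub_T₁_lt (hFs n) (hFc n)
      (show 0 < η / 4 by positivity), Ioc_mem_nhdsGT h.τ_pos] with ε hε1 hε2
    -- Three errors, each at most `η / 4` off the exceptional sets: the truncation of `f - F n` by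
    -- the weak-type bound uniform in `ε`, the truncation error of `F n` uniformly in `x`, and `T₁ γ
    -- (F n) - g` off `U n`. The index `n` is fixed before `ε` tends to `0`.
    have hsub : {x | η ≤ ‖truncatedT γ ε f x - g x‖} ⊆
        {x | η / 4 < ‖truncatedT γ ε (f - F n) x‖} ∪ U n := by
      intro x hx
      by_contra hcon
      simp only [mem_union, mem_ofPred_eq, not_or, not_lt] at hcon hx
      have h1 := hg n x hcon.2
      have h2 := hε1 x
      have h3 := hcon.1
      rw [h.truncatedT_sub hf (hFi n) hε2.1 (hε2.2.trans h.τ_lt_one.le)] at h3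
      have h4 := norm_add₃_le (a := truncatedT γ ε f x - truncatedT γ ε (F n) x)
        (b := truncatedT γ ε (F n) x - T₁ γ (F n) x) (c := T₁ γ (F n) x - g x)
      rw [sub_add_sub_cancel, sub_add_sub_cancel] at h4
      linarith
    calc volume {x | η ≤ ‖truncatedT γ ε f x - g x‖}
        ≤ volume {x | η / 4 < ‖truncatedT γ ε (f - F n) x‖} + volume (U n) :=
          (measure_mono hsub).trans (measure_union_le _ _)
      _ ≤ ENNReal.ofReal (A / (η / 4)) * ENNReal.ofReal ((1 / 4) ^ n) + volume (U n) := by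
          gcongr
          refine (hA ε hε2.1 hε2.2 _ (hf.sub (hFi n)) _ (by positivity)).trans ?_
          rw [eLpNorm_one_eq_ofReal (hf.sub (hFi n))]
          gcongr
          exact hFf n
      _ ≤ θ := hn1.le
  · refine WeakTypeOneOneBound.of_approx hf fun η hη => ?_
    obtain ⟨n, hn1, hn2, hn3⟩ := ((hp4.eventually_lt_const hη).and
      ((hp2.eventually_lt_const hη).and (hU.eventually_lt_const
        (show 0 < ENNReal.ofReal η by simpa using hη)))).exists
    refine ⟨F n, T₁ γ (F n), h.weakType_T₁ hA (hFs n) (hFc n),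
      eLpNorm_le_add_of_integral_sub_le hf (hFi n) ((hFf n).trans hn1.le), ?_⟩
    refine (measure_mono fun x hx => ?_).trans hn3.le
    by_contra hcon
    have h1 := hg n x hcon
    rw [mem_ofPred_eq, norm_sub_rev] at hx
    linarith

end SingularPhase

theorem mainTheorem2 (γ ψ : ℝ → ℝ) (t₀ s₀ C : ℝ) (h : PhaseAssumptions γ ψ t₀ s₀ C) :
    ∃ A : ℝ, 0 < A ∧
      -- on test functions the limit exists at every point, and is of weak type
      (∀ f : ℝ → ℂ, ContDiff ℝ ∞ f → HasCompactSupport f →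
        (∀ x : ℝ, Tendsto (fun ε => truncatedT γ ε f x) (𝓝[>] (0 : ℝ)) (𝓝 (T₁ γ f x))) ∧
        WeakTypeOneOneBound A f (T₁ γ f)) ∧
      -- on all of `L¹` the limit exists in measure, and is of weak type with the same constant
      (∀ f : ℝ → ℂ, Integrable f volume →
        ∃ g : ℝ → ℂ, AEStronglyMeasurable g volume ∧
          TendstoInMeasure volume (fun ε => truncatedT γ ε f) (𝓝[>] (0 : ℝ)) g ∧
          WeakTypeOneOneBound A f g) := by
  obtain ⟨τ, δ, K, hγ⟩ := h.exists_singularPhase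
  obtain ⟨A, hA0, hA⟩ := hγ.exists_weakType_truncatedT
  exact ⟨A, hA0, fun f hf hc => ⟨hγ.tendsto_truncatedT hf hc, hγ.weakType_T₁ hA hf hc⟩,
    fun f hf => hγ.exists_tendstoInMeasure hA0 hA hf⟩
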